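/- Let $n\ge 1$, let $f:\mathbb R\to\mathbb R$, put $F(u)=\int_0^u f(s)\,ds$, and assume: (A1) $f$ is differentiable almost everywhere and $\liminf_{u\to-\infty}\,(f(u)+u)>-\infty$. (A2) There are constants $C_1>0$, $p\ge 1$, $q>1$ such that $|f(u)-f(v)|\le C_1(|u|+|v|)^{p-1}|u-v|$ and $|f(u)|\le C_1|u|^q$ for all $u,v\in\mathbb R$; if $n>4$, then also $p,q<\frac{n+4}{n-4}$. (A3) $\mu\ge 2$ is such that $G(u)=F(u)-\frac1\mu\,uf(u)$ is non-negative and convex on $\mathbb R$; if $\mu=2$, then also $G(u)\ge C_2|f(u)|$ for some $C_2>0$ and all $u\in\mathbb R$. (A4) $u^2f'(u)-uf(u)\le 0$ for almost all $u\in\mathbb R$, with equality if and only if $f(u)=0$. Let $c\in\mathbb R^n$ with $0<|c|<\sqrt2$, and for real-valued $z\in H^2(\mathbb R^n)$ set $$I_c(z)=\frac12\int_{\mathbb R^n}\big((\Delta z)^2-(c\cdot\nabla z)^2+z^2\big)\,dx+\int_{\mathbb R^n}F(z)\,dx,$$ $$P_c(z)=\int_{\mathbb R^n}\big((\Delta z)^2-(c\cdot\nabla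 z)^2+z^2\big)\,dx+\int_{\mathbb R^n}zf(z)\,dx.$$ Let $S_c$ be the set of all $z\in H^2(\mathbb R^n)$, $z\ne0$, at which the Fréchet derivative of $I_c$ on $H^2(\mathbb R^n)$ vanishes. A ground state is a $w\in S_c$ with $I_c(w)\le I_c(u)$ for all $u\in S_c$. (a) If $\mu>2$, then (in every dimension $n\ge1$) there exists a ground state $w$ for which $u(x,t)=w(x+ct)$ is a solution, in the sense of distributions on $\mathbb R^n\times\mathbb R$, of $u_{tt}+\Delta^2u+u+f(u)=0$. (b) If $\mu=2$ and $n\in\{1,2,3\}$, then such a ground state exists as well. Moreover, in any case, $w\in H^2(\mathbb R^n)$ is a ground state if and only if $w$ minimises $I_c$ over the Nehari manifold $\{z\in H^2(\mathbb R^n): z\ne 0,\ P_c(z)=0\}$ (that is, $w$ lies in this set and $I_c(w)\le I_c(z)$ for all $z$ in it). -/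

import Mathlib

open MeasureTheory
open scoped ContDiff

noncomputable section

namespace BeamWave

/-! ### The Sobolev space of order two -/

/-- The space `ℝⁿ` with its Euclidean norm. -/
abbrev Eucl (n : ℕ) : Type := EuclideanSpace ℝ (Fin n)

/-- Real `L²` functions on `ℝⁿ`. -/
abbrev LTwo (n : ℕ) : Type := Lp ℝ 2 (volume : Measure (Eucl n))

/-- `h` is the weak partial derivative of `g` in the `i`-th coordinate direction: one may
integrate by parts against every smooth compactly supported function. -/
def IsWeakPartial {n : ℕ} (i : Fin n) (g h : LTwo n) : Prop :=
  ∀ φ : Eucl n → ℝ, ContDiff ℝ ∞ φ → HasCompactSupport φ →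
    ∫ x, g x * fderiv ℝ φ x (EuclideanSpace.single i 1) = -∫ x, h x * φ x

/-- Index set for a function, its first and its second partial derivatives. -/
abbrev JetIndex (n : ℕ) : Type := Unit ⊕ (Fin n ⊕ (Fin n × Fin n))

/-- Families `(u, (gᵢ)ᵢ, (hᵢⱼ)ᵢⱼ)` of `L²` functions, with norm
`(‖u‖² + ∑ᵢ ‖gᵢ‖² + ∑ᵢⱼ ‖hᵢⱼ‖²) ^ (1/2)`. -/
abbrev Jet (n : ℕ) : Type := PiLp 2 (fun _ : JetIndex n => LTwo n)

/-- The function itself. -/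
def Jet.fn {n : ℕ} (z : Jet n) : LTwo n := z (Sum.inl ())

/-- The entry standing for the `i`-th first partial derivative. -/
def Jet.d1 {n : ℕ} (z : Jet n) (i : Fin n) : LTwo n := z (Sum.inr (Sum.inl i))

/-- The entry standing for the second partial derivative `∂ⱼ∂ᵢ`. -/
def Jet.d2 {n : ℕ} (z : Jet n) (i j : Fin n) : LTwo n := z (Sum.inr (Sum.inr (i, j)))

theorem integrable_mul_test {n : ℕ} (g : LTwo n) {ψ : Eucl n → ℝ} (hc : Continuous ψ)
    (hs : HasCompactSupport ψ) : Integrable (fun x => g x * ψ x) :=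
  (Lp.memLp g).integrable_mul (hc.memLp_of_hasCompactSupport (p := 2) hs)

theorem continuous_test_partial {n : ℕ} {φ : Eucl n → ℝ} (hφ : ContDiff ℝ ∞ φ) (v : Eucl n) :
    Continuous (fun x => fderiv ℝ φ x v) :=
  (hφ.continuous_fderiv (by simp)).clm_apply continuous_const

theorem integral_add_mul_test {n : ℕ} (g g' : LTwo n) {ψ : Eucl n → ℝ} (hc : Continuous ψ)
    (hs : HasCompactSupport ψ) :
    ∫ x, (g + g' : LTwo n) x * ψ x = (∫ x, g x * ψ x) + ∫ x, g' x * ψ x := by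
  rw [← integral_add (integrable_mul_test g hc hs) (integrable_mul_test g' hc hs)]
  refine integral_congr_ae ?_
  filter_upwards [Lp.coeFn_add g g'] with x hx
  rw [hx, Pi.add_apply, add_mul]

theorem integral_smul_mul_test {n : ℕ} (a : ℝ) (g : LTwo n) (ψ : Eucl n → ℝ) :
    ∫ x, (a • g : LTwo n) x * ψ x = a * ∫ x, g x * ψ x := by
  rw [← integral_const_mul]
  refine integral_congr_ae ?_
  filter_upwards [Lp.coeFn_smul a g] with x hx
  rw [hx, Pi.smul_apply, smul_eq_mul, mul_assoc]

theorem IsWeakPartial.zero {n : ℕ} (i : Fin n) : IsWeakPartial i (0 : LTwo n) 0 := by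
  intro φ _ _
  have h : ∀ ψ : Eucl n → ℝ, ∫ x, (0 : LTwo n) x * ψ x = 0 := fun ψ => by
    have h0 := integral_smul_mul_test (0 : ℝ) (0 : LTwo n) ψ
    rwa [zero_smul, zero_mul] at h0
  rw [h, h, neg_zero]

theorem IsWeakPartial.add {n : ℕ} {i : Fin n} {g h g' h' : LTwo n} (H : IsWeakPartial i g h)
    (H' : IsWeakPartial i g' h') : IsWeakPartial i (g + g') (h + h') := by
  intro φ hφ hs
  rw [integral_add_mul_test g g' (continuous_test_partial hφ _) (hs.fderiv_apply ℝ _),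
    integral_add_mul_test h h' hφ.continuous hs, H φ hφ hs, H' φ hφ hs, neg_add]

theorem IsWeakPartial.smul {n : ℕ} {i : Fin n} {g h : LTwo n} (a : ℝ) (H : IsWeakPartial i g h) :
    IsWeakPartial i (a • g) (a • h) := by
  intro φ hφ hs
  rw [integral_smul_mul_test, integral_smul_mul_test, H φ hφ hs, mul_neg]

/-- The real Sobolev space `H²(ℝⁿ)`. An element is an `L²` function together with its weak first
and second partial derivatives, all in `L²` (the derivatives are determined by the function);
the norm is the usual `H²` norm. -/
def HTwo (n : ℕ) : Submodule ℝ (Jet n) where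
  carrier := {z | (∀ i, IsWeakPartial i z.fn (z.d1 i)) ∧
    ∀ i j, IsWeakPartial j (z.d1 i) (z.d2 i j)}
  zero_mem' := ⟨fun i => IsWeakPartial.zero i, fun _ j => IsWeakPartial.zero j⟩
  add_mem' ha hb := ⟨fun i => (ha.1 i).add (hb.1 i), fun i j => (ha.2 i j).add (hb.2 i j)⟩
  smul_mem' a _ hz := ⟨fun i => (hz.1 i).smul a, fun i j => (hz.2 i j).smul a⟩

/-- The Laplacian of `z ∈ H²`. -/
def lapl {n : ℕ} (z : HTwo n) (x : Eucl n) : ℝ := ∑ i, z.1.d2 i i x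

/-- The directional derivative `c · ∇z` of `z ∈ H²`. -/
def dirDeriv {n : ℕ} (c : Eucl n) (z : HTwo n) (x : Eucl n) : ℝ := ∑ i, c i * z.1.d1 i x

/-! ### The nonlinearity -/

/-- The primitive `F(u) = ∫₀ᵘ f`. -/
def primitive (f : ℝ → ℝ) (u : ℝ) : ℝ := ∫ s in (0 : ℝ)..u, f s

/-- `f` is differentiable almost everywhere and `liminf (f(u) + u) > -∞` as `u → -∞`. -/
def A1 (f : ℝ → ℝ) : Prop :=
  (∀ᵐ u : ℝ, DifferentiableAt ℝ f u) ∧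
    ⊥ < Filter.liminf (fun u : ℝ => ((f u + u : ℝ) : EReal)) Filter.atBot

/-- Growth conditions on `f` with exponents that are subcritical for `H²(ℝⁿ)`. -/
def A2 (n : ℕ) (f : ℝ → ℝ) : Prop :=
  ∃ C₁ p q : ℝ, 0 < C₁ ∧ 1 ≤ p ∧ 1 < q ∧
    (∀ u v : ℝ, |f u - f v| ≤ C₁ * (|u| + |v|) ^ (p - 1) * |u - v|) ∧
    (∀ u : ℝ, |f u| ≤ C₁ * |u| ^ q) ∧
    (4 < n → p < ((n : ℝ) + 4) / ((n : ℝ) - 4) ∧ q < ((n : ℝ) + 4) / ((n : ℝ) - 4))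

/-- `G(u) = F(u) - u f(u) / μ`. -/
def gFun (f : ℝ → ℝ) (μ u : ℝ) : ℝ := primitive f u - 1 / μ * (u * f u)

/-- The condition of Ambrosetti–Rabinowitz type with the exponent `μ`. -/
def A3 (f : ℝ → ℝ) (μ : ℝ) : Prop :=
  2 ≤ μ ∧ (∀ u, 0 ≤ gFun f μ u) ∧ ConvexOn ℝ Set.univ (gFun f μ) ∧
    (μ = 2 → ∃ C₂ : ℝ, 0 < C₂ ∧ ∀ u, C₂ * |f u| ≤ gFun f μ u)

/-- `u² f'(u) - u f(u) ≤ 0` for almost all `u`, with equality if and only if `f(u) = 0`. -/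
def A4 (f : ℝ → ℝ) : Prop :=
  ∀ᵐ u : ℝ, u ^ 2 * deriv f u - u * f u ≤ 0 ∧ (u ^ 2 * deriv f u - u * f u = 0 ↔ f u = 0)

/-! ### The action, its critical points and the Nehari manifold -/

/-- `∫ (Δz)² - (c · ∇z)² + z²`. -/
def quadForm {n : ℕ} (c : Eucl n) (z : HTwo n) : ℝ :=
  ∫ x, (lapl z x ^ 2 - dirDeriv c z x ^ 2 + z.1.fn x ^ 2)

/-- The action `I_c`. -/
def action {n : ℕ} (f : ℝ → ℝ) (c : Eucl n) (z : HTwo n) : ℝ :=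
  1 / 2 * quadForm c z + ∫ x, primitive f (z.1.fn x)

/-- The functional `P_c`. -/
def nehariFun {n : ℕ} (f : ℝ → ℝ) (c : Eucl n) (z : HTwo n) : ℝ :=
  quadForm c z + ∫ x, z.1.fn x * f (z.1.fn x)

/-- The set of nontrivial critical points of the action: the Fréchet derivative on `H²(ℝⁿ)`
exists and vanishes there. -/
def critSet {n : ℕ} (f : ℝ → ℝ) (c : Eucl n) : Set (HTwo n) :=
  {z | z ≠ 0 ∧ HasFDerivAt (action f c) (0 : HTwo n →L[ℝ] ℝ) z}

/-- Ground states: nontrivial critical points with least action among these. -/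
def IsGroundState {n : ℕ} (f : ℝ → ℝ) (c : Eucl n) (w : HTwo n) : Prop :=
  w ∈ critSet f c ∧ ∀ u ∈ critSet f c, action f c w ≤ action f c u

/-- The Nehari manifold. -/
def nehari {n : ℕ} (f : ℝ → ℝ) (c : Eucl n) : Set (HTwo n) :=
  {z | z ≠ 0 ∧ nehariFun f c z = 0}

/-- Minimizers of the action over the Nehari manifold. -/
def IsNehariMinimizer {n : ℕ} (f : ℝ → ℝ) (c : Eucl n) (w : HTwo n) : Prop :=
  w ∈ nehari f c ∧ ∀ z ∈ nehari f c, action f c w ≤ action f c z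

/-! ### The wave equation -/

/-- `u = u(t, x)` solves `u_tt + Δ²u + u + f(u) = 0` on `ℝ × ℝⁿ` in the sense of distributions. -/
def IsWeakSolution {n : ℕ} (f : ℝ → ℝ) (u : ℝ × Eucl n → ℝ) : Prop :=
  LocallyIntegrable u ∧ LocallyIntegrable (fun y => f (u y)) ∧
    ∀ ψ : ℝ × Eucl n → ℝ, ContDiff ℝ ∞ ψ → HasCompactSupport ψ →
      ∫ y : ℝ × Eucl n, (u y * (iteratedDeriv 2 (fun s => ψ (s, y.2)) y.1
          + Laplacian.laplacian
              (Laplacian.laplacian (fun x => ψ (y.1, x))) y.2 + ψ y)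
        + f (u y) * ψ y) = 0

/-- The wave `u(t, x) = w(x + t c)` with profile `w` and velocity parameter `c`. -/
def travellingWave {n : ℕ} (c : Eucl n) (w : HTwo n) (y : ℝ × Eucl n) : ℝ :=
  w.1.fn (y.2 + y.1 • c)

end BeamWave

end

/-!
Ground states are the minimizers of the action `I_c` over the Nehari manifold `P_c = 0`, and the
point is to produce such a minimizer.

**Structure of the functionals.** Plancherel's theorem gives `2 ∑ᵢ ‖∂ᵢz‖² ≤ ‖Δz‖² + ‖z‖²`, so the
quadratic form is coercive on `H²` for `|c| < √2` (`quadForm_coercive`). The differential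
inequality `A4` says that `f(u) / u` is monotone on each half-line; hence `u f(u) ≤ 0`, and for
`z` on the Nehari manifold `P_c(t z)` is positive for `0 < t < 1` and negative for `t > 1`
(`mul_nonpos_and_scale`). It follows that the action is maximal along a ray at its point on the
Nehari manifold, and a minimizer over the manifold is a free critical point: otherwise a descent
direction, followed by a rescaling, would lower the action (`Setup.mem_critSet_of_minimizer`).
The manifold is not empty, because by `A1` and `c ≠ 0` large negative multiples of a slowly varying
bump have `P_c < 0` (`Setup.nehari_nonempty`).

**Coercivity on the Nehari manifold.** There `I_c` equals `I_c - P_c / μ`, which is `1/2 - 1/μ`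
times the quadratic form plus `∫ G(z)`. If `μ > 2` this controls the norm at once. If `μ = 2`,
only `∫ G(z)` is left; convexity of `G` yields `-u f(u) ≤ 2 C k ^ (q - 1) |u| ^ (q + 1) + (4 / k)
G(u)` for `0 < k ≤ 1` (`neg_mul_le`), and choosing `k` of size `1 / ‖z‖` shows that `I_c` still
controls `‖z‖` linearly (`Setup.exists_mul_norm_le`). This works in every dimension.

**Compactness.** A minimizing sequence is bounded and does not tend to zero in `L^(q+1)`. Since
`q` is subcritical, high frequencies contribute little to the `L^(q+1)` norm, so a low-pass filter
of the sequence is bounded below at some points (`exists_lowPass_ge`); translating these to the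
origin gives a nonzero weak limit `w`. By Brezis–Lieb splitting (`tendsto_integral_sub`) the
functionals split into the parts of `w` and of the remainder. If `P_c(w) > 0`, the remainder would
have `P_c < 0` with a gap, and a uniform rescaling would push it to the manifold below the minimal
action. So `P_c(w) ≤ 0`, and the rescaling of `w` to the manifold is a minimizer
(`Setup.exists_minimizer`), because `I_c - P_c / μ` does not increase when scaling down.

**The wave equation.** In the moving frame a test function turns into a family of test functions
indexed by time; its time derivatives factor so that `∂ₜ² - (c · ∇)²` is a total time derivative,
and the rest is the critical point equation at each time (`Setup.isWeakSolution`).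
-/

noncomputable section

namespace BeamWave

open Filter Topology

/-! ### Weak derivatives on the Fourier side -/

section

/-- A weak partial derivative may be tested against smooth functions that are merely square
integrable together with the derivative in question. -/
theorem IsWeakPartial.integral_eq {n : ℕ} {i : Fin n} {g h : LTwo n} (H : IsWeakPartial i g h)
    {ψ : Eucl n → ℝ} (hψ : ContDiff ℝ ∞ ψ) (h2 : MemLp ψ 2)
    (h2' : MemLp (fun x => fderiv ℝ ψ x (EuclideanSpace.single i 1)) 2) :
    ∫ x, g x * fderiv ℝ ψ x (EuclideanSpace.single i 1) = -∫ x, h x * ψ x := by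
  set e : Eucl n := EuclideanSpace.single i 1
  -- cut off with `c k x = χ (a k • x)`; the derivative of the cutoff carries the factor `a k → 0`
  let χ : ContDiffBump (0 : Eucl n) := ⟨1, 2, one_pos, one_lt_two⟩
  have hχ : ContDiff ℝ ∞ (χ : Eucl n → ℝ) := χ.contDiff
  have hχd : Continuous (fun x => fderiv ℝ (χ : Eucl n → ℝ) x e) := continuous_test_partial hχ e
  obtain ⟨M, hM⟩ : ∃ M, ∀ x, ‖fderiv ℝ (χ : Eucl n → ℝ) x e‖ ≤ M :=
    (χ.hasCompactSupport.fderiv_apply ℝ e).exists_bound_of_continuous hχd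
  have hM0 : 0 ≤ M := (norm_nonneg _).trans (hM 0)
  let a : ℕ → ℝ := fun k => ((k : ℝ) + 1)⁻¹
  have ha0 : ∀ k, 0 < a k := fun k => by positivity
  have ha1 : ∀ k, a k ≤ 1 := fun k => inv_le_one_of_one_le₀ (by linarith [k.cast_nonneg (α := ℝ)])
  have hat : Tendsto a atTop (𝓝 0) := by
    simpa [a, one_div] using tendsto_one_div_add_atTop_nhds_zero_nat (𝕜 := ℝ)
  let c : ℕ → Eucl n → ℝ := fun k x => χ (a k • x)
  have hc : ∀ k, ContDiff ℝ ∞ (c k) := fun k => hχ.comp (contDiff_const_smul (a k))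
  have hcs : ∀ k, HasCompactSupport (c k) := fun k =>
    χ.hasCompactSupport.comp_smul (ha0 k).ne'
  have hcd : ∀ k x, fderiv ℝ (c k) x e = a k * fderiv ℝ (χ : Eucl n → ℝ) (a k • x) e := by
    intro k x
    have h1 : HasFDerivAt (fun y : Eucl n => a k • y) (a k • ContinuousLinearMap.id ℝ (Eucl n)) x :=
      (hasFDerivAt_id x).const_smul (a k)
    have h2 : HasFDerivAt (χ : Eucl n → ℝ) (fderiv ℝ (χ : Eucl n → ℝ) (a k • x)) (a k • x) :=
      (hχ.differentiable (by simp) _).hasFDerivAt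
    have h3 : fderiv ℝ (c k) x = _ := (h2.comp x h1).fderiv
    rw [h3]
    simp
  have hct : ∀ x, Tendsto (fun k => c k x) atTop (𝓝 1) := by
    intro x
    have : Tendsto (fun k => c k x) atTop (𝓝 (χ ((0 : ℝ) • x))) :=
      (hχ.continuous.tendsto _).comp (hat.smul_const x)
    have h1 : χ ((0 : ℝ) • x) = 1 := by
      rw [zero_smul]; exact χ.one_of_mem_closedBall (by simp [χ])
    rwa [h1] at this
  have hc1 : ∀ k x, ‖c k x‖ ≤ 1 := fun k x => by
    rw [Real.norm_of_nonneg χ.nonneg]; exact χ.le_one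
  have hprod : ∀ k x, fderiv ℝ (fun y => c k y * ψ y) x e
      = c k x * fderiv ℝ ψ x e + fderiv ℝ (c k) x e * ψ x := by
    intro k x
    have := ((hc k).differentiable (by simp) x).hasFDerivAt.mul
      (hψ.differentiable (by simp) x).hasFDerivAt
    have h3 : fderiv ℝ (fun y => c k y * ψ y) x = _ := this.fderiv
    rw [h3]
    simp [mul_comm]
  have key : ∀ k, ∫ x, g x * (c k x * fderiv ℝ ψ x e + fderiv ℝ (c k) x e * ψ x)
      = -∫ x, h x * (c k x * ψ x) := by
    intro k
    rw [← H _ ((hc k).mul hψ) (hcs k).mul_right]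
    exact integral_congr_ae (Eventually.of_forall fun x => by simp only [hprod, e])
  have hg := Lp.memLp g
  have hh := Lp.memLp h
  have L : Tendsto (fun k => ∫ x, g x * (c k x * fderiv ℝ ψ x e + fderiv ℝ (c k) x e * ψ x)) atTop
      (𝓝 (∫ x, g x * fderiv ℝ ψ x e)) := by
    refine tendsto_integral_of_dominated_convergence
      (fun x => |g x * fderiv ℝ ψ x e| + M * |g x * ψ x|) ?_ ?_ ?_ ?_
    · intro k
      exact hg.1.mul (((hc k).continuous.aestronglyMeasurable.mul h2'.1).add
        ((continuous_test_partial (hc k) e).aestronglyMeasurable.mul h2.1))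
    · exact (hg.integrable_mul h2').abs.add ((hg.integrable_mul h2).abs.const_mul M)
    · intro k
      refine Eventually.of_forall fun x => ?_
      rw [mul_add]
      refine (norm_add_le _ _).trans (add_le_add ?_ ?_)
      · rw [norm_mul, norm_mul, abs_mul, Real.norm_eq_abs (g x)]
        exact mul_le_mul_of_nonneg_left (mul_le_of_le_one_left (norm_nonneg _) (hc1 k x))
          (abs_nonneg _)
      · rw [norm_mul, norm_mul, hcd, norm_mul, abs_mul, Real.norm_eq_abs, Real.norm_eq_abs (ψ x),
          Real.norm_of_nonneg (ha0 k).le]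
        have : a k * ‖fderiv ℝ (χ : Eucl n → ℝ) (a k • x) e‖ ≤ M := by
          have h5 := hM (a k • x)
          have h6 := norm_nonneg (fderiv ℝ (χ : Eucl n → ℝ) (a k • x) e)
          nlinarith [ha1 k, ha0 k]
        calc |g x| * (a k * ‖fderiv ℝ (χ : Eucl n → ℝ) (a k • x) e‖ * |ψ x|)
            ≤ |g x| * (M * |ψ x|) := by gcongr
          _ = M * (|g x| * |ψ x|) := by ring
    · refine Eventually.of_forall fun x => ?_
      have h0 : Tendsto (fun k => fderiv ℝ (c k) x e) atTop (𝓝 0) := by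
        refine squeeze_zero_norm (a := fun k => a k * M) (fun k => ?_)
            (by simpa using hat.mul_const M)
        rw [hcd, norm_mul, Real.norm_of_nonneg (ha0 k).le]
        exact mul_le_mul_of_nonneg_left (hM _) (ha0 k).le
      simpa using (((hct x).mul_const (fderiv ℝ ψ x e)).add (h0.mul_const (ψ x))).const_mul (g x)
  have R : Tendsto (fun k => ∫ x, h x * (c k x * ψ x)) atTop (𝓝 (∫ x, h x * ψ x)) := by
    refine tendsto_integral_of_dominated_convergence (fun x => |h x * ψ x|) ?_ ?_ ?_ ?_
    · intro k
      exact hh.1.mul ((hc k).continuous.aestronglyMeasurable.mul h2.1)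
    · exact (hh.integrable_mul h2).abs
    · intro k
      refine Eventually.of_forall fun x => ?_
      rw [norm_mul, norm_mul, abs_mul, Real.norm_eq_abs (h x)]
      exact mul_le_mul_of_nonneg_left (mul_le_of_le_one_left (norm_nonneg _) (hc1 k x))
        (abs_nonneg _)
    · refine Eventually.of_forall fun x => ?_
      simpa using ((hct x).mul_const (ψ x)).const_mul (h x)
  refine tendsto_nhds_unique L ?_
  simp_rw [key]
  exact R.neg

/-- Complex square integrable functions on `ℝⁿ`. -/
abbrev CTwo (n : ℕ) : Type := Lp ℂ 2 (volume : Measure (Eucl n))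

/-- A real square integrable function viewed as a complex one. -/
def cplx {n : ℕ} : LTwo n →L[ℝ] CTwo n := Complex.ofRealCLM.compLpL 2 volume

theorem coeFn_cplx {n : ℕ} (g : LTwo n) : cplx g =ᵐ[volume] fun x => (g x : ℂ) :=
  Complex.ofRealCLM.coeFn_compLpL g

theorem norm_cplx {n : ℕ} (g : LTwo n) : ‖cplx g‖ = ‖g‖ := by
  rw [Lp.norm_def, Lp.norm_def]
  congr 1
  refine eLpNorm_congr_norm_ae ?_
  filter_upwards [coeFn_cplx g] with x hx
  rw [hx, Complex.norm_real]

open SchwartzMap FourierTransform LineDeriv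

/-- Complex-valued Schwartz functions are admissible test functions: their real and imaginary parts
    are
smooth and square integrable together with their derivatives. -/
theorem IsWeakPartial.schwartz {n : ℕ} {i : Fin n} {g h : LTwo n} (H : IsWeakPartial i g h)
    (ψ : 𝓢(Eucl n, ℂ)) :
    ∫ x, ψ x * (h x : ℂ) = -∫ x, (∂_{(EuclideanSpace.single i 1 : Eucl n)} ψ) x * (g x : ℂ) := by
  set e : Eucl n := EuclideanSpace.single i 1
  have hψ2 : MemLp ψ 2 := ψ.memLp 2
  have hd2 : MemLp (∂_{e} ψ : 𝓢(Eucl n, ℂ)) 2 := (∂_{e} ψ : 𝓢(Eucl n, ℂ)).memLp 2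
  have hde : ∀ x, (∂_{e} ψ) x = fderiv ℝ ψ x e :=
      fun x => SchwartzMap.lineDerivOp_apply_eq_fderiv e ψ x
  have part : ∀ L : ℂ →L[ℝ] ℝ, ∫ x, h x * L (ψ x) = -∫ x, g x * L ((∂_{e} ψ) x) := by
    intro L
    have hs : ContDiff ℝ ∞ (fun x => L (ψ x)) := L.contDiff.comp (ψ.smooth ⊤)
    have hfd : ∀ x, fderiv ℝ (fun x => L (ψ x)) x e = L ((∂_{e} ψ) x) := by
      intro x
      have : HasFDerivAt (fun x => L (ψ x)) (L.comp (fderiv ℝ ψ x)) x :=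
        L.hasFDerivAt.comp x (ψ.differentiable x).hasFDerivAt
      rw [this.fderiv, hde]; rfl
    have := H.integral_eq hs (L.comp_memLp' hψ2) (by
      have := L.comp_memLp' hd2
      refine this.ae_eq (Eventually.of_forall fun x => ?_)
      exact (hfd x).symm)
    rw [← neg_eq_iff_eq_neg, ← this]
    exact integral_congr_ae (Eventually.of_forall fun x => by simp only [← hfd, e])
  have hc : ∀ g : LTwo n, MemLp (fun x => (g x : ℂ)) 2 := fun g =>
    Complex.ofRealCLM.comp_memLp' (Lp.memLp g)
  have i1 : Integrable (fun x => ψ x * (h x : ℂ)) := hψ2.integrable_mul (hc h)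
  have i2 : Integrable (fun x => (∂_{e} ψ) x * (g x : ℂ)) := hd2.integrable_mul (hc g)
  have hre := part Complex.reCLM
  have him := part Complex.imCLM
  apply Complex.ext
  · have e1 := Complex.reCLM.integral_comp_comm i1
    have e2 := Complex.reCLM.integral_comp_comm i2
    simp only [Complex.reCLM_apply, Complex.mul_re, Complex.ofReal_re, Complex.ofReal_im, mul_zero,
      sub_zero] at e1 e2 hre
    rw [Complex.neg_re, ← e1, ← e2]
    simpa only [mul_comm] using hre
  · have e1 := Complex.imCLM.integral_comp_comm i1
    have e2 := Complex.imCLM.integral_comp_comm i2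
    simp only [Complex.imCLM_apply, Complex.mul_im, Complex.ofReal_re, Complex.ofReal_im, mul_zero,
      zero_add] at e1 e2 him
    rw [Complex.neg_im, ← e1, ← e2]
    simpa only [mul_comm] using him

/-- The Fourier transform turns a weak partial derivative into multiplication by `2πi ξᵢ`. -/
theorem IsWeakPartial.fourier_ae {n : ℕ} {i : Fin n} {g h : LTwo n} (H : IsWeakPartial i g h) :
    ∀ᵐ ξ : Eucl n, (𝓕 (cplx h) : CTwo n) ξ
      = (2 * Real.pi * Complex.I) * (ξ i : ℂ) * (𝓕 (cplx g) : CTwo n) ξ := by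
  set e : Eucl n := EuclideanSpace.single i 1
  -- the identity `h = ∂ᵢ g` of tempered distributions is transformed and read off in `L²`
  have hD : ((cplx h : CTwo n) : 𝓢'(Eucl n, ℂ)) = ∂_{e} ((cplx g : CTwo n) : 𝓢'(Eucl n, ℂ)) := by
    ext ψ
    rw [TemperedDistribution.lineDerivOp_apply_apply, Lp.toTemperedDistribution_apply,
      Lp.toTemperedDistribution_apply]
    have e1 : ∫ x, ψ x • (cplx h : CTwo n) x = ∫ x, ψ x * (h x : ℂ) := by
      refine integral_congr_ae ?_
      filter_upwards [coeFn_cplx h] with x hx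
      rw [hx, smul_eq_mul]
    have e2 : ∫ x, (-∂_{e} ψ) x • (cplx g : CTwo n) x = ∫ x, -((∂_{e} ψ) x * (g x : ℂ)) := by
      refine integral_congr_ae ?_
      filter_upwards [coeFn_cplx g] with x hx
      rw [hx, smul_eq_mul, _root_.neg_apply, neg_mul]
    rw [e1, e2, integral_neg]
    exact H.schwartz ψ
  have hF := congrArg (fun T => 𝓕 T) hD
  simp only [TemperedDistribution.fourier_lineDerivOp_eq, Lp.fourier_toTemperedDistribution_eq]
      at hF
  have hi : ∀ ξ : Eucl n, inner ℝ ξ e = ξ i := fun ξ => by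
    simp [e, EuclideanSpace.inner_single_right]
  have hloc : LocallyIntegrable (𝓕 (cplx g) : CTwo n) :=
    (Lp.memLp _).locallyIntegrable (by norm_num)
  refine ae_eq_of_integral_contDiff_smul_eq ((Lp.memLp _).locallyIntegrable (by norm_num)) ?_ ?_
  · have := hloc.continuous_mul (g := fun ξ : Eucl n => (2 * Real.pi * Complex.I) * (ξ i : ℂ))
      (by fun_prop)
    exact this
  · intro φ hφ hs
    have hs' : HasCompactSupport (fun x => (φ x : ℂ)) := hs.comp_left (g := ((↑) : ℝ → ℂ)) (by simp)
    let ψ : 𝓢(Eucl n, ℂ) := hs'.toSchwartzMap (Complex.ofRealCLM.contDiff.comp hφ)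
    have h1 := DFunLike.congr_fun hF ψ
    have htg : Function.HasTemperateGrowth (fun ξ : Eucl n => inner ℝ ξ e) := by fun_prop
    have htg' : Function.HasTemperateGrowth (fun ξ : Eucl n => ((inner ℝ ξ e : ℝ) : ℂ)) :=
        by fun_prop
    have hψ : ∀ x, ψ x = (φ x : ℂ) := fun x => rfl
    rw [Lp.toTemperedDistribution_apply] at h1
    have h2 : ((2 * Real.pi * Complex.I) • TemperedDistribution.smulLeftCLM ℂ
        (fun ξ : Eucl n => ((inner ℝ ξ e : ℝ) : ℂ))
        (((𝓕 (cplx g) : CTwo n)) : 𝓢'(Eucl n, ℂ))) ψ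
        = (2 * Real.pi * Complex.I) * ∫ ξ, (ξ i : ℂ) * φ ξ * (𝓕 (cplx g) : CTwo n) ξ := by
      change (2 * Real.pi * Complex.I) • (TemperedDistribution.smulLeftCLM ℂ
        (fun ξ : Eucl n => ((inner ℝ ξ e : ℝ) : ℂ))
        (((𝓕 (cplx g) : CTwo n)) : 𝓢'(Eucl n, ℂ))) ψ = _
      rw [TemperedDistribution.smulLeftCLM_apply_apply, Lp.toTemperedDistribution_apply,
          smul_eq_mul]
      congr 1
      refine integral_congr_ae (Eventually.of_forall fun ξ => ?_)
      dsimp only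
      rw [SchwartzMap.smulLeftCLM_apply_apply htg', hψ]
      simp only [smul_eq_mul, hi]
    rw [h2] at h1
    calc ∫ x, φ x • (𝓕 (cplx h) : CTwo n) x = ∫ x, ψ x • (𝓕 (cplx h) : CTwo n) x := by
          refine integral_congr_ae (Eventually.of_forall fun ξ => ?_)
          simp [hψ]
      _ = _ := h1
      _ = _ := by
          rw [← integral_const_mul]
          refine integral_congr_ae (Eventually.of_forall fun ξ => ?_)
          simp only [Complex.real_smul]
          ring

end

/-! ### The Hilbert space structure of `H²` and coercivity of the quadratic form -/

section

open SchwartzMap FourierTransform LineDeriv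

theorem sq_norm_eq_integral {n : ℕ} {F : Type*} [NormedAddCommGroup F]
    (g : Lp F 2 (volume : Measure (Eucl n))) :
    ‖g‖ ^ 2 = ∫ x, ‖g x‖ ^ 2 := by
  have := (Lp.memLp g).eLpNorm_eq_integral_rpow_norm (by norm_num) (by norm_num)
  rw [Lp.norm_def, this, ENNReal.toReal_ofReal (by positivity), ENNReal.toReal_ofNat,
    ← Real.rpow_natCast, ← Real.rpow_mul (integral_nonneg fun x => by positivity)]
  norm_num

theorem integrable_sq_norm {n : ℕ} {F : Type*} [NormedAddCommGroup F]
    (g : Lp F 2 (volume : Measure (Eucl n))) :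
    Integrable (fun x => ‖g x‖ ^ 2) :=
  (memLp_two_iff_integrable_sq_norm (Lp.memLp g).1).1 (Lp.memLp g)

/-- The inclusion of `H²` into `L²`. -/
def fnL {n : ℕ} : HTwo n →L[ℝ] LTwo n :=
  (PiLp.proj 2 (fun _ : JetIndex n => LTwo n) (Sum.inl ()) : Jet n →L[ℝ] LTwo n).comp
    (HTwo n).subtypeL

/-- The first partial derivatives as continuous operators from `H²` to `L²`. -/
def d1L {n : ℕ} (i : Fin n) : HTwo n →L[ℝ] LTwo n :=
  (PiLp.proj 2 (fun _ : JetIndex n => LTwo n) (Sum.inr (Sum.inl i)) : Jet n →L[ℝ] LTwo n).comp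
    (HTwo n).subtypeL

/-- The second partial derivatives as continuous operators from `H²` to `L²`. -/
def d2L {n : ℕ} (i j : Fin n) : HTwo n →L[ℝ] LTwo n :=
  (PiLp.proj 2 (fun _ : JetIndex n => LTwo n) (Sum.inr (Sum.inr (i, j))) : Jet n →L[ℝ] LTwo n).comp
    (HTwo n).subtypeL

/-- The Laplacian as a continuous operator from `H²` to `L²`. -/
def laplL {n : ℕ} : HTwo n →L[ℝ] LTwo n := ∑ i, d2L i i

/-- The directional derivative `c · ∇` as a continuous operator from `H²` to `L²`. -/
def dirL {n : ℕ} (c : Eucl n) : HTwo n →L[ℝ] LTwo n := ∑ i, c i • d1L i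

theorem fnL_apply {n : ℕ} (z : HTwo n) : fnL z = z.1.fn := rfl
theorem d1L_apply {n : ℕ} (i : Fin n) (z : HTwo n) : d1L i z = z.1.d1 i := rfl
theorem d2L_apply {n : ℕ} (i j : Fin n) (z : HTwo n) : d2L i j z = z.1.d2 i j := rfl

theorem coeFn_finset_sum {n : ℕ} {ι F : Type*} [NormedAddCommGroup F] (s : Finset ι)
    (g : ι → Lp F 2 (volume : Measure (Eucl n))) :
    ((∑ i ∈ s, g i : Lp F 2 (volume : Measure (Eucl n))) : Eucl n → F)
      =ᵐ[volume] fun x => ∑ i ∈ s, g i x := by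
  classical
  induction s using Finset.induction_on with
  | empty =>
    simp only [Finset.sum_empty]
    exact Lp.coeFn_zero _ _ _
  | insert a s ha ih =>
    rw [Finset.sum_insert ha]
    filter_upwards [Lp.coeFn_add (g a) (∑ i ∈ s, g i), ih] with x h1 h2
    rw [h1, Pi.add_apply, h2, Finset.sum_insert ha]

theorem coeFn_laplL {n : ℕ} (z : HTwo n) : laplL z =ᵐ[volume] lapl z := by
  have : laplL z = ∑ i, z.1.d2 i i := by simp [laplL, d2L_apply]
  rw [this]
  exact coeFn_finset_sum _ _

theorem coeFn_dirL {n : ℕ} (c : Eucl n) (z : HTwo n) : dirL c z =ᵐ[volume] dirDeriv c z := by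
  have : dirL c z = ∑ i, c i • z.1.d1 i := by simp [dirL, d1L_apply]
  rw [this]
  have h : ∀ᵐ x : Eucl n, ∀ i, (c i • z.1.d1 i : LTwo n) x = c i * z.1.d1 i x := by
    rw [ae_all_iff]
    intro i
    exact Lp.coeFn_smul _ _
  filter_upwards [coeFn_finset_sum Finset.univ (fun i => c i • z.1.d1 i), h] with x hx hx'
  rw [hx, dirDeriv]
  exact Finset.sum_congr rfl fun i _ => hx' i

theorem sq_norm_htwo {n : ℕ} (z : HTwo n) :
    ‖z‖ ^ 2 = ‖fnL z‖ ^ 2 + ∑ i, ‖d1L i z‖ ^ 2 + ∑ i, ∑ j, ‖d2L i j z‖ ^ 2 := by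
  have : ‖z‖ ^ 2 = ‖(z : Jet n)‖ ^ 2 := rfl
  rw [this, PiLp.norm_sq_eq_of_L2, Fintype.sum_sum_type, Fintype.sum_sum_type,
    Fintype.sum_prod_type, ← add_assoc]
  simp
  rfl

theorem quadForm_eq {n : ℕ} (c : Eucl n) (z : HTwo n) :
    quadForm c z = ‖laplL z‖ ^ 2 - ‖dirL c z‖ ^ 2 + ‖fnL z‖ ^ 2 := by
  have i1 := integrable_sq_norm (laplL z)
  have i2 := integrable_sq_norm (dirL c z)
  have e : ∫ x, (‖laplL z x‖ ^ 2 - ‖dirL c z x‖ ^ 2 + ‖fnL z x‖ ^ 2) = _ :=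
    integral_add (i1.sub i2) (integrable_sq_norm (fnL z))
  rw [sq_norm_eq_integral, sq_norm_eq_integral, sq_norm_eq_integral, ← integral_sub i1 i2, ← e,
    quadForm]
  refine integral_congr_ae ?_
  filter_upwards [coeFn_laplL z, coeFn_dirL c z] with x h1 h2
  simp only [Real.norm_eq_abs, sq_abs, h1, h2, fnL_apply]

/-- The Fourier transform of a real square integrable function. -/
def hat {n : ℕ} (g : LTwo n) : CTwo n := 𝓕 (cplx g)

theorem norm_hat {n : ℕ} (g : LTwo n) : ‖hat g‖ = ‖g‖ := by
  rw [hat, Lp.norm_fourier_eq, norm_cplx]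

theorem hat_d1 {n : ℕ} (i : Fin n) (z : HTwo n) : ∀ᵐ ξ : Eucl n,
    hat (d1L i z) ξ = (2 * Real.pi * Complex.I) * (ξ i : ℂ) * hat (fnL z) ξ :=
  (z.2.1 i).fourier_ae

theorem hat_d2 {n : ℕ} (i j : Fin n) (z : HTwo n) : ∀ᵐ ξ : Eucl n,
    hat (d2L i j z) ξ = -((2 * Real.pi) ^ 2 * (ξ i * ξ j) : ℝ) * hat (fnL z) ξ := by
  filter_upwards [(z.2.2 i j).fourier_ae, hat_d1 i z] with ξ h1 h2
  change hat (d2L i j z) ξ = _ at h1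
  change hat (d2L i j z) ξ = (2 * Real.pi * Complex.I) * (ξ j : ℂ) * hat (d1L i z) ξ at h1
  rw [h1, h2]
  push_cast
  linear_combination (4 * Real.pi ^ 2 * (ξ i : ℂ) * ξ j * hat (fnL z) ξ) * Complex.I_sq

theorem coeFn_hat_sum {n : ℕ} {ι : Type*} (s : Finset ι) (g : ι → LTwo n) :
    hat (∑ i ∈ s, g i) =ᵐ[volume] fun ξ => ∑ i ∈ s, hat (g i) ξ := by
  have : hat (∑ i ∈ s, g i) = ∑ i ∈ s, hat (g i) := by
    simp only [hat, map_sum]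
    exact map_sum (Lp.fourierTransformₗᵢ (Eucl n) ℂ) _ _
  rw [this]
  exact coeFn_finset_sum _ _

theorem hat_lapl {n : ℕ} (z : HTwo n) : ∀ᵐ ξ : Eucl n,
    hat (laplL z) ξ = -((2 * Real.pi) ^ 2 * ‖ξ‖ ^ 2 : ℝ) * hat (fnL z) ξ := by
  have h : ∀ᵐ ξ : Eucl n, ∀ i, hat (d2L i i z) ξ
      = -((2 * Real.pi) ^ 2 * (ξ i * ξ i) : ℝ) * hat (fnL z) ξ :=
    ae_all_iff.2 fun i => hat_d2 i i z
  have h0 : laplL z = ∑ i, d2L i i z := by simp [laplL]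
  rw [h0]
  filter_upwards [coeFn_hat_sum Finset.univ (fun i => d2L i i z), h] with ξ h1 h2
  rw [h1, EuclideanSpace.real_norm_sq_eq]
  simp only [h2]
  rw [← Finset.sum_mul]
  congr 1
  push_cast
  rw [Finset.sum_neg_distrib, Finset.mul_sum]
  simp [sq]

/-- The Hessian and the Laplacian have the same `L²` norm, since `∑ (ξᵢ ξⱼ)² = |ξ|⁴`. -/
theorem sum_sq_norm_d2 {n : ℕ} (z : HTwo n) : ∑ i, ∑ j, ‖d2L i j z‖ ^ 2 = ‖laplL z‖ ^ 2 := by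
  simp only [← norm_hat, sq_norm_eq_integral]
  have h : ∀ᵐ ξ : Eucl n, ∀ i j, hat (d2L i j z) ξ
      = -((2 * Real.pi) ^ 2 * (ξ i * ξ j) : ℝ) * hat (fnL z) ξ :=
    ae_all_iff.2 fun i => ae_all_iff.2 fun j => hat_d2 i j z
  have e : ∀ i, ∑ j, ∫ ξ, ‖hat (d2L i j z) ξ‖ ^ 2 = ∫ ξ, ∑ j, ‖hat (d2L i j z) ξ‖ ^ 2 := fun i =>
    (integral_finsetSum _ fun j _ => integrable_sq_norm _).symm
  simp only [e]
  rw [← integral_finsetSum _ fun i _ => integrable_finsetSum _ fun j _ => integrable_sq_norm _]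
  refine integral_congr_ae ?_
  filter_upwards [h, hat_lapl z] with ξ h1 h2
  rw [h2]
  simp only [h1, norm_mul, norm_neg, Complex.norm_real, mul_pow, Real.norm_eq_abs, sq_abs,
    EuclideanSpace.real_norm_sq_eq]
  simp only [← Finset.sum_mul, ← Finset.mul_sum]
  rw [sq (∑ i, _)]

/-- Interpolation of the gradient, from `2 s ≤ s² + 1` for `s = (2π|ξ|)²`. The constant `1 / 2` is
what makes `√2` the critical speed. -/
theorem sum_sq_norm_d1_le {n : ℕ} (z : HTwo n) :
    ∑ i, ‖d1L i z‖ ^ 2 ≤ 1 / 2 * (‖laplL z‖ ^ 2 + ‖fnL z‖ ^ 2) := by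
  simp only [← norm_hat, sq_norm_eq_integral]
  rw [← integral_finsetSum _ fun i _ => integrable_sq_norm _,
    ← integral_add (integrable_sq_norm _) (integrable_sq_norm _), ← integral_const_mul]
  have h : ∀ᵐ ξ : Eucl n, ∀ i, hat (d1L i z) ξ
      = (2 * Real.pi * Complex.I) * (ξ i : ℂ) * hat (fnL z) ξ :=
    ae_all_iff.2 fun i => hat_d1 i z
  refine integral_mono_ae (integrable_finsetSum _ fun i _ => integrable_sq_norm _)
    (((integrable_sq_norm _).add (integrable_sq_norm _)).const_mul _) ?_
  filter_upwards [h, hat_lapl z] with ξ h1 h2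
  have h3 : ∑ i, ‖hat (d1L i z) ξ‖ ^ 2 = (2 * Real.pi) ^ 2 * ‖ξ‖ ^ 2 * ‖hat (fnL z) ξ‖ ^ 2 := by
    rw [EuclideanSpace.real_norm_sq_eq]
    simp only [h1, norm_mul, Complex.norm_real, Complex.norm_I, mul_one, mul_pow, Real.norm_eq_abs,
      sq_abs, Complex.norm_ofNat]
    simp only [← Finset.sum_mul, ← Finset.mul_sum]
  simp only [h3]
  rw [h2, norm_mul, norm_neg, Complex.norm_real, Real.norm_eq_abs,
    mul_pow |(2 * Real.pi) ^ 2 * ‖ξ‖ ^ 2|, sq_abs]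
  nlinarith [mul_nonneg (sq_nonneg ((2 * Real.pi) ^ 2 * ‖ξ‖ ^ 2 - 1)) (sq_nonneg ‖hat (fnL z) ξ‖)]

theorem sq_norm_dirL_le {n : ℕ} (c : Eucl n) (z : HTwo n) :
    ‖dirL c z‖ ^ 2 ≤ ‖c‖ ^ 2 * ∑ i, ‖d1L i z‖ ^ 2 := by
  have h0 : dirL c z = ∑ i, c i • d1L i z := by simp [dirL]
  have h1 : ‖dirL c z‖ ≤ ∑ i, |c i| * ‖d1L i z‖ := by
    rw [h0]
    refine (norm_sum_le _ _).trans (le_of_eq ?_)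
    simp [norm_smul]
  calc ‖dirL c z‖ ^ 2 ≤ (∑ i, |c i| * ‖d1L i z‖) ^ 2 := by gcongr
    _ ≤ (∑ i, |c i| ^ 2) * ∑ i, ‖d1L i z‖ ^ 2 := Finset.sum_mul_sq_le_sq_mul_sq _ _ _
    _ = _ := by rw [EuclideanSpace.real_norm_sq_eq]; simp

/-- The quadratic form is coercive on `H²` in the subsonic regime `|c| < √2`. -/
theorem quadForm_coercive {n : ℕ} {c : Eucl n} (hc : ‖c‖ < √2) :
    ∃ κ > 0, ∀ z : HTwo n, κ * ‖z‖ ^ 2 ≤ quadForm c z := by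
  have h2 : ‖c‖ ^ 2 < 2 := by
    have := Real.sq_sqrt (show (0 : ℝ) ≤ 2 by norm_num)
    nlinarith [norm_nonneg c, Real.sqrt_nonneg 2]
  refine ⟨(1 - ‖c‖ ^ 2 / 2) * (2 / 3), by linarith, fun z => ?_⟩
  have h3 := sum_sq_norm_d1_le z
  have h4 := sq_norm_dirL_le c z
  rw [quadForm_eq, sq_norm_htwo, sum_sq_norm_d2]
  have h5 : ‖c‖ ^ 2 * ∑ i, ‖d1L i z‖ ^ 2 ≤ ‖c‖ ^ 2 * (1 / 2 * (‖laplL z‖ ^ 2 + ‖fnL z‖ ^ 2)) :=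
    mul_le_mul_of_nonneg_left h3 (sq_nonneg _)
  nlinarith [sq_nonneg ‖laplL z‖, sq_nonneg ‖fnL z‖, sq_nonneg ‖c‖]

theorem norm_fnL_le {n : ℕ} (z : HTwo n) : ‖fnL z‖ ≤ ‖z‖ := by
  refine (sq_le_sq₀ (norm_nonneg _) (norm_nonneg _)).1 ?_
  rw [sq_norm_htwo z]
  have : 0 ≤ ∑ i, ‖d1L i z‖ ^ 2 := Finset.sum_nonneg fun i _ => sq_nonneg _
  have : 0 ≤ ∑ i, ∑ j, ‖d2L i j z‖ ^ 2 :=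
    Finset.sum_nonneg fun i _ => Finset.sum_nonneg fun j _ => sq_nonneg _
  linarith

theorem norm_laplL_le {n : ℕ} (z : HTwo n) : ‖laplL z‖ ≤ ‖z‖ := by
  refine (sq_le_sq₀ (norm_nonneg _) (norm_nonneg _)).1 ?_
  rw [sq_norm_htwo z, sum_sq_norm_d2]
  have : 0 ≤ ∑ i, ‖d1L i z‖ ^ 2 := Finset.sum_nonneg fun i _ => sq_nonneg _
  nlinarith [sq_nonneg ‖fnL z‖]

theorem quadForm_le {n : ℕ} (c : Eucl n) (z : HTwo n) : quadForm c z ≤ 2 * ‖z‖ ^ 2 := by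
  rw [quadForm_eq]
  nlinarith [norm_fnL_le z, norm_laplL_le z, norm_nonneg (fnL z), norm_nonneg (laplL z),
    sq_nonneg ‖dirL c z‖]

/-- Being a weak derivative is a closed condition on pairs of `L²` functions. -/
instance {n : ℕ} : CompleteSpace (HTwo n) := by
  have hcl : IsClosed ((HTwo n : Set (Jet n))) := by
    have hint : ∀ ψ : Eucl n → ℝ, Continuous ψ → HasCompactSupport ψ →
        Continuous fun g : LTwo n => ∫ x, g x * ψ x := by
      intro ψ hψ hs
      have hm : MemLp ψ 2 := hψ.memLp_of_hasCompactSupport hs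
      have : (fun g : LTwo n => ∫ x, g x * ψ x) = fun g => inner ℝ (hm.toLp ψ) g := by
        funext g
        rw [L2.inner_def]
        refine integral_congr_ae ?_
        filter_upwards [hm.coeFn_toLp] with x hx
        rw [hx]; rfl
      rw [this]
      fun_prop
    have hp : ∀ a : JetIndex n, Continuous fun z : Jet n => z a := fun a =>
      (PiLp.proj 2 (fun _ : JetIndex n => LTwo n) a : Jet n →L[ℝ] LTwo n).continuous
    have hw : ∀ (i : Fin n) (a b : JetIndex n), IsClosed {z : Jet n | IsWeakPartial i (z a)
        (z b)} := by
      intro i a b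
      simp only [IsWeakPartial, Set.ofPred_forall]
      refine isClosed_iInter fun φ => isClosed_iInter fun hφ => isClosed_iInter fun hs => ?_
      exact isClosed_eq ((hint _ (continuous_test_partial hφ _) (hs.fderiv_apply ℝ _)).comp (hp a))
        ((hint _ hφ.continuous hs).comp (hp b)).neg
    have : (HTwo n : Set (Jet n)) = (⋂ i, {z : Jet n | IsWeakPartial i z.fn (z.d1 i)}) ∩
        ⋂ i, ⋂ j, {z : Jet n | IsWeakPartial j (z.d1 i) (z.d2 i j)} := by
      ext z
      simp [HTwo]
    rw [this]
    exact (isClosed_iInter fun i => hw i _ _).inter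
      (isClosed_iInter fun i => isClosed_iInter fun j => hw j _ _)
  exact hcl.completeSpace_coe

/-- Bounded sequences in `H²` have weakly convergent subsequences. -/
theorem exists_weak_subseq {n : ℕ} {z : ℕ → HTwo n} {B : ℝ} (hB : ∀ k, ‖z k‖ ≤ B) :
    ∃ (w : HTwo n) (φ : ℕ → ℕ), StrictMono φ ∧
      ∀ L : HTwo n →L[ℝ] ℝ, Tendsto (fun k => L (z (φ k))) atTop (𝓝 (L w)) := by
  have : Fact ((2 : ENNReal) ≠ ⊤) := ⟨by norm_num⟩
  have : SecondCountableTopology (LTwo n) := inferInstance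
  have : SecondCountableTopology (Jet n) := inferInstance
  have : TopologicalSpace.SeparableSpace (HTwo n) := inferInstance
  let D := InnerProductSpace.toDual ℝ (HTwo n)
  have hs := WeakDual.isSeqCompact_closedBall ℝ (HTwo n) 0 B
  obtain ⟨y, hy, φ, hφ, hl⟩ := hs (x := fun k => StrongDual.toWeakDual (D (z k))) (fun k => by
    exact ((dist_zero_right (D (z k))).trans (D.norm_map (z k))).le.trans (hB k))
  refine ⟨D.symm (WeakDual.toStrongDual y), φ, hφ, fun L => ?_⟩
  have h1 : ∀ v : HTwo n, L v = inner ℝ v (D.symm L) := by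
    intro v
    rw [real_inner_comm]
    exact (InnerProductSpace.toDual_symm_apply).symm
  have h2 := ((WeakDual.eval_continuous (𝕜 := ℝ) (E := HTwo n) (D.symm L)).tendsto y).comp hl
  have h3 : L (D.symm (WeakDual.toStrongDual y)) = y (D.symm L) := by
    rw [h1]
    exact InnerProductSpace.toDual_symm_apply
  rw [h3]
  refine h2.congr fun k => ?_
  rw [h1]
  rfl

end

/-! ### Low-pass filters -/

section

open SchwartzMap FourierTransform LineDeriv

theorem continuous_neg_inner (n : ℕ) :
    Continuous fun p : Eucl n × Eucl n => (-innerₗ (Eucl n)) p.1 p.2 := by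
  simp only [LinearMap.neg_apply, innerₗ_apply_apply]
  fun_prop

/-- On integrable functions the inverse Fourier transform of `L²` is given by the integral. -/
theorem fourierInv_ae_eq {n : ℕ} {a : CTwo n} {b : Eucl n → ℂ} (hb : Integrable b)
    (hab : a =ᵐ[volume] b) : (𝓕⁻ a : CTwo n) =ᵐ[volume] (𝓕⁻ b : Eucl n → ℂ) := by
  have hcont : Continuous (𝓕⁻ b : Eucl n → ℂ) :=
    VectorFourier.fourierIntegral_continuous (L := -innerₗ (Eucl n)) Real.continuous_fourierChar
      (continuous_neg_inner n) hb
  refine ae_eq_of_integral_contDiff_smul_eq ((Lp.memLp _).locallyIntegrable (by norm_num))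
    hcont.locallyIntegrable ?_
  intro φ hφ hs
  have hs' : HasCompactSupport (fun x => (φ x : ℂ)) := hs.comp_left (g := ((↑) : ℝ → ℂ)) (by simp)
  let ψ : 𝓢(Eucl n, ℂ) := hs'.toSchwartzMap (Complex.ofRealCLM.contDiff.comp hφ)
  have hψ : ∀ x, ψ x = (φ x : ℂ) := fun x => rfl
  have h1 := DFunLike.congr_fun (Lp.fourierInv_toTemperedDistribution_eq a) ψ
  rw [TemperedDistribution.fourierInv_apply, Lp.toTemperedDistribution_apply,
    Lp.toTemperedDistribution_apply] at h1
  have h2 : ∫ x, (𝓕⁻ (ψ : Eucl n → ℂ)) x • b x = ∫ x, ψ x • (𝓕⁻ b : Eucl n → ℂ) x := by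
    have := VectorFourier.integral_fourierIntegral_smul_eq_flip (μ := volume) (ν := volume)
      (L := -innerₗ (Eucl n)) (f := (ψ : Eucl n → ℂ)) (g := b) Real.continuous_fourierChar
      (continuous_neg_inner n) ψ.integrable hb
    have hflip : (-innerₗ (Eucl n)).flip = -innerₗ (Eucl n) := by
      ext x y; simp [real_inner_comm]
    rw [hflip] at this
    exact this
  calc ∫ x, φ x • (𝓕⁻ a : CTwo n) x = ∫ x, ψ x • (𝓕⁻ a : CTwo n) x := by simp [hψ]
    _ = ∫ x, (𝓕⁻ (ψ : Eucl n → ℂ)) x • b x := by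
      rw [← h1]
      refine integral_congr_ae ?_
      filter_upwards [hab] with x hx
      rw [hx, SchwartzMap.fourierInv_coe]
    _ = _ := by rw [h2]; simp [hψ]

/-- The closed ball of radius `R` around the origin in frequency space. -/
abbrev freqBall (n : ℕ) (R : ℝ) : Set (Eucl n) := Metric.closedBall 0 R

/-- The volume of a frequency ball. -/
def freqVol (n : ℕ) (R : ℝ) : ℝ := (volume : Measure (Eucl n)).real (freqBall n R)

theorem integrableOn_freqBall {n : ℕ} (g : CTwo n) (R : ℝ) :
    IntegrableOn g (freqBall n R) :=
  ((Lp.memLp g).locallyIntegrable (by norm_num)).integrableOn_isCompact (isCompact_closedBall _ _)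

/-- The part of `g` with frequencies in the closed ball of radius `R`, as a genuine (continuous)
function. -/
def lowPass {n : ℕ} (R : ℝ) (g : LTwo n) : Eucl n → ℂ :=
  𝓕⁻ ((freqBall n R).indicator (hat g))

theorem integrable_lowHat {n : ℕ} (g : LTwo n) (R : ℝ) :
    Integrable ((freqBall n R).indicator (hat g)) :=
  (integrable_indicator_iff Metric.isClosed_closedBall.measurableSet).2 (integrableOn_freqBall _ _)

theorem continuous_lowPass {n : ℕ} (R : ℝ) (g : LTwo n) : Continuous (lowPass R g) :=
  VectorFourier.fourierIntegral_continuous (L := -innerₗ (Eucl n)) Real.continuous_fourierChar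
    (continuous_neg_inner n) (integrable_lowHat g R)

/-- The low-frequency part as an element of `L²` on the Fourier side. -/
def lowHat {n : ℕ} (R : ℝ) (g : LTwo n) : CTwo n :=
  ((Lp.memLp (hat g)).indicator (s := freqBall n R) Metric.isClosed_closedBall.measurableSet).toLp

theorem coeFn_lowHat {n : ℕ} (R : ℝ) (g : LTwo n) :
    lowHat R g =ᵐ[volume] (freqBall n R).indicator (hat g) := MemLp.coeFn_toLp _

theorem lowPass_ae {n : ℕ} (R : ℝ) (g : LTwo n) :
    (𝓕⁻ (lowHat R g) : CTwo n) =ᵐ[volume] lowPass R g :=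
  fourierInv_ae_eq (integrable_lowHat g R) (coeFn_lowHat R g)

theorem eLpNorm_le_of_sq {n : ℕ} {a : CTwo n} {M : ℝ} (hM : 0 ≤ M) (h : ‖a‖ ^ 2 ≤ M ^ 2) :
    eLpNorm a 2 volume ≤ ENNReal.ofReal M := by
  rw [← ENNReal.ofReal_toReal (Lp.eLpNorm_ne_top a), ← Lp.norm_def]
  exact ENNReal.ofReal_le_ofReal ((sq_le_sq₀ (norm_nonneg _) hM).1 h)

theorem norm_fourierInv {n : ℕ} (a : CTwo n) : ‖(𝓕⁻ a : CTwo n)‖ = ‖a‖ :=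
  (Lp.fourierTransformₗᵢ (Eucl n) ℂ).symm.norm_map a

theorem eLpNorm_lowPass_le {n : ℕ} (R : ℝ) (g : LTwo n) :
    eLpNorm (lowPass R g) 2 volume ≤ ENNReal.ofReal ‖g‖ := by
  rw [← eLpNorm_congr_ae (lowPass_ae R g)]
  refine eLpNorm_le_of_sq (norm_nonneg _) ?_
  rw [norm_fourierInv, ← norm_hat g, sq_norm_eq_integral, sq_norm_eq_integral]
  refine integral_mono_ae (integrable_sq_norm _) (integrable_sq_norm _) ?_
  filter_upwards [coeFn_lowHat R g] with ξ h1
  simp only [h1]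
  gcongr
  exact norm_indicator_le_norm_self _ _

/-- The part of an element of `H²` with frequencies above `R` is small in `L²`. -/
theorem eLpNorm_sub_lowPass_le {n : ℕ} {R : ℝ} (hR : 0 < R) (z : HTwo n) :
    eLpNorm (fun x => (fnL z x : ℂ) - lowPass R (fnL z) x) 2 volume
      ≤ ENNReal.ofReal ((R ^ 2)⁻¹ * ‖z‖) := by
  have e : (fun x => (fnL z x : ℂ) - lowPass R (fnL z) x)
      =ᵐ[volume] (cplx (fnL z) - 𝓕⁻ (lowHat R (fnL z)) : CTwo n) := by
    filter_upwards [coeFn_cplx (fnL z), lowPass_ae R (fnL z),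
      Lp.coeFn_sub (cplx (fnL z)) (𝓕⁻ (lowHat R (fnL z)) : CTwo n)] with x h1 h2 h3
    rw [h3, Pi.sub_apply, h1, h2]
  rw [eLpNorm_congr_ae e]
  refine eLpNorm_le_of_sq (by positivity) ?_
  have e1 : ‖(cplx (fnL z) - 𝓕⁻ (lowHat R (fnL z)) : CTwo n)‖ = ‖hat (fnL z) - lowHat R (fnL z)‖ :=
      by
    rw [← Lp.norm_fourier_eq]
    congr 1
    have : 𝓕 (cplx (fnL z) - 𝓕⁻ (lowHat R (fnL z)) : CTwo n)
        = 𝓕 (cplx (fnL z)) - 𝓕 (𝓕⁻ (lowHat R (fnL z)) : CTwo n) :=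
      map_sub (Lp.fourierTransformₗᵢ (Eucl n) ℂ) _ _
    rw [this, FourierTransform.fourier_fourierInv_eq]
    rfl
  have hl := norm_laplL_le z
  rw [e1, mul_pow]
  calc ‖hat (fnL z) - lowHat R (fnL z)‖ ^ 2 ≤ ((R ^ 2)⁻¹) ^ 2 * ‖laplL z‖ ^ 2 := by
        rw [← norm_hat (laplL z), sq_norm_eq_integral, sq_norm_eq_integral, ← integral_const_mul]
        refine integral_mono_ae (integrable_sq_norm _) ((integrable_sq_norm _).const_mul _) ?_
        filter_upwards [coeFn_lowHat R (fnL z), Lp.coeFn_sub (hat (fnL z)) (lowHat R (fnL z)),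
          hat_lapl z] with ξ h1 h2 h3
        simp only [h2, Pi.sub_apply, h1]
        by_cases hξ : ξ ∈ freqBall n R
        · rw [Set.indicator_of_mem hξ, sub_self, norm_zero,
            zero_pow two_ne_zero]
          positivity
        · rw [Set.indicator_of_notMem hξ, sub_zero, h3, ← mul_pow]
          have hξ' : R < ‖ξ‖ := by simpa [freqBall] using hξ
          have h5 : 1 ≤ (R ^ 2)⁻¹ * ((2 * Real.pi) ^ 2 * ‖ξ‖ ^ 2) := by
            rw [inv_mul_eq_div, one_le_div (by positivity)]
            have : 1 ≤ (2 * Real.pi) ^ 2 := by nlinarith [Real.pi_gt_three]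
            have h6 : R ^ 2 ≤ ‖ξ‖ ^ 2 := by gcongr
            nlinarith [sq_nonneg ‖ξ‖]
          gcongr
          rw [norm_mul, norm_neg, Complex.norm_real, Real.norm_of_nonneg (by positivity),
              ← mul_assoc]
          exact le_mul_of_one_le_left (norm_nonneg _) h5
    _ ≤ _ := by gcongr

/-- The Cauchy–Schwarz inequality on a ball in frequency space. -/
theorem setIntegral_norm_le {n : ℕ} (a : CTwo n) (R : ℝ) :
    ∫ ξ in freqBall n R, ‖a ξ‖ ≤ √(freqVol n R) * ‖a‖ := by
  have hfin : volume (freqBall n R) ≠ ⊤ := (isCompact_closedBall _ _).measure_lt_top.ne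
  have hm : MeasurableSet (freqBall n R) := Metric.isClosed_closedBall.measurableSet
  have h1 : MemLp ((freqBall n R).indicator (fun _ => (1 : ℝ))) 2 (volume : Measure (Eucl n)) :=
    memLp_indicator_const 2 hm 1 (Or.inr hfin)
  have h2 : MemLp (fun ξ => ‖a ξ‖) 2 := (Lp.memLp a).norm
  have := integral_mul_le_Lp_mul_Lq_of_nonneg (p := 2) (q := 2) (μ := (volume : Measure (Eucl n)))
    ((Real.holderConjugate_iff).2 ⟨by norm_num, by norm_num⟩)
    (f := (freqBall n R).indicator (fun _ => (1 : ℝ))) (g := fun ξ => ‖a ξ‖)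
    (Eventually.of_forall fun x => Set.indicator_nonneg (fun _ _ => zero_le_one) x)
    (Eventually.of_forall fun x => norm_nonneg _) (by simpa using h1) (by simpa using h2)
  have e1 : ∫ ξ, (freqBall n R).indicator (fun _ => (1 : ℝ)) ξ * ‖a ξ‖ = ∫ ξ in freqBall n R,
      ‖a ξ‖ := by
    rw [← integral_indicator hm]
    refine integral_congr_ae (Eventually.of_forall fun ξ => ?_)
    by_cases h : ξ ∈ freqBall n R <;> simp [h]
  have e2 : ∫ ξ, (freqBall n R).indicator (fun _ => (1 : ℝ)) ξ ^ (2 : ℝ) = freqVol n R := by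
    have : (fun ξ => (freqBall n R).indicator (fun _ => (1 : ℝ)) ξ ^ (2 : ℝ))
        = (freqBall n R).indicator (fun _ => (1 : ℝ)) := by
      funext ξ
      by_cases h : ξ ∈ freqBall n R <;> simp [h]
    rw [this, integral_indicator_const _ hm, freqVol]
    simp
  have e3 : ∫ ξ, ‖a ξ‖ ^ (2 : ℝ) = ‖a‖ ^ 2 := by
    rw [sq_norm_eq_integral]; simp
  rw [e1, e2, e3, ← Real.sqrt_eq_rpow, ← Real.sqrt_eq_rpow, Real.sqrt_sq (norm_nonneg _)] at this
  exact this

theorem norm_fourierInv_le {n : ℕ} (b : Eucl n → ℂ) (x : Eucl n) :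
    ‖(𝓕⁻ b : Eucl n → ℂ) x‖ ≤ ∫ ξ, ‖b ξ‖ :=
  VectorFourier.norm_fourierIntegral_le_integral_norm _ _ _ _ _

theorem norm_lowPass_le {n : ℕ} (R : ℝ) (g : LTwo n) (x : Eucl n) :
    ‖lowPass R g x‖ ≤ √(freqVol n R) * ‖g‖ := by
  refine (norm_fourierInv_le _ x).trans ?_
  rw [← norm_hat g]
  refine le_trans (le_of_eq ?_) (setIntegral_norm_le (hat g) R)
  rw [← integral_indicator Metric.isClosed_closedBall.measurableSet]
  simp only [norm_indicator_eq_indicator_norm]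

/-- The frequencies between `R` and `R'` contribute little to the values of an element of `H²`. -/
theorem norm_lowPass_sub_le {n : ℕ} {R R' : ℝ} (hR : 0 < R) (hRR : R ≤ R') (z : HTwo n) (x : Eucl n)
    :
    ‖lowPass R' (fnL z) x - lowPass R (fnL z) x‖ ≤ √(freqVol n R') * ((R ^ 2)⁻¹ * ‖z‖) := by
  have hm : ∀ R, MeasurableSet (freqBall n R) := fun R => Metric.isClosed_closedBall.measurableSet
  have conv : ∀ R, Integrable fun ξ => Real.fourierChar (inner ℝ ξ x) •
      (freqBall n R).indicator (hat (fnL z)) ξ := fun R => by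
    simpa using (VectorFourier.fourierIntegral_convergent_iff Real.continuous_fourierChar
      (continuous_neg_inner n) x).2 (integrable_lowHat (fnL z) R)
  have e : lowPass R' (fnL z) x - lowPass R (fnL z) x
      = (𝓕⁻ ((freqBall n R').indicator (hat (fnL z)) - (freqBall n R).indicator (hat (fnL z))) :
          Eucl n → ℂ) x := by
    rw [lowPass, lowPass, Real.fourierInv_eq, Real.fourierInv_eq, Real.fourierInv_eq,
        ← integral_sub]
    · simp only [Pi.sub_apply, smul_sub]
    · exact conv R'
    · exact conv R
  rw [e]
  refine (norm_fourierInv_le _ x).trans ?_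
  calc _ ≤ ∫ ξ in freqBall n R', (R ^ 2)⁻¹ * ‖hat (laplL z) ξ‖ := by
        rw [← integral_indicator (hm R')]
        refine integral_mono_ae ((integrable_lowHat _ _).sub (integrable_lowHat _ _)).norm
          ((integrable_indicator_iff (hm R')).2
            ((integrableOn_freqBall (hat (laplL z)) R').norm.const_mul _)) ?_
        filter_upwards [hat_lapl z] with ξ h3
        simp only [Pi.sub_apply]
        by_cases hξ : ξ ∈ freqBall n R
        · have hξ' : ξ ∈ freqBall n R' := Metric.closedBall_subset_closedBall hRR hξ
          rw [Set.indicator_of_mem hξ, Set.indicator_of_mem hξ', Set.indicator_of_mem hξ', sub_self,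
            norm_zero]
          positivity
        · rw [Set.indicator_of_notMem hξ, sub_zero]
          by_cases hξ' : ξ ∈ freqBall n R'
          · rw [Set.indicator_of_mem hξ', Set.indicator_of_mem hξ', h3]
            have hξ' : R < ‖ξ‖ := by simpa [freqBall] using hξ
            have h5 : 1 ≤ (R ^ 2)⁻¹ * ((2 * Real.pi) ^ 2 * ‖ξ‖ ^ 2) := by
              rw [inv_mul_eq_div, one_le_div (by positivity)]
              have : 1 ≤ (2 * Real.pi) ^ 2 := by nlinarith [Real.pi_gt_three]
              have h6 : R ^ 2 ≤ ‖ξ‖ ^ 2 := by gcongr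
              nlinarith [sq_nonneg ‖ξ‖]
            rw [norm_mul, norm_neg, Complex.norm_real, Real.norm_of_nonneg (by positivity),
                ← mul_assoc]
            exact le_mul_of_one_le_left (norm_nonneg _) h5
          · simp [hξ']
    _ ≤ (R ^ 2)⁻¹ * (√(freqVol n R') * ‖hat (laplL z)‖) := by
        rw [integral_const_mul]
        gcongr
        exact setIntegral_norm_le _ _
    _ ≤ √(freqVol n R') * ((R ^ 2)⁻¹ * ‖z‖) := by
        rw [norm_hat, mul_left_comm]
        gcongr
        exact norm_laplL_le z

/-! ### The kernel of the low-pass filter -/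

/-- The convolution kernel of the low-pass filter. -/
def lowKernel (n : ℕ) (R : ℝ) : Eucl n → ℂ := 𝓕⁻ ((freqBall n R).indicator (fun _ => (1 : ℂ)))

/-- Point values of the low-pass filter are given by pairing with a fixed element of `L²`. -/
theorem lowPass_eq_inner {n : ℕ} (R : ℝ) (x : Eucl n) : ∃ a : CTwo n,
    (∀ g, lowPass R g x = inner ℂ a (hat g)) ∧
      (𝓕⁻ a : CTwo n) =ᵐ[volume] fun y => lowKernel n R (y - x) := by
  have hm : MeasurableSet (freqBall n R) := Metric.isClosed_closedBall.measurableSet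
  have hfin : volume (freqBall n R) ≠ ⊤ := (isCompact_closedBall _ _).measure_lt_top.ne
  let b : Eucl n → ℂ := (freqBall n R).indicator (fun ξ => (Real.fourierChar (-inner ℝ ξ x) : ℂ))
  have hbm : AEStronglyMeasurable b volume :=
    AEStronglyMeasurable.indicator (Continuous.aestronglyMeasurable (by fun_prop)) hm
  have hbn : ∀ ξ, ‖b ξ‖ ≤ ‖(freqBall n R).indicator (fun _ => (1 : ℝ)) ξ‖ := by
    intro ξ
    by_cases h : ξ ∈ freqBall n R
    · simp only [b, Set.indicator_of_mem h, Circle.norm_coe, norm_one, le_refl]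
    · simp [b, h]
  have hb2 : MemLp b 2 := MemLp.mono (memLp_indicator_const 2 hm (1 : ℝ) (Or.inr hfin)) hbm
    (Eventually.of_forall hbn)
  have hb1 : Integrable b := Integrable.mono
    ((integrable_indicator_iff hm).2 (integrableOn_const hfin)) hbm (Eventually.of_forall hbn)
  have hK : ∀ y, (𝓕⁻ b : Eucl n → ℂ) y = lowKernel n R (y - x) := by
    intro y
    rw [lowKernel, Real.fourierInv_eq, Real.fourierInv_eq]
    refine integral_congr_ae (Eventually.of_forall fun ξ => ?_)
    by_cases h : ξ ∈ freqBall n R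
    · simp only [b, Set.indicator_of_mem h]
      rw [Circle.smul_def, Circle.smul_def, smul_eq_mul, smul_eq_mul, mul_one, ← Circle.coe_mul,
        ← AddChar.map_add_eq_mul, inner_sub_right, sub_eq_add_neg]
    · simp [b, h]
  refine ⟨hb2.toLp b, fun g => ?_, ?_⟩
  · rw [L2.inner_def, lowPass, Real.fourierInv_eq]
    refine integral_congr_ae ?_
    filter_upwards [hb2.coeFn_toLp] with ξ h1
    rw [h1, RCLike.inner_apply]
    by_cases h : ξ ∈ freqBall n R
    · simp only [b, Set.indicator_of_mem h, Circle.smul_def, smul_eq_mul]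
      rw [mul_comm _ ((starRingEnd ℂ) _), ← Circle.coe_inv_eq_conj, ← AddChar.map_neg_eq_inv,
          neg_neg]
    · simp [b, h]
  · filter_upwards [fourierInv_ae_eq hb1 hb2.coeFn_toLp] with y e1
    rw [e1, hK]

/-- The low-pass filter is a convolution; in particular it commutes with translations. -/
theorem lowPass_eq_integral {n : ℕ} (R : ℝ) (g : LTwo n) (x : Eucl n) :
    lowPass R g x = ∫ y, (g y : ℂ) * (starRingEnd ℂ) (lowKernel n R (y - x)) := by
  obtain ⟨a, ha, hK⟩ := lowPass_eq_inner R x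
  have h2 : inner ℂ a (hat g) = inner ℂ (𝓕⁻ a : CTwo n) (cplx g) := by
    rw [hat, ← Lp.inner_fourier_eq (𝓕⁻ a : CTwo n), FourierTransform.fourier_fourierInv_eq]
  rw [ha, h2, L2.inner_def]
  refine integral_congr_ae ?_
  filter_upwards [hK, coeFn_cplx g] with y e1 e2
  rw [e1, e2, RCLike.inner_apply]

end

/-! ### Subcritical Sobolev embedding and local compactness -/

/-- Interpolation of `Lʳ` between `L²` and a uniform bound. -/
theorem eLpNorm_le_interpolate {n : ℕ} {r : ℝ} (hr : 2 ≤ r) {u : Eucl n → ℂ} {M N : ℝ}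
    (hM : 0 ≤ M) (hN : 0 ≤ N) (hu : ∀ x, ‖u x‖ ≤ M) (h2 : eLpNorm u 2 volume ≤ ENNReal.ofReal N) :
    eLpNorm u (ENNReal.ofReal r) volume ≤ ENNReal.ofReal (M ^ (1 - 2 / r) * N ^ (2 / r)) := by
  have hr0 : 0 < r := by linarith
  have h2' : ∫⁻ x, ‖u x‖ₑ ^ (2 : ℝ) ≤ ENNReal.ofReal (N ^ (2 : ℝ)) := by
    rw [eLpNorm_eq_lintegral_rpow_enorm_toReal (by norm_num) (by norm_num)] at h2
    rw [← ENNReal.ofReal_rpow_of_nonneg hN (by norm_num)]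
    have := ENNReal.rpow_le_rpow h2 (show (0 : ℝ) ≤ 2 by norm_num)
    rwa [← ENNReal.rpow_mul, ENNReal.toReal_ofNat, one_div, inv_mul_cancel₀ (by norm_num),
      ENNReal.rpow_one] at this
  rw [eLpNorm_eq_lintegral_rpow_enorm_toReal (by simpa using hr0) (by simp),
      ENNReal.toReal_ofReal hr0.le]
  have h3 : ∫⁻ x, ‖u x‖ₑ ^ r ≤ ENNReal.ofReal (M ^ (r - 2) * N ^ (2 : ℝ)) := by
    calc ∫⁻ x, ‖u x‖ₑ ^ r ≤ ∫⁻ x, ENNReal.ofReal (M ^ (r - 2)) * ‖u x‖ₑ ^ (2 : ℝ) := by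
          refine lintegral_mono fun x => ?_
          rw [← ofReal_norm, ENNReal.ofReal_rpow_of_nonneg (norm_nonneg _) hr0.le,
            ENNReal.ofReal_rpow_of_nonneg (norm_nonneg _) (by norm_num),
            ← ENNReal.ofReal_mul (by positivity)]
          refine ENNReal.ofReal_le_ofReal ?_
          have e : ‖u x‖ ^ r = ‖u x‖ ^ (r - 2) * ‖u x‖ ^ (2 : ℝ) := by
            rw [← Real.rpow_add_of_nonneg (norm_nonneg _) (by linarith) (by norm_num)]
            congr 1; ring
          rw [e]
          gcongr
          · exact hu x
      _ = ENNReal.ofReal (M ^ (r - 2)) * ∫⁻ x, ‖u x‖ₑ ^ (2 : ℝ) :=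
          lintegral_const_mul' _ _ ENNReal.ofReal_ne_top
      _ ≤ _ := by
          rw [ENNReal.ofReal_mul (by positivity)]
          gcongr
  calc _ ≤ ENNReal.ofReal (M ^ (r - 2) * N ^ (2 : ℝ)) ^ (1 / r) := by gcongr
    _ = _ := by
      rw [ENNReal.ofReal_rpow_of_nonneg (by positivity) (by positivity),
        Real.mul_rpow (by positivity) (by positivity), ← Real.rpow_mul hM, ← Real.rpow_mul hN]
      congr 3 <;> field_simp

theorem freqVol_eq (n : ℕ) {R : ℝ} (hR : 0 ≤ R) : freqVol n R = R ^ n * freqVol n 1 := by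
  rw [freqVol, freqVol, freqBall, freqBall, Measure.addHaar_real_closedBall' _ _ hR,
    finrank_euclideanSpace_fin]

theorem freqVol_nonneg (n : ℕ) (R : ℝ) : 0 ≤ freqVol n R := measureReal_nonneg

/-- The exponents `r ≥ 2` below the critical exponent of the embedding of `H²(ℝⁿ)` into `Lʳ`: this
means `r < 2 n / (n - 4)` for `n > 4` and is no condition otherwise. -/
def Subcritical (n : ℕ) (r : ℝ) : Prop := 2 ≤ r ∧ (n : ℝ) * (1 / 2 - 1 / r) < 2

/-- Geometric decay in `Lʳ` of the dyadic frequency blocks of an element of `H²`, by interpolation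
between the uniform bound on a block and its decay in `L²`. -/
theorem exists_dyadic_bound {n : ℕ} {r : ℝ} (hr : Subcritical n r) :
    ∃ C θ : ℝ, 0 ≤ C ∧ 0 < θ ∧ θ < 1 ∧ ∀ (z : HTwo n) (J : ℕ),
      eLpNorm (fun x => lowPass (2 ^ (J + 1)) (fnL z) x - lowPass (2 ^ J) (fnL z) x)
        (ENNReal.ofReal r) volume ≤ ENNReal.ofReal (C * θ ^ J * ‖z‖) := by
  obtain ⟨hr2, hrs⟩ := hr
  have hr0 : 0 < r := by linarith
  set s : ℝ := 2 / r with hs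
  have hs0 : 0 < s := by positivity
  have hs1 : s ≤ 1 := by rw [hs, div_le_one hr0]; exact hr2
  set V := √(freqVol n 2) with hV
  -- `2 ^ (n / 2)` is the growth rate of the square root of the volume, `1 / 4` the decay in `L²`
  let b : ℝ := √(2 ^ n)
  have hb0 : 0 < b := by positivity
  let θ : ℝ := b ^ (1 - s) / 4
  refine ⟨V ^ (1 - s) * 2 ^ s, θ, by positivity, by positivity, ?_, fun z J => ?_⟩
  · have e : b ^ (1 - s) = 2 ^ ((n : ℝ) * (1 / 2 - 1 / r)) := by
      have : b = 2 ^ ((n : ℝ) / 2) := by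
        rw [show b = √(2 ^ n) from rfl, Real.sqrt_eq_rpow, ← Real.rpow_natCast,
            ← Real.rpow_mul (by norm_num)]
        congr 1; ring
      rw [this, ← Real.rpow_mul (by norm_num), hs]
      congr 1
      field_simp
    have h4 : (2 : ℝ) ^ ((n : ℝ) * (1 / 2 - 1 / r)) < 2 ^ (2 : ℝ) :=
      Real.rpow_lt_rpow_of_exponent_lt (by norm_num) hrs
    change b ^ (1 - s) / 4 < 1
    rw [e, div_lt_one (by norm_num)]
    calc _ < (2 : ℝ) ^ (2 : ℝ) := h4
      _ = 4 := by norm_num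
  · have h2J : (0 : ℝ) < 2 ^ J := by positivity
    have hsup := norm_lowPass_sub_le h2J (show (2 : ℝ) ^ J ≤ 2 ^ (J + 1) by
      rw [pow_succ]; linarith) z
    have hvol : √(freqVol n (2 ^ (J + 1))) = V * b ^ J := by
      rw [hV, freqVol_eq n (by positivity), freqVol_eq n (by norm_num : (0 : ℝ) ≤ 2),
        ← Real.sqrt_sq (show 0 ≤ b ^ J by positivity), ← Real.sqrt_mul
          (mul_nonneg (by positivity) (freqVol_nonneg _ _))]
      congr 1
      have : (b ^ J) ^ 2 = (2 ^ n) ^ J := by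
        rw [← pow_mul, mul_comm J 2, pow_mul, Real.sq_sqrt (by positivity)]
      rw [this, ← pow_mul, ← pow_mul, add_mul, pow_add, one_mul, mul_comm J n]
      ring
    have hL2 : eLpNorm (fun x => lowPass (2 ^ (J + 1)) (fnL z) x - lowPass (2 ^ J) (fnL z) x)
        2 volume
        ≤ ENNReal.ofReal (2 * ((1 / 4) ^ J * ‖z‖)) := by
      have m : ∀ R, AEStronglyMeasurable (fun x => (fnL z x : ℂ) - lowPass R (fnL z) x) volume :=
        fun R => (Complex.continuous_ofReal.comp_aestronglyMeasurable (Lp.memLp _).1).sub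
          (continuous_lowPass _ _).aestronglyMeasurable
      have e : (fun x => lowPass (2 ^ (J + 1)) (fnL z) x - lowPass (2 ^ J) (fnL z) x)
          = (fun x => (fnL z x : ℂ) - lowPass (2 ^ J) (fnL z) x)
            - fun x => (fnL z x : ℂ) - lowPass (2 ^ (J + 1)) (fnL z) x := by
        funext x; simp
      rw [e]
      refine (eLpNorm_sub_le (m _) (m _) (by norm_num)).trans ?_
      refine (add_le_add (eLpNorm_sub_lowPass_le h2J z)
        (eLpNorm_sub_lowPass_le (by positivity) z)).trans ?_
      rw [← ENNReal.ofReal_add (by positivity) (by positivity)]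
      refine ENNReal.ofReal_le_ofReal ?_
      have e1 : (((2 : ℝ) ^ J) ^ 2)⁻¹ = (1 / 4) ^ J := by
        rw [← pow_mul, mul_comm, pow_mul, one_div, inv_pow]; norm_num
      have e2 : (((2 : ℝ) ^ (J + 1)) ^ 2)⁻¹ ≤ (1 / 4) ^ J := by
        rw [← e1]
        gcongr
        · norm_num
        · linarith
      have := mul_le_mul_of_nonneg_right e2 (norm_nonneg z)
      rw [e1]; linarith
    have e1 : (((2 : ℝ) ^ J) ^ 2)⁻¹ = (1 / 4) ^ J := by
      rw [← pow_mul, mul_comm, pow_mul, one_div, inv_pow]; norm_num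
    have hint := eLpNorm_le_interpolate hr2 (by positivity) (by positivity) hsup hL2
    refine hint.trans (ENNReal.ofReal_le_ofReal (le_of_eq ?_))
    rw [hvol, e1, ← hs]
    set q : ℝ := (1 / 4) ^ J * ‖z‖ with hq
    have hq0 : 0 ≤ q := by positivity
    have hVn : 0 ≤ V := Real.sqrt_nonneg _
    rw [Real.mul_rpow (by positivity) hq0, Real.mul_rpow hVn (by positivity),
      Real.mul_rpow (by norm_num) hq0]
    have e3 : q ^ (1 - s) * q ^ s = q := by
      rw [← Real.rpow_add_of_nonneg hq0 (by linarith) hs0.le]; simp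
    have e4 : (b ^ J) ^ (1 - s) = (b ^ (1 - s)) ^ J := by
      rw [← Real.rpow_natCast, ← Real.rpow_natCast, ← Real.rpow_mul hb0.le, ← Real.rpow_mul hb0.le,
        mul_comm]
    calc V ^ (1 - s) * (b ^ J) ^ (1 - s) * q ^ (1 - s) * (2 ^ s * q ^ s)
        = V ^ (1 - s) * 2 ^ s * (b ^ J) ^ (1 - s) * (q ^ (1 - s) * q ^ s) := by ring
      _ = V ^ (1 - s) * 2 ^ s * θ ^ J * ‖z‖ := by
        rw [e3, e4, hq, show θ = b ^ (1 - s) / 4 from rfl, div_pow, div_pow, one_pow]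
        ring

/-- High frequencies of elements of `H²` are uniformly small in subcritical `Lʳ`: the dyadic blocks
are summed, and Fatou's lemma applies to the partial sums. -/
theorem exists_highPass_bound {n : ℕ} {r : ℝ} (hr : Subcritical n r) :
    ∃ C θ : ℝ, 0 ≤ C ∧ 0 < θ ∧ θ < 1 ∧ ∀ (z : HTwo n) (J : ℕ),
      eLpNorm (fun x => (fnL z x : ℂ) - lowPass (2 ^ J) (fnL z) x)
        (ENNReal.ofReal r) volume ≤ ENNReal.ofReal (C * θ ^ J * ‖z‖) := by
  obtain ⟨C, θ, hC, hθ0, hθ1, hd⟩ := exists_dyadic_bound hr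
  have hr1 : (1 : ENNReal) ≤ ENNReal.ofReal r := by
    rw [← ENNReal.ofReal_one]; exact ENNReal.ofReal_le_ofReal (by linarith [hr.1])
  have h1θ : 0 < 1 - θ := by linarith
  refine ⟨C / (1 - θ), θ, by positivity, hθ0, hθ1, fun z J => ?_⟩
  set S : ℕ → Eucl n → ℂ := fun J => lowPass (2 ^ J) (fnL z) with hS
  have hSm : ∀ J, AEStronglyMeasurable (S J) volume := fun J =>
    (continuous_lowPass _ _).aestronglyMeasurable
  have hzm : AEStronglyMeasurable (fun x => (fnL z x : ℂ)) volume :=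
    Complex.continuous_ofReal.comp_aestronglyMeasurable (Lp.memLp _).1
  have tel : ∀ m : ℕ, eLpNorm (fun x => S (J + m) x - S J x) (ENNReal.ofReal r) volume
      ≤ ENNReal.ofReal (C * θ ^ J * ‖z‖ * ∑ i ∈ Finset.range m, θ ^ i) := by
    intro m
    induction m with
    | zero => simp
    | succ m ih =>
      have e : (fun x => S (J + (m + 1)) x - S J x)
          = (fun x => S (J + m) x - S J x) + fun x => S (J + m + 1) x - S (J + m) x := by
        funext x; simp [add_assoc]
      rw [e]
      refine (eLpNorm_add_le ((hSm _).sub (hSm _)) ((hSm _).sub (hSm _)) hr1).trans ?_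
      refine (add_le_add ih (hd z (J + m))).trans ?_
      have hsum : 0 ≤ ∑ i ∈ Finset.range m, θ ^ i := Finset.sum_nonneg fun i _ => by positivity
      rw [← ENNReal.ofReal_add (by positivity) (by positivity)]
      refine ENNReal.ofReal_le_ofReal (le_of_eq ?_)
      rw [Finset.sum_range_succ, pow_add]; ring
  have tel' : ∀ m : ℕ, J ≤ m → eLpNorm (fun x => S m x - S J x) (ENNReal.ofReal r) volume
      ≤ ENNReal.ofReal (C / (1 - θ) * θ ^ J * ‖z‖) := by
    intro m hm
    obtain ⟨k, rfl⟩ := Nat.exists_eq_add_of_le hm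
    refine (tel k).trans (ENNReal.ofReal_le_ofReal ?_)
    have h5 : ∑ i ∈ Finset.range k, θ ^ i ≤ 1 / (1 - θ) := by
      rw [le_div_iff₀ h1θ]
      have := geom_sum_mul θ k
      have h6 : 0 ≤ θ ^ k := by positivity
      nlinarith
    calc C * θ ^ J * ‖z‖ * ∑ i ∈ Finset.range k, θ ^ i ≤ C * θ ^ J * ‖z‖ * (1 / (1 - θ)) :=
        by gcongr
      _ = _ := by ring
  have hL2 : Tendsto (fun m => eLpNorm (S m - fun x => (fnL z x : ℂ)) 2 volume) atTop (𝓝 0) := by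
    have ht : Tendsto (fun m : ℕ => ENNReal.ofReal ((((2 : ℝ) ^ m) ^ 2)⁻¹ * ‖z‖)) atTop (𝓝 0) := by
      rw [← ENNReal.ofReal_zero]
      refine ENNReal.tendsto_ofReal ?_
      have : Tendsto (fun m : ℕ => ((1 / 4 : ℝ)) ^ m * ‖z‖) atTop (𝓝 (0 * ‖z‖)) :=
        (tendsto_pow_atTop_nhds_zero_of_lt_one (by norm_num) (by norm_num)).mul_const _
      rw [zero_mul] at this
      refine this.congr fun m => ?_
      rw [← pow_mul, mul_comm m 2, pow_mul, one_div, inv_pow]; norm_num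
    refine tendsto_of_tendsto_of_tendsto_of_le_of_le tendsto_const_nhds ht (fun _ => zero_le)
        fun m => ?_
    rw [← eLpNorm_neg, neg_sub]
    exact eLpNorm_sub_lowPass_le (by positivity) z
  obtain ⟨ns, hns, hae⟩ := (tendstoInMeasure_of_tendsto_eLpNorm (by norm_num) hSm hzm
    hL2).exists_seq_tendsto_ae
  have hF := Lp.eLpNorm_lim_le_liminf_eLpNorm (p := ENNReal.ofReal r) (μ := volume)
    (f := fun k x => S (ns k) x - S J x) (fun k => (hSm _).sub (hSm _))
    (fun x => (fnL z x : ℂ) - S J x) (by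
      filter_upwards [hae] with x hx
      exact hx.sub_const _)
  refine hF.trans ?_
  refine Filter.liminf_le_of_frequently_le' (Eventually.frequently ?_)
  filter_upwards [hns.tendsto_atTop.eventually_ge_atTop J] with k hk
  exact tel' _ hk

theorem ennreal_ofReal_ne_zero_of_subcritical {n : ℕ} {r : ℝ} (hr : Subcritical n r) :
    ENNReal.ofReal r ≠ 0 := by
  have := hr.1
  simp; linarith

theorem eLpNorm_fnL_le {n : ℕ} {r : ℝ} (hr : Subcritical n r) :
    ∃ C, 0 ≤ C ∧ ∀ z : HTwo n,
      eLpNorm (fnL z) (ENNReal.ofReal r) volume ≤ ENNReal.ofReal (C * ‖z‖) := by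
  obtain ⟨C, θ, hC, hθ0, hθ1, hd⟩ := exists_highPass_bound hr
  have hr1 : (1 : ENNReal) ≤ ENNReal.ofReal r := by
    rw [← ENNReal.ofReal_one]; exact ENNReal.ofReal_le_ofReal (by linarith [hr.1])
  set V := √(freqVol n 1) with hV
  refine ⟨C + V ^ (1 - 2 / r), by positivity, fun z => ?_⟩
  have h1 := hd z 0
  rw [pow_zero, pow_zero, mul_one] at h1
  have h2 : eLpNorm (lowPass 1 (fnL z)) (ENNReal.ofReal r) volume
      ≤ ENNReal.ofReal (V ^ (1 - 2 / r) * ‖z‖) := by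
    have hb : ∀ x, ‖lowPass 1 (fnL z) x‖ ≤ V * ‖z‖ := fun x =>
      (norm_lowPass_le 1 (fnL z) x).trans
        (mul_le_mul_of_nonneg_left (norm_fnL_le z) (Real.sqrt_nonneg _))
    refine (eLpNorm_le_interpolate hr.1 (by positivity) (norm_nonneg z) hb
      ((eLpNorm_lowPass_le 1 (fnL z)).trans (ENNReal.ofReal_le_ofReal (norm_fnL_le z)))).trans
      (ENNReal.ofReal_le_ofReal (le_of_eq ?_))
    have hr0 : 0 < r := by linarith [hr.1]
    have : 2 / r ≤ 1 := by rw [div_le_one hr0]; exact hr.1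
    rw [Real.mul_rpow (Real.sqrt_nonneg _) (norm_nonneg z), mul_assoc,
      ← Real.rpow_add_of_nonneg (norm_nonneg z) (by linarith) (by positivity), sub_add_cancel,
      Real.rpow_one]
  have hzm : AEStronglyMeasurable (fun x => (fnL z x : ℂ)) volume :=
    Complex.continuous_ofReal.comp_aestronglyMeasurable (Lp.memLp _).1
  have hlm := (continuous_lowPass 1 (fnL z)).aestronglyMeasurable (μ := volume)
  have e : eLpNorm (fnL z) (ENNReal.ofReal r) volume
      = eLpNorm ((fun x => (fnL z x : ℂ) - lowPass 1 (fnL z) x) + lowPass 1 (fnL z))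
        (ENNReal.ofReal r) volume := by
    refine eLpNorm_congr_norm_ae (Eventually.of_forall fun x => ?_)
    simp
  rw [e]
  refine (eLpNorm_add_le (hzm.sub hlm) hlm hr1).trans ((add_le_add h1 h2).trans ?_)
  rw [← ENNReal.ofReal_add (by positivity) (by positivity)]
  exact ENNReal.ofReal_le_ofReal (le_of_eq (by ring))

theorem memLp_fnL {n : ℕ} {r : ℝ} (hr : Subcritical n r) (z : HTwo n) :
    MemLp (fnL z) (ENNReal.ofReal r) := by
  obtain ⟨C, -, h⟩ := eLpNorm_fnL_le hr
  exact ⟨(Lp.memLp _).1, (h z).trans_lt ENNReal.ofReal_lt_top⟩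

theorem integrable_rpow_fnL {n : ℕ} {r : ℝ} (hr : Subcritical n r) (z : HTwo n) :
    Integrable (fun x => |fnL z x| ^ r) := by
  have := (memLp_fnL hr z).integrable_norm_rpow (ennreal_ofReal_ne_zero_of_subcritical hr) (by simp)
  rwa [ENNReal.toReal_ofReal (by linarith [hr.1])] at this

theorem eLpNorm_fnL_eq {n : ℕ} {r : ℝ} (hr : Subcritical n r) (z : HTwo n) :
    eLpNorm (fnL z) (ENNReal.ofReal r) volume
      = ENNReal.ofReal ((∫ x, |fnL z x| ^ r) ^ (1 / r)) := by
  rw [(memLp_fnL hr z).eLpNorm_eq_integral_rpow_norm (ennreal_ofReal_ne_zero_of_subcritical hr)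
      (by simp),
    ENNReal.toReal_ofReal (by linarith [hr.1]), one_div]
  rfl

/-- The Sobolev embedding of `H²(ℝⁿ)` into subcritical `Lʳ(ℝⁿ)`. -/
theorem exists_integral_rpow_le {n : ℕ} {r : ℝ} (hr : Subcritical n r) :
    ∃ C, 0 ≤ C ∧ ∀ z : HTwo n, ∫ x, |fnL z x| ^ r ≤ C * ‖z‖ ^ r := by
  obtain ⟨C, hC, h⟩ := eLpNorm_fnL_le hr
  have hr0 : 0 < r := by linarith [hr.1]
  refine ⟨C ^ r, by positivity, fun z => ?_⟩
  have h1 := h z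
  have hI : 0 ≤ ∫ x, |fnL z x| ^ r := integral_nonneg fun x => by positivity
  rw [eLpNorm_fnL_eq hr, ENNReal.ofReal_le_ofReal_iff (by positivity)] at h1
  have h2 := Real.rpow_le_rpow (by positivity) h1 hr0.le
  rwa [← Real.rpow_mul hI, one_div, inv_mul_cancel₀ hr0.ne', Real.rpow_one,
    Real.mul_rpow hC (norm_nonneg z)] at h2

/-- Non-vanishing: a bounded set of elements of `H²` whose `Lʳ` norms, `2 < r`, stay away from `0`
has a low-frequency part of fixed size somewhere in space. Otherwise that part would be small in
`Lʳ` by interpolation, and the high frequencies are small there anyway. -/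
theorem exists_lowPass_ge {n : ℕ} {r : ℝ} (hr : Subcritical n r) (hr2 : 2 < r) {B δ : ℝ}
    (hB : 0 < B) (hδ : 0 < δ) : ∃ (R : ℝ) (η : ℝ), 0 < η ∧
      ∀ z : HTwo n, ‖z‖ ≤ B → δ ≤ ∫ x, |fnL z x| ^ r → ∃ x, η ≤ ‖lowPass R (fnL z) x‖ := by
  obtain ⟨C, θ, hC, hθ0, hθ1, hd⟩ := exists_highPass_bound hr
  have hr0 : 0 < r := by linarith
  have hr1 : (1 : ENNReal) ≤ ENNReal.ofReal r := by
    rw [← ENNReal.ofReal_one]; exact ENNReal.ofReal_le_ofReal (by linarith)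
  set d : ℝ := δ ^ (1 / r) with hd'
  have hd0 : 0 < d := by positivity
  obtain ⟨J, hJ⟩ : ∃ J : ℕ, C * θ ^ J * B < d / 2 := by
    have : Tendsto (fun J : ℕ => C * θ ^ J * B) atTop (𝓝 (C * 0 * B)) :=
      ((tendsto_pow_atTop_nhds_zero_of_lt_one hθ0.le hθ1).const_mul C).mul_const B
    rw [mul_zero, zero_mul] at this
    exact (this.eventually_lt_const (by positivity)).exists
  have hexp : 0 < 1 - 2 / r := by
    rw [sub_pos, div_lt_one hr0]; exact hr2
  obtain ⟨η, hη, hη0⟩ : ∃ η : ℝ, η ^ (1 - 2 / r) * B ^ (2 / r) < d / 2 ∧ 0 < η := by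
    have h1 : Tendsto (fun η : ℝ => η ^ (1 - 2 / r) * B ^ (2 / r)) (𝓝[>] 0)
        (𝓝 (0 ^ (1 - 2 / r) * B ^ (2 / r))) :=
      ((Real.continuousAt_rpow_const 0 _ (Or.inr hexp.le)).tendsto.mono_left
        nhdsWithin_le_nhds).mul_const _
    rw [Real.zero_rpow hexp.ne', zero_mul] at h1
    exact ((h1.eventually_lt_const (by positivity : 0 < d / 2)).and self_mem_nhdsWithin).exists
  refine ⟨2 ^ J, η, hη0, fun z hz hδz => ?_⟩
  by_contra! hcon
  have hlow := eLpNorm_le_interpolate hr.1 hη0.le hB.le (fun x => (hcon x).le)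
    ((eLpNorm_lowPass_le (2 ^ J)
        (fnL z)).trans (ENNReal.ofReal_le_ofReal ((norm_fnL_le z).trans hz)))
  have hhigh := hd z J
  have hzm : AEStronglyMeasurable (fun x => (fnL z x : ℂ)) volume :=
    Complex.continuous_ofReal.comp_aestronglyMeasurable (Lp.memLp _).1
  have hlm := (continuous_lowPass (2 ^ J) (fnL z)).aestronglyMeasurable (μ := volume)
  have e : eLpNorm (fnL z) (ENNReal.ofReal r) volume
      = eLpNorm ((fun x => (fnL z x : ℂ) - lowPass (2 ^ J) (fnL z) x) + lowPass (2 ^ J) (fnL z))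
        (ENNReal.ofReal r) volume := by
    refine eLpNorm_congr_norm_ae (Eventually.of_forall fun x => ?_)
    simp
  have h3 := e.le.trans ((eLpNorm_add_le (hzm.sub hlm) hlm hr1).trans (add_le_add hhigh hlow))
  rw [eLpNorm_fnL_eq hr, ← ENNReal.ofReal_add (by positivity) (by positivity),
    ENNReal.ofReal_le_ofReal_iff (by positivity)] at h3
  have h4 : d ≤ (∫ x, |fnL z x| ^ r) ^ (1 / r) :=
    Real.rpow_le_rpow hδ.le hδz (by positivity)
  have h5 : C * θ ^ J * ‖z‖ ≤ C * θ ^ J * B := by gcongr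
  linarith

/-- Low-pass filters turn weak convergence into pointwise convergence. -/
theorem tendsto_lowPass {n : ℕ} {z : ℕ → HTwo n} {w : HTwo n}
    (hw : ∀ L : HTwo n →L[ℝ] ℝ, Tendsto (fun k => L (z k)) atTop (𝓝 (L w))) (R : ℝ) (x : Eucl n) :
    Tendsto (fun k => lowPass R (fnL (z k)) x) atTop (𝓝 (lowPass R (fnL w) x)) := by
  obtain ⟨a, ha, -⟩ := lowPass_eq_inner R x
  let T : HTwo n →L[ℝ] ℂ := ((innerSL ℂ a).restrictScalars ℝ).comp
    ((((Lp.fourierTransformₗᵢ (Eucl n) ℂ).toContinuousLinearEquiv : CTwo n →L[ℂ]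
        CTwo n).restrictScalars ℝ).comp
      (cplx.comp fnL))
  have hT : ∀ z, T z = lowPass R (fnL z) x := fun z => (ha _).symm
  simp only [← hT]
  have h1 := hw (Complex.reCLM.comp T)
  have h2 := hw (Complex.imCLM.comp T)
  have h3 := ((Complex.continuous_ofReal.tendsto _).comp h1).add
    (((Complex.continuous_ofReal.tendsto _).comp h2).mul_const Complex.I)
  simpa [Function.comp_def, Complex.re_add_im] using h3

/-- Weakly convergent sequences in `H²` have almost everywhere convergent subsequences. -/
theorem exists_ae_subseq {n : ℕ} {z : ℕ → HTwo n} {w : HTwo n} {B : ℝ} (hB : ∀ k, ‖z k‖ ≤ B)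
    (hw : ∀ L : HTwo n →L[ℝ] ℝ, Tendsto (fun k => L (z k)) atTop (𝓝 (L w))) :
    ∃ φ : ℕ → ℕ, StrictMono φ ∧
      ∀ᵐ x, Tendsto (fun k => fnL (z (φ k)) x) atTop (𝓝 (fnL w x)) := by
  -- an integrable positive weight turns local convergence into global convergence in `L²`
  let ρ : Eucl n → ℝ := fun x => (1 + ‖x‖) ^ (-((n : ℝ) + 1))
  have hρ0 : ∀ x, 0 < ρ x := fun x => by positivity
  have hρ1 : ∀ x, ρ x ≤ 1 := fun x =>
    Real.rpow_le_one_of_one_le_of_nonpos (by linarith [norm_nonneg x])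
        (by linarith [n.cast_nonneg (α := ℝ)])
  have hρi : Integrable ρ := integrable_one_add_norm (by simp)
  have hρm : AEStronglyMeasurable ρ volume := hρi.1
  have hB0 : 0 ≤ B := (norm_nonneg _).trans (hB 0)
  have key : Tendsto (fun k => eLpNorm ((fun x => (ρ x : ℂ) * fnL (z k) x)
      - fun x => (ρ x : ℂ) * fnL w x) 2 volume) atTop (𝓝 0) := by
    have low : ∀ J : ℕ, Tendsto (fun k => eLpNorm (fun x => (ρ x : ℂ) *
        (lowPass (2 ^ J) (fnL (z k)) x - lowPass (2 ^ J) (fnL w) x)) 2 volume) atTop (𝓝 0) := by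
      intro J
      set M : ℝ := √(freqVol n (2 ^ J)) * B + √(freqVol n (2 ^ J)) * ‖w‖ with hM
      have hM0 : 0 ≤ M := by positivity
      have hbd : ∀ k x, ‖lowPass (2 ^ J) (fnL (z k)) x - lowPass (2 ^ J) (fnL w) x‖ ≤ M := by
        intro k x
        refine (norm_sub_le _ _).trans (add_le_add ?_ ?_)
        · exact (norm_lowPass_le _ _ x).trans
            (mul_le_mul_of_nonneg_left ((norm_fnL_le _).trans (hB k)) (Real.sqrt_nonneg _))
        · exact (norm_lowPass_le _ _ x).trans
            (mul_le_mul_of_nonneg_left (norm_fnL_le _) (Real.sqrt_nonneg _))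
      have hint : Tendsto (fun k => ∫⁻ x, ‖(ρ x : ℂ) *
          (lowPass (2 ^ J) (fnL (z k)) x - lowPass (2 ^ J) (fnL w) x)‖ₑ ^ (2 : ℝ)) atTop
          (𝓝 (∫⁻ _ : Eucl n, 0)) := by
        refine tendsto_lintegral_of_dominated_convergence' (fun x => ENNReal.ofReal (M ^ 2 * ρ x))
          ?_ ?_ ?_ ?_
        · intro k
          refine AEMeasurable.pow_const (AEStronglyMeasurable.enorm ?_) _
          exact (Complex.continuous_ofReal.comp_aestronglyMeasurable hρm).mul
            ((continuous_lowPass _ _).sub (continuous_lowPass _ _)).aestronglyMeasurable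
        · intro k
          refine Eventually.of_forall fun x => ?_
          dsimp only
          rw [← ofReal_norm, ENNReal.ofReal_rpow_of_nonneg (norm_nonneg _) (by norm_num)]
          refine ENNReal.ofReal_le_ofReal ?_
          rw [norm_mul, Complex.norm_real, Real.norm_of_nonneg (hρ0 x).le, Real.rpow_two, mul_pow,
            mul_comm (M ^ 2)]
          have h1 : ρ x ^ 2 ≤ ρ x := by nlinarith [hρ0 x, hρ1 x]
          have h2 := hbd k x
          gcongr
        · exact (hρi.const_mul _).lintegral_lt_top.ne
        · refine Eventually.of_forall fun x => ?_
          have h1 := ((tendsto_lowPass hw (2 ^ J) x).sub_const (lowPass (2 ^ J) (fnL w)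
              x)).const_mul
            (ρ x : ℂ)
          rw [sub_self, mul_zero] at h1
          have h2 := (ENNReal.continuous_rpow_const (y := (2 : ℝ))).tendsto 0 |>.comp
            (by simpa using h1.enorm)
          simpa [Function.comp_def] using h2
      simp only [lintegral_zero] at hint
      have h3 := ((ENNReal.continuous_rpow_const (y := (1 / 2 : ℝ))).tendsto 0).comp hint
      simp only [one_div, ENNReal.zero_rpow_of_pos (show (0 : ℝ) < 2⁻¹ by norm_num)] at h3
      refine h3.congr fun k => ?_
      rw [eLpNorm_eq_lintegral_rpow_enorm_toReal (by norm_num) (by norm_num)]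
      simp
    rw [ENNReal.tendsto_nhds_zero]
    intro ε hε
    -- the high frequencies are uniformly small in `L²`
    obtain ⟨J, hJ⟩ : ∃ J : ℕ, ENNReal.ofReal ((((2 : ℝ) ^ J) ^ 2)⁻¹ * B)
        + ENNReal.ofReal ((((2 : ℝ) ^ J) ^ 2)⁻¹ * ‖w‖) < ε := by
      have ht : ∀ b : ℝ, Tendsto (fun m : ℕ => ENNReal.ofReal ((((2 : ℝ) ^ m) ^ 2)⁻¹ * b))
          atTop (𝓝 0) := by
        intro b
        rw [← ENNReal.ofReal_zero]
        refine ENNReal.tendsto_ofReal ?_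
        have : Tendsto (fun m : ℕ => ((1 / 4 : ℝ)) ^ m * b) atTop (𝓝 (0 * b)) :=
          (tendsto_pow_atTop_nhds_zero_of_lt_one (by norm_num) (by norm_num)).mul_const _
        rw [zero_mul] at this
        refine this.congr fun m => ?_
        rw [← pow_mul, mul_comm m 2, pow_mul, one_div, inv_pow]; norm_num
      have h2 := (ht B).add (ht ‖w‖)
      rw [add_zero] at h2
      exact (h2.eventually_lt_const hε).exists
    obtain ⟨ε', hε', hε''⟩ : ∃ ε' : ENNReal, 0 < ε' ∧ ε' + (ENNReal.ofReal ((((2 : ℝ) ^ J)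
        ^ 2)⁻¹ * B)
        + ENNReal.ofReal ((((2 : ℝ) ^ J) ^ 2)⁻¹ * ‖w‖)) ≤ ε :=
      ⟨_, tsub_pos_of_lt hJ, (tsub_add_cancel_of_le hJ.le).le⟩
    filter_upwards [(ENNReal.tendsto_nhds_zero.1 (low J)) ε' hε'] with k hk
    refine le_trans ?_ hε''
    have hm : ∀ v : HTwo n, AEStronglyMeasurable (fun x => (ρ x : ℂ) *
        ((fnL v x : ℂ) - lowPass (2 ^ J) (fnL v) x)) volume := fun v =>
      (Complex.continuous_ofReal.comp_aestronglyMeasurable hρm).mul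
        ((Complex.continuous_ofReal.comp_aestronglyMeasurable (Lp.memLp _).1).sub
          (continuous_lowPass _ _).aestronglyMeasurable)
    have hm' : AEStronglyMeasurable (fun x => (ρ x : ℂ) *
        (lowPass (2 ^ J) (fnL (z k)) x - lowPass (2 ^ J) (fnL w) x)) volume :=
      (Complex.continuous_ofReal.comp_aestronglyMeasurable hρm).mul
        ((continuous_lowPass _ _).sub (continuous_lowPass _ _)).aestronglyMeasurable
    have hhi : ∀ v : HTwo n, eLpNorm (fun x => (ρ x : ℂ) *
        ((fnL v x : ℂ) - lowPass (2 ^ J) (fnL v) x)) 2 volume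
        ≤ ENNReal.ofReal ((((2 : ℝ) ^ J) ^ 2)⁻¹ * ‖v‖) := by
      intro v
      refine le_trans (eLpNorm_mono fun x => ?_) (eLpNorm_sub_lowPass_le (by positivity) v)
      rw [norm_mul, Complex.norm_real, Real.norm_of_nonneg (hρ0 x).le]
      exact mul_le_of_le_one_left (norm_nonneg _) (hρ1 x)
    have e : ((fun x => (ρ x : ℂ) * fnL (z k) x) - fun x => (ρ x : ℂ) * fnL w x)
        = (fun x => (ρ x : ℂ) * (lowPass (2 ^ J) (fnL (z k)) x - lowPass (2 ^ J) (fnL w) x))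
          + ((fun x => (ρ x : ℂ) * ((fnL (z k) x : ℂ) - lowPass (2 ^ J) (fnL (z k)) x))
            - fun x => (ρ x : ℂ) * ((fnL w x : ℂ) - lowPass (2 ^ J) (fnL w) x)) := by
      funext x
      simp only [Pi.sub_apply, Pi.add_apply]
      ring
    rw [e]
    refine (eLpNorm_add_le hm' ((hm _).sub (hm _)) (by norm_num)).trans (add_le_add hk ?_)
    refine (eLpNorm_sub_le (hm _) (hm _) (by norm_num)).trans (add_le_add ?_ (hhi w))
    refine (hhi _).trans (ENNReal.ofReal_le_ofReal ?_)
    have := hB k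
    gcongr
  have hmz : ∀ v : HTwo n, AEStronglyMeasurable (fun x => (ρ x : ℂ) * fnL v x) volume := fun v =>
    (Complex.continuous_ofReal.comp_aestronglyMeasurable hρm).mul
      (Complex.continuous_ofReal.comp_aestronglyMeasurable (Lp.memLp _).1)
  obtain ⟨φ, hφ, hae⟩ := (tendstoInMeasure_of_tendsto_eLpNorm (by norm_num) (fun k => hmz (z k))
    (hmz w) key).exists_seq_tendsto_ae
  refine ⟨φ, hφ, ?_⟩
  filter_upwards [hae] with x hx
  have h1 := (Complex.continuous_re.tendsto _).comp (hx.const_mul ((ρ x : ℂ)⁻¹))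
  have h0 : (ρ x : ℂ) ≠ 0 := by exact_mod_cast (hρ0 x).ne'
  simpa [Function.comp_def, inv_mul_cancel_left₀ h0] using h1

/-! ### The nonlinearity -/

/-- `f` vanishes at `0` and is locally Lipschitz with a constant growing like the power `p - 1`. -/
structure PolyLipschitz (f : ℝ → ℝ) (C p : ℝ) : Prop where
  pos : 0 < C
  one_le : 1 ≤ p
  zero : f 0 = 0
  lip : ∀ u v, |f u - f v| ≤ C * (|u| + |v|) ^ (p - 1) * |u - v|

namespace PolyLipschitz

variable {f : ℝ → ℝ} {C p : ℝ}

theorem lipschitzOnWith (h : PolyLipschitz f C p) {R : ℝ} (hR : 0 ≤ R) :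
    LipschitzOnWith (Real.toNNReal (C * (R + R) ^ (p - 1))) f (Set.Icc (-R) R) := by
  refine LipschitzOnWith.of_dist_le_mul fun u hu v hv => ?_
  rw [Real.dist_eq, Real.dist_eq, Real.coe_toNNReal _ (by have := h.pos; positivity)]
  refine (h.lip u v).trans ?_
  have h1 : |u| ≤ R := abs_le.2 hu
  have h2 : |v| ≤ R := abs_le.2 hv
  have := h.pos
  have := h.one_le
  gcongr

theorem continuous (h : PolyLipschitz f C p) : Continuous f := by
  refine continuous_iff_continuousAt.2 fun u => ?_
  have h1 := (h.lipschitzOnWith (R := |u| + 1) (by positivity)).continuousOn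
  refine h1.continuousAt (Icc_mem_nhds ?_ ?_)
  · linarith [neg_abs_le u]
  · linarith [le_abs_self u]

theorem abs_le (h : PolyLipschitz f C p) (u : ℝ) : |f u| ≤ C * |u| ^ p := by
  have h1 := h.lip u 0
  rw [h.zero, sub_zero, sub_zero, abs_zero, add_zero, mul_assoc] at h1
  refine h1.trans (le_of_eq ?_)
  congr 1
  have := h.one_le
  rcases eq_or_ne u 0 with rfl | hu
  · rw [abs_zero, mul_zero, Real.zero_rpow (by linarith)]
  · rw [← Real.rpow_add_one (abs_pos.2 hu).ne']; congr 1; ring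

theorem hasDerivAt_primitive (h : PolyLipschitz f C p) (u : ℝ) :
    HasDerivAt (primitive f) (f u) u :=
  intervalIntegral.integral_hasDerivAt_right (h.continuous.intervalIntegrable _ _)
    h.continuous.stronglyMeasurable.stronglyMeasurableAtFilter h.continuous.continuousAt

theorem continuous_primitive (h : PolyLipschitz f C p) : Continuous (primitive f) :=
  continuous_iff_continuousAt.2 fun u => (h.hasDerivAt_primitive u).continuousAt

theorem primitive_zero : primitive f 0 = 0 := by simp [primitive]

theorem primitive_sub_le (h : PolyLipschitz f C p) (u v : ℝ) :
    |primitive f u - primitive f v| ≤ C * (|u| + |v|) ^ p * |u - v| := by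
  have := (convex_segment (𝕜 := ℝ) v u).norm_image_sub_le_of_norm_hasDerivWithin_le
    (f := primitive f) (f' := f) (C := C * (|u| + |v|) ^ p)
    (fun x _ => (h.hasDerivAt_primitive x).hasDerivWithinAt) (fun x hx => ?_)
    (left_mem_segment ℝ v u) (right_mem_segment ℝ v u)
  · simpa [Real.norm_eq_abs] using this
  · have hx' : |x| ≤ |u| + |v| := by
      obtain ⟨a, b, ha, hb, hab, rfl⟩ := hx
      have h1 : |a • v + b • u| ≤ a * |v| + b * |u| := by
        refine (abs_add_le _ _).trans (le_of_eq ?_)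
        simp [abs_mul, abs_of_nonneg ha, abs_of_nonneg hb]
      nlinarith [abs_nonneg u, abs_nonneg v]
    have := h.pos
    have := h.one_le
    refine (h.abs_le x).trans ?_
    gcongr

theorem primitive_remainder_le (h : PolyLipschitz f C p) (u v : ℝ) :
    |primitive f (u + v) - primitive f u - f u * v|
      ≤ C * 2 ^ (p - 1) * ((|u| + |v|) ^ (p - 1) * |v| * |v|) := by
  have hp := h.one_le
  have hC := h.pos
  have := (convex_segment (𝕜 := ℝ) 0 v).norm_image_sub_le_of_norm_hasDerivWithin_le
    (f := fun s => primitive f (u + s) - f u * s) (f' := fun s => f (u + s) - f u)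
    (C := C * (2 * (|u| + |v|)) ^ (p - 1) * |v|)
    (fun x _ => ?_) (fun x hx => ?_) (left_mem_segment ℝ 0 v) (right_mem_segment ℝ 0 v)
  · simp only [add_zero, mul_zero, sub_zero, Real.norm_eq_abs] at this
    rw [Real.mul_rpow (by norm_num) (by positivity)] at this
    calc _ = |primitive f (u + v) - f u * v - primitive f u| := by congr 1; ring
      _ ≤ _ := this
      _ = _ := by ring
  · have h1 := (h.hasDerivAt_primitive (u + x)).comp_const_add u x
    have h2 := (hasDerivAt_id x).const_mul (f u)
    have := h1.sub h2
    simp only [id, mul_one] at this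
    exact this.hasDerivWithinAt
  · have hx' : |x| ≤ |v| := by
      obtain ⟨a, b, ha, hb, hab, rfl⟩ := hx
      rw [smul_zero, zero_add, smul_eq_mul, abs_mul, abs_of_nonneg hb]
      nlinarith [abs_nonneg v]
    have h3 := h.lip (u + x) u
    rw [add_sub_cancel_left] at h3
    refine h3.trans ?_
    have h4 := abs_add_le u x
    have : |u + x| + |u| ≤ 2 * (|u| + |v|) := by linarith [abs_nonneg v]
    gcongr

theorem mul_sub_le (h : PolyLipschitz f C p) (u v : ℝ) :
    |u * f u - v * f v| ≤ 2 * C * (|u| + |v|) ^ p * |u - v| := by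
  have hp := h.one_le
  have hC := h.pos
  have e : u * f u - v * f v = u * (f u - f v) + (u - v) * f v := by ring
  rw [e]
  refine (abs_add_le _ _).trans ?_
  rw [abs_mul, abs_mul]
  have hs : (|u| + |v|) * (|u| + |v|) ^ (p - 1) = (|u| + |v|) ^ p := by
    rcases eq_or_ne (|u| + |v|) 0 with h0 | h0
    · rw [h0, zero_mul, Real.zero_rpow (by linarith)]
    · rw [mul_comm, ← Real.rpow_add_one h0]; congr 1; ring
  have h1 : |u| * |f u - f v| ≤ C * (|u| + |v|) ^ p * |u - v| := by
    calc |u| * |f u - f v| ≤ (|u| + |v|) * (C * (|u| + |v|) ^ (p - 1) * |u - v|) := by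
          gcongr
          · linarith [abs_nonneg v]
          · exact h.lip u v
      _ = C * ((|u| + |v|) * (|u| + |v|) ^ (p - 1)) * |u - v| := by ring
      _ = _ := by rw [hs]
  have h2 : |u - v| * |f v| ≤ C * (|u| + |v|) ^ p * |u - v| := by
    have : |f v| ≤ C * (|u| + |v|) ^ p := by
      refine (h.abs_le v).trans ?_
      gcongr
      linarith [abs_nonneg u]
    calc _ ≤ |u - v| * (C * (|u| + |v|) ^ p) := by gcongr
      _ = _ := by ring
  linarith

end PolyLipschitz

/-- Both `f` and the reflected nonlinearity `u ↦ -f (-u)` satisfy `A4`. -/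
theorem A4.reflect {f : ℝ → ℝ} (h : A4 f) : A4 (fun u => -f (-u)) := by
  have h1 := (Measure.measurePreserving_neg (volume : Measure ℝ)).quasiMeasurePreserving.ae h
  filter_upwards [h1] with u hu
  have hd : deriv (fun u => -f (-u)) u = deriv f (-u) := by
    rw [deriv.fun_neg, deriv_comp_neg, neg_neg]
  rw [hd]
  have e : u ^ 2 * deriv f (-u) - u * -f (-u) = (-u) ^ 2 * deriv f (-u) - -u * f (-u) := by ring
  rw [e, neg_eq_zero]
  exact hu

theorem PolyLipschitz.reflect {f : ℝ → ℝ} {C p : ℝ} (h : PolyLipschitz f C p) :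
    PolyLipschitz (fun u => -f (-u)) C p where
  pos := h.pos
  one_le := h.one_le
  zero := by simp [h.zero]
  lip u v := by
    have := h.lip (-u) (-v)
    rw [abs_neg, abs_neg] at this
    calc |-f (-u) - -f (-v)| = |f (-u) - f (-v)| := by rw [← abs_neg]; congr 1; ring
      _ ≤ _ := this
      _ = _ := by congr 1; rw [← abs_neg]; congr 1; ring

/-- By `A4` the quotient `f u / u` is antitone on `(0, ∞)`, strictly so where `f ≠ 0`. The quotient
is absolutely continuous on compact intervals, so its almost everywhere derivative decides. -/
theorem div_antitone {f : ℝ → ℝ} {C p : ℝ} (hf : PolyLipschitz f C p) (h4 : A4 f) {a b : ℝ}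
    (ha : 0 < a) (hab : a < b) : f b / b ≤ f a / a ∧ (f b ≠ 0 → f b / b < f a / a) := by
  let h : ℝ → ℝ := fun u => f u * u⁻¹
  have hac : ∀ a b : ℝ, 0 < a → a ≤ b → AbsolutelyContinuousOnInterval h a b := by
    intro a b ha hab
    have h1 : AbsolutelyContinuousOnInterval f a b := by
      refine ((hf.lipschitzOnWith (R := b) (by linarith)).mono ?_).absolutelyContinuousOnInterval
      rw [Set.uIcc_of_le hab]
      exact Set.Icc_subset_Icc_left (by linarith)
    have h2 : AbsolutelyContinuousOnInterval (fun u : ℝ => u⁻¹) a b := by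
      refine ContDiffOn.absolutelyContinuousOnInterval ?_
      refine contDiffOn_inv ℝ |>.mono fun x hx => ?_
      rw [Set.uIcc_of_le hab] at hx
      exact (lt_of_lt_of_le ha hx.1).ne'
    exact h1.mul h2
  have hder : ∀ u : ℝ, 0 < u → DifferentiableAt ℝ f u →
      deriv h u = (u ^ 2 * deriv f u - u * f u) / u ^ 3 := by
    intro u hu hd
    have h0 : deriv h u = _ := (hd.hasDerivAt.mul (hasDerivAt_inv hu.ne')).deriv
    rw [h0]
    field_simp
    ring
  have hdiff : ∀ a b : ℝ, 0 < a → a ≤ b → ∀ᵐ u, u ∈ Set.Icc a b → DifferentiableAt ℝ f u := by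
    intro a b ha hab
    have := ((hf.lipschitzOnWith (R := b) (by linarith)).mono (s := Set.uIcc a b) (by
      rw [Set.uIcc_of_le hab]
      exact Set.Icc_subset_Icc_left (by
          linarith))).absolutelyContinuousOnInterval.ae_differentiableAt
    rwa [Set.uIcc_of_le hab] at this
  have anti : ∀ a b : ℝ, 0 < a → a ≤ b → h b ≤ h a := by
    intro a b ha hab
    have := (hac a b ha hab).integral_deriv_eq_sub
    have h2 : ∫ x in a..b, deriv h x ≤ 0 := by
      rw [intervalIntegral.integral_of_le hab]
      refine setIntegral_nonpos_ae measurableSet_Ioc ?_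
      filter_upwards [h4, hdiff a b ha hab] with u h4u hdu hu
      rw [hder u (ha.trans hu.1) (hdu ⟨hu.1.le, hu.2⟩)]
      exact div_nonpos_of_nonpos_of_nonneg h4u.1 (pow_nonneg (ha.trans hu.1).le 3)
    linarith
  have hab' := anti a b ha hab.le
  simp only [div_eq_mul_inv]
  refine ⟨hab', fun hfb => lt_of_le_of_ne hab' fun heq => hfb ?_⟩
  have hconst : ∀ u ∈ Set.Ioo a b, h u = h b := by
    intro u hu
    refine le_antisymm ?_ (anti u b (ha.trans hu.1) hu.2.le)
    calc h u ≤ h a := anti a u ha hu.1.le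
      _ = h b := heq.symm
  have : (ae (volume.restrict (Set.Ioo a b))).NeBot := by
    rw [ae_neBot, Ne, Measure.restrict_eq_zero]
    simp [hab]
  have hae : ∀ᵐ u ∂(volume.restrict (Set.Ioo a b)), u ∈ Set.Ioo a b ∧ DifferentiableAt ℝ f u ∧
      (u ^ 2 * deriv f u - u * f u = 0 ↔ f u = 0) := by
    rw [ae_restrict_iff' measurableSet_Ioo]
    filter_upwards [h4, hdiff a b ha hab.le] with u h4u hdu hu
    exact ⟨hu, hdu ⟨hu.1.le, hu.2.le⟩, h4u.2⟩
  obtain ⟨u, hu, hdu, hiff⟩ := hae.exists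
  have hu0 : 0 < u := ha.trans hu.1
  have hd0 : deriv h u = 0 := by
    have : h =ᶠ[𝓝 u] fun _ => h b := by
      filter_upwards [isOpen_Ioo.mem_nhds hu] with v hv using hconst v hv
    rw [this.deriv_eq, deriv_const]
  rw [hder u hu0 hdu, div_eq_zero_iff] at hd0
  have hfu : f u = 0 := hiff.1 (hd0.resolve_right (by positivity))
  have hub := hconst u hu
  simp only [h, hfu, zero_mul] at hub
  have : b⁻¹ ≠ 0 := inv_ne_zero (by linarith)
  exact (mul_eq_zero.1 hub.symm).resolve_right this

/-- For positive `u` the nonlinearity is non-positive, and `u f u` scales superquadratically. The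
sign holds because the antitone function `f u / u` tends to `0` at `0`. -/
theorem scale_pos {f : ℝ → ℝ} {C p C' q : ℝ} (hf : PolyLipschitz f C p) (h4 : A4 f)
    (hq : 1 < q) (hfq : ∀ u, |f u| ≤ C' * |u| ^ q) {u : ℝ} (hu : 0 < u) :
    f u ≤ 0 ∧ ∀ t, 0 < t → t < 1 →
      t ^ 2 * (u * f u) ≤ t * u * f (t * u) ∧ (f u ≠ 0 → t ^ 2 * (u * f u) < t * u * f (t * u)) :=
          by
  constructor
  · have h1 : ∀ᶠ a in 𝓝[>] (0 : ℝ), f u / u ≤ C' * a ^ (q - 1) := by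
      have : Set.Ioo (0 : ℝ) u ∈ 𝓝[>] (0 : ℝ) := Ioo_mem_nhdsGT hu
      filter_upwards [this] with a ha
      refine (div_antitone hf h4 ha.1 ha.2).1.trans ?_
      rw [div_le_iff₀ ha.1, mul_assoc, ← Real.rpow_add_one ha.1.ne', sub_add_cancel]
      have := hfq a
      rw [abs_of_pos ha.1] at this
      exact (le_abs_self _).trans this
    have h2 : Tendsto (fun a : ℝ => C' * a ^ (q - 1)) (𝓝[>] 0) (𝓝 (C' * 0 ^ (q - 1))) :=
      (((Real.continuousAt_rpow_const 0 _ (Or.inr (by linarith))).tendsto).mono_left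
        nhdsWithin_le_nhds).const_mul _
    rw [Real.zero_rpow (by linarith), mul_zero] at h2
    have h3 := ge_of_tendsto h2 h1
    by_contra! hcon
    exact absurd h3 (not_le.2 (div_pos hcon hu))
  · intro t ht0 ht1
    have htu : 0 < t * u := by positivity
    obtain ⟨h1, h2⟩ := div_antitone hf h4 htu (show t * u < u by nlinarith)
    have e1 : (t * u) ^ 2 * (f u / u) = t ^ 2 * (u * f u) := by field_simp
    have e2 : (t * u) ^ 2 * (f (t * u) / (t * u)) = t * u * f (t * u) := by field_simp
    rw [← e1, ← e2]
    exact ⟨mul_le_mul_of_nonneg_left h1 (by positivity),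
      fun h => mul_lt_mul_of_pos_left (h2 h) (by positivity)⟩

/-- The sign and the scaling property on both half-lines, the negative one by reflection. -/
theorem mul_nonpos_and_scale {f : ℝ → ℝ} {C p C' q : ℝ} (hf : PolyLipschitz f C p) (h4 : A4 f)
    (hq : 1 < q) (hfq : ∀ u, |f u| ≤ C' * |u| ^ q) (u : ℝ) :
    u * f u ≤ 0 ∧ ∀ t, 0 < t → t < 1 →
      t ^ 2 * (u * f u) ≤ t * u * f (t * u) ∧
        (u * f u ≠ 0 → t ^ 2 * (u * f u) < t * u * f (t * u)) := by
  rcases lt_trichotomy u 0 with hu | rfl | hu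
  · obtain ⟨h1, h2⟩ := scale_pos hf.reflect h4.reflect hq (fun u => by
      rw [abs_neg, ← abs_neg u]; exact hfq (-u)) (neg_pos.2 hu)
    rw [neg_neg] at h1
    refine ⟨by nlinarith, fun t ht0 ht1 => ?_⟩
    have h3 := h2 t ht0 ht1
    simp only [neg_neg, mul_neg, neg_mul] at h3
    simp only [ne_eq, neg_eq_zero] at h3
    exact ⟨h3.1, fun h => h3.2 fun h0 => h (by rw [h0, mul_zero])⟩
  · exact ⟨by simp, fun t _ _ => ⟨by simp, by simp⟩⟩
  · obtain ⟨h1, h2⟩ := scale_pos hf h4 hq hfq hu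
    refine ⟨by nlinarith, fun t ht0 ht1 => ⟨(h2 t ht0 ht1).1,
        fun h => (h2 t ht0 ht1).2 fun h0 => ?_⟩⟩
    exact h (by rw [h0, mul_zero])

/-- By `A1` the quantity `-u f u` grows at least like `u ^ 2` at `-∞`. -/
theorem exists_mul_le {f : ℝ → ℝ} (h1 : A1 f) (hs : ∀ u, u * f u ≤ 0) :
    ∃ M, ∀ u ≤ 0, u * f u ≤ -u ^ 2 - M * u := by
  obtain ⟨m, -, hm⟩ := EReal.lt_iff_exists_real_btwn.1 h1.2
  have h2 := eventually_lt_of_lt_liminf hm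
  obtain ⟨a, ha⟩ := eventually_atBot.1 h2
  refine ⟨max |m| |a|, fun u hu => ?_⟩
  rcases le_total u a with hua | hua
  · have h3 : m < f u + u := by exact_mod_cast ha u hua
    have h4 := neg_abs_le m
    have h5 := le_max_left |m| |a|
    nlinarith
  · have h3 := neg_abs_le a
    have h5 := le_max_right |m| |a|
    nlinarith [hs u]

theorem gFun_mul_le {f : ℝ → ℝ} {μ : ℝ} (h3 : A3 f μ) {t : ℝ} (ht0 : 0 ≤ t) (ht1 : t ≤ 1) (u : ℝ) :
    gFun f μ (t * u) ≤ t * gFun f μ u := by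
  have h0 : gFun f μ 0 = 0 := by simp [gFun, PolyLipschitz.primitive_zero]
  have := h3.2.2.1.2 (Set.mem_univ u) (Set.mem_univ 0) ht0 (sub_nonneg.2 ht1) (by ring)
  simpa [h0] using this

theorem neg_mul_le_of_pos {f : ℝ → ℝ} {C p C' q : ℝ} (hf : PolyLipschitz f C p)
    (hC' : 0 < C') (hfq : ∀ u, |f u| ≤ C' * |u| ^ q) (hG0 : ∀ u, 0 ≤ gFun f 2 u)
    (hG : ∀ t u, 0 ≤ t → t ≤ 1 → gFun f 2 (t * u) ≤ t * gFun f 2 u) (hq : 1 < q)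
    {u κ : ℝ} (hu : 0 < u) (hκ : 0 < κ) (hκ1 : κ ≤ 1) :
    -(u * f u) ≤ 2 * C' * κ ^ (q - 1) * u ^ (q + 1) + 4 / κ * gFun f 2 u := by
  set v : ℝ := κ * u with hvdef
  have hv : 0 < v := by positivity
  have hvu : v ≤ u := by rw [hvdef]; nlinarith
  set X := gFun f 2 u / u with hX
  have hder : ∀ s : ℝ, 0 < s → HasDerivAt (fun s => -primitive f s / s ^ 2 + 2 * X / s)
      (2 * gFun f 2 s / s ^ 3 - 2 * X / s ^ 2) s := by
    intro s hs
    have h1 := ((hf.hasDerivAt_primitive s).neg.div (hasDerivAt_pow 2 s) (by positivity)).add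
      ((hasDerivAt_const s (2 * X)).div (hasDerivAt_id s) hs.ne')
    convert! h1 using 1
    simp only [gFun, Nat.cast_ofNat, id, Pi.neg_apply]
    field_simp
    ring
  have hanti : AntitoneOn (fun s => -primitive f s / s ^ 2 + 2 * X / s) (Set.Icc v u) := by
    refine antitoneOn_of_deriv_nonpos (convex_Icc v u) (fun s hs => ?_) (fun s hs => ?_)
        (fun s hs => ?_)
    · exact (hder s (hv.trans_le hs.1)).continuousAt.continuousWithinAt
    · rw [interior_Icc] at hs
      exact (hder s (hv.trans hs.1)).differentiableAt.differentiableWithinAt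
    · rw [interior_Icc] at hs
      have hs0 : 0 < s := hv.trans hs.1
      rw [(hder s hs0).deriv]
      have h2 : gFun f 2 s ≤ s * X := by
        have := hG (s / u) u (by positivity) ((div_le_one hu).2 hs.2.le)
        rw [div_mul_cancel₀ _ hu.ne'] at this
        refine this.trans (le_of_eq ?_)
        rw [hX]; ring
      rw [sub_nonpos, div_le_div_iff₀ (by positivity) (by positivity)]
      have h5 : 0 ≤ 2 * s ^ 2 := by positivity
      nlinarith [mul_le_mul_of_nonneg_left h2 h5]
  have hvu' := hanti (Set.left_mem_Icc.2 hvu) (Set.right_mem_Icc.2 hvu) hvu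
  simp only at hvu'
  have hprim : -primitive f v ≤ C' * v ^ (q + 1) := by
    have h6 := intervalIntegral.norm_integral_le_of_norm_le_const (a := 0) (b := v) (f := f)
      (C := C' * v ^ q) (fun x hx => by
        rw [Set.uIoc_of_le hv.le] at hx
        refine (hfq x).trans ?_
        rw [abs_of_pos hx.1]
        have := hx.1.le
        have := hx.2
        gcongr)
    rw [sub_zero, abs_of_pos hv, mul_assoc, ← Real.rpow_add_one hv.ne'] at h6
    have h7 := neg_abs_le (primitive f v)
    have h8 : |primitive f v| ≤ C' * v ^ (q + 1) := h6
    linarith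
  have hv2 : -primitive f v / v ^ 2 ≤ C' * v ^ (q - 1) := by
    rw [div_le_iff₀ (by positivity), mul_assoc, ← Real.rpow_natCast, ← Real.rpow_add hv]
    refine hprim.trans (le_of_eq ?_)
    congr 2; push_cast; ring
  have hΦ : -primitive f u ≤ u ^ 2 * (C' * v ^ (q - 1)) + u ^ 2 * (2 * X / v) - 2 * gFun f 2 u := by
    have h9 : -primitive f u / u ^ 2 ≤ C' * v ^ (q - 1) + 2 * X / v - 2 * X / u := by linarith
    rw [div_le_iff₀ (by positivity)] at h9
    have h10 : 2 * X / u * u ^ 2 = 2 * gFun f 2 u := by rw [hX]; field_simp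
    linarith [h9, h10, mul_comm (u ^ 2) (C' * v ^ (q - 1)), mul_comm (u ^ 2) (2 * X / v)]
  have e : -(u * f u) = 2 * gFun f 2 u + 2 * -primitive f u := by simp only [gFun]; ring
  have e1 : u ^ 2 * (C' * v ^ (q - 1)) = C' * κ ^ (q - 1) * u ^ (q + 1) := by
    have : u ^ (q + 1) = u ^ 2 * u ^ (q - 1) := by
      rw [← Real.rpow_natCast, ← Real.rpow_add hu]; congr 1; push_cast; ring
    rw [hvdef, Real.mul_rpow hκ.le hu.le, this]; ring
  have e2 : u ^ 2 * (2 * X / v) = 2 / κ * gFun f 2 u := by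
    rw [hX, hvdef]; field_simp
  have e3 : 4 / κ * gFun f 2 u = 2 * (2 / κ * gFun f 2 u) := by ring
  rw [e1, e2] at hΦ
  rw [e, e3]
  linarith [hG0 u]

/-- If `A3` holds with the borderline exponent `2`,
    then `-u f u` is controlled by `G` up to a small multiple of `|u| ^ (q + 1)`. The reason is that
    the derivative of
`-F(s) / s²` is `2 G(s) / s³` and that `G(s) ≤ s G(u) / u` by convexity, so that one can
integrate from `κ u` to `u`. -/
theorem neg_mul_le {f : ℝ → ℝ} {C p C' q : ℝ} (hf : PolyLipschitz f C p)
    (hC' : 0 < C') (hq : 1 < q) (hfq : ∀ u, |f u| ≤ C' * |u| ^ q) (h3 : A3 f 2)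
    (u : ℝ) {κ : ℝ} (hκ : 0 < κ) (hκ1 : κ ≤ 1) :
    -(u * f u) ≤ 2 * C' * κ ^ (q - 1) * |u| ^ (q + 1) + 4 / κ * gFun f 2 u := by
  rcases lt_trichotomy u 0 with hu | rfl | hu
  · have hpr : ∀ u, primitive (fun u => -f (-u)) u = primitive f (-u) := by
      intro u
      simp only [primitive]
      rw [intervalIntegral.integral_neg, intervalIntegral.integral_comp_neg, neg_zero,
        intervalIntegral.integral_symm, neg_neg]
    have hg : ∀ u, gFun (fun u => -f (-u)) 2 u = gFun f 2 (-u) := by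
      intro u
      simp only [gFun, hpr]
      ring
    have := neg_mul_le_of_pos hf.reflect hC' (fun u => by
      rw [abs_neg, ← abs_neg u]; exact hfq (-u)) (fun u => by rw [hg]; exact h3.2.1 _)
      (fun t u ht0 ht1 => by
        rw [hg, hg, ← mul_neg]
        exact gFun_mul_le h3 ht0 ht1 (-u)) hq (neg_pos.2 hu) hκ hκ1
    rw [hg, neg_neg] at this
    rw [abs_of_neg hu]
    linarith
  · rw [abs_zero, zero_mul, neg_zero, Real.zero_rpow (by linarith), mul_zero, zero_add]
    exact mul_nonneg (by positivity) (h3.2.1 0)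
  · rw [abs_of_pos hu]
    exact neg_mul_le_of_pos hf hC' hfq h3.2.1 (fun t u ht0 ht1 => gFun_mul_le h3 ht0 ht1 u) hq
      hu hκ hκ1

/-! ### Superposition estimates and the derivative of the action -/

theorem mul_le_rpow_add {p x y w : ℝ} (hp : 1 ≤ p) (hx : 0 ≤ x) (hy : 0 ≤ y) (hw : 0 ≤ w) :
    x ^ (p - 1) * y * w ≤ x ^ (p + 1) + y ^ (p + 1) + w ^ (p + 1) := by
  set m := max x (max y w) with hm
  have hxm : x ≤ m := le_max_left _ _
  have hym : y ≤ m := (le_max_left _ _).trans (le_max_right _ _)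
  have hwm : w ≤ m := (le_max_right _ _).trans (le_max_right _ _)
  have hm0 : 0 ≤ m := hx.trans hxm
  have h1 : x ^ (p - 1) * y * w ≤ m ^ (p + 1) := by
    have e : m ^ (p + 1) = m ^ (p - 1) * m * m := by
      have : p + 1 = (p - 1) + 1 + 1 := by ring
      rw [this, Real.rpow_add_of_nonneg hm0 (by linarith) zero_le_one,
        Real.rpow_add_of_nonneg hm0 (by linarith) zero_le_one, Real.rpow_one]
    rw [e]
    have : x ^ (p - 1) ≤ m ^ (p - 1) := Real.rpow_le_rpow hx hxm (by linarith)
    gcongr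
  have hx' := Real.rpow_nonneg hx (p + 1)
  have hy' := Real.rpow_nonneg hy (p + 1)
  have hw' := Real.rpow_nonneg hw (p + 1)
  refine h1.trans ?_
  rcases max_choice x (max y w) with h | h
  · rw [hm, h]; linarith
  · rcases max_choice y w with h' | h'
    · rw [hm, h, h']; linarith
    · rw [hm, h, h']; linarith

theorem add_rpow_le {r x y : ℝ} (hr : 0 ≤ r) (hx : 0 ≤ x) (hy : 0 ≤ y) :
    (x + y) ^ r ≤ 2 ^ r * (x ^ r + y ^ r) := by
  have hx' := Real.rpow_nonneg hx r
  have hy' := Real.rpow_nonneg hy r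
  have h2 : (0 : ℝ) ≤ 2 ^ r := by positivity
  rcases le_total x y with h | h
  · calc (x + y) ^ r ≤ (2 * y) ^ r := by gcongr; linarith
      _ = 2 ^ r * y ^ r := Real.mul_rpow (by norm_num) hy
      _ ≤ _ := by gcongr; linarith
  · calc (x + y) ^ r ≤ (2 * x) ^ r := by gcongr; linarith
      _ = 2 ^ r * x ^ r := Real.mul_rpow (by norm_num) hx
      _ ≤ _ := by gcongr; linarith

theorem aestronglyMeasurable_fnL {n : ℕ} (z : HTwo n) : AEStronglyMeasurable (fnL z) volume :=
  (Lp.memLp _).1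

theorem aestronglyMeasurable_superposition {n : ℕ} {p : ℝ} (hp : 1 ≤ p) (a b h v : HTwo n) :
    AEStronglyMeasurable (fun x => (|fnL a x| + |fnL b x|) ^ (p - 1) * |fnL h x| * |fnL v x|)
        volume := by
  have hc : Continuous fun t : ℝ => t ^ (p - 1) := Real.continuous_rpow_const (by linarith)
  have hab : ∀ z : HTwo n, AEStronglyMeasurable (fun x => |fnL z x|) volume := fun z =>
    continuous_abs.comp_aestronglyMeasurable (aestronglyMeasurable_fnL z)
  exact ((hc.comp_aestronglyMeasurable ((hab a).add (hab b))).mul (hab h)).mul (hab v)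

/-- The basic trilinear estimate behind all continuity properties of the nonlinear terms. -/
theorem exists_superposition_bound {n : ℕ} {p : ℝ} (hp : 1 ≤ p) (hs : Subcritical n (p + 1)) :
    ∃ K, 0 ≤ K ∧ ∀ a b h v : HTwo n,
      Integrable (fun x => (|fnL a x| + |fnL b x|) ^ (p - 1) * |fnL h x| * |fnL v x|) ∧
      ∀ A s t : ℝ, 0 < A → 0 < s → 0 < t → ‖a‖ ≤ A → ‖b‖ ≤ A → ‖h‖ ≤ s → ‖v‖ ≤ t →
        ∫ x, (|fnL a x| + |fnL b x|) ^ (p - 1) * |fnL h x| * |fnL v x| ≤ K * (A ^ (p - 1) * s * t)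
            := by
  obtain ⟨S, hS, hemb⟩ := exists_integral_rpow_le hs
  have hr0 : 0 < p + 1 := by linarith
  set T : ℝ := 2 ^ (p + 1) with hT
  have hT0 : 0 < T := by positivity
  refine ⟨S * (2 * T + 2), by positivity, fun a b h v => ?_⟩
  -- after scaling, the integrand is dominated by a sum of integrable powers
  have hpt : ∀ A s t : ℝ, 0 < A → 0 < s → 0 < t → ∀ x,
      (|fnL a x| + |fnL b x|) ^ (p - 1) * |fnL h x| * |fnL v x| ≤ A ^ (p - 1) * s * t *
        (T / A ^ (p + 1) * |fnL a x| ^ (p + 1) + T / A ^ (p + 1) * |fnL b x| ^ (p + 1)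
          + 1 / s ^ (p + 1) * |fnL h x| ^ (p + 1) + 1 / t ^ (p + 1) * |fnL v x| ^ (p + 1)) := by
    intro A s t hA hs ht x
    set α := |fnL a x|
    set β := |fnL b x|
    set γ := |fnL h x|
    set δ := |fnL v x|
    have hα : 0 ≤ α := abs_nonneg _
    have hβ : 0 ≤ β := abs_nonneg _
    have hγ : 0 ≤ γ := abs_nonneg _
    have hδ : 0 ≤ δ := abs_nonneg _
    have h1 := mul_le_rpow_add hp (show 0 ≤ (α + β) / A by positivity) (show 0 ≤
        γ / s by positivity)
      (show 0 ≤ δ / t by positivity)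
    rw [Real.div_rpow (by positivity) hA.le, Real.div_rpow (by positivity) hA.le,
      Real.div_rpow hγ hs.le, Real.div_rpow hδ ht.le] at h1
    have h2 := add_rpow_le hr0.le hα hβ
    have e : (α + β) ^ (p - 1) * γ * δ
        = A ^ (p - 1) * s * t * ((α + β) ^ (p - 1) / A ^ (p - 1) * (γ / s) * (δ / t)) := by
      have : A ^ (p - 1) ≠ 0 := by positivity
      field_simp
    rw [e]
    refine mul_le_mul_of_nonneg_left (h1.trans ?_) (by positivity)
    have h3 : (α + β) ^ (p + 1) / A ^ (p + 1)
        ≤ T / A ^ (p + 1) * α ^ (p + 1) + T / A ^ (p + 1) * β ^ (p + 1) := by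
      rw [div_le_iff₀ (by positivity)]
      have : A ^ (p + 1) ≠ 0 := by positivity
      refine h2.trans (le_of_eq ?_)
      rw [← hT]
      field_simp
    have e1 : γ ^ (p + 1) / s ^ (p + 1) = 1 / s ^ (p + 1) * γ ^ (p + 1) := by ring
    have e2 : δ ^ (p + 1) / t ^ (p + 1) = 1 / t ^ (p + 1) * δ ^ (p + 1) := by ring
    rw [e1, e2]
    linarith
  have hI : ∀ z : HTwo n, Integrable (fun x => |fnL z x| ^ (p + 1)) := integrable_rpow_fnL hs
  have hdom : ∀ A s t : ℝ, Integrable (fun x => A ^ (p - 1) * s * t *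
        (T / A ^ (p + 1) * |fnL a x| ^ (p + 1) + T / A ^ (p + 1) * |fnL b x| ^ (p + 1)
          + 1 / s ^ (p + 1) * |fnL h x| ^ (p + 1) + 1 / t ^ (p + 1) * |fnL v x| ^ (p + 1))) :=
    fun A s t => (((((hI a).const_mul _).add ((hI b).const_mul _)).add ((hI h).const_mul _)).add
      ((hI v).const_mul _)).const_mul _
  have hint : Integrable (fun x => (|fnL a x| + |fnL b x|) ^ (p - 1) * |fnL h x| * |fnL v x|) := by
    refine (hdom 1 1 1).mono' (aestronglyMeasurable_superposition hp a b h v)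
      (Eventually.of_forall fun x => ?_)
    rw [Real.norm_of_nonneg (by positivity)]
    exact hpt 1 1 1 one_pos one_pos one_pos x
  refine ⟨hint, fun A s t hA hs' ht haA hbA hhs hvt => ?_⟩
  refine (integral_mono hint (hdom A s t) (hpt A s t hA hs' ht)).trans ?_
  rw [integral_const_mul, integral_add, integral_add, integral_add, integral_const_mul,
    integral_const_mul, integral_const_mul, integral_const_mul]
  rotate_left
  · exact (hI a).const_mul _
  · exact (hI b).const_mul _
  · exact ((hI a).const_mul _).add ((hI b).const_mul _)
  · exact (hI h).const_mul _
  · exact (((hI a).const_mul _).add ((hI b).const_mul _)).add ((hI h).const_mul _)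
  · exact (hI v).const_mul _
  have hb : ∀ (z : HTwo n) (m c : ℝ), 0 < m → 0 ≤ c → ‖z‖ ≤ m →
      c / m ^ (p + 1) * ∫ x, |fnL z x| ^ (p + 1) ≤ c * S := by
    intro z m c hm hc hz
    have h1 : ∫ x, |fnL z x| ^ (p + 1) ≤ S * m ^ (p + 1) := (hemb z).trans (by gcongr)
    calc c / m ^ (p + 1) * ∫ x, |fnL z x| ^ (p + 1) ≤ c / m ^ (p + 1) * (S * m ^ (p + 1)) :=
        by gcongr
      _ = c * S := by
        have : m ^ (p + 1) ≠ 0 := by positivity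
        field_simp
  have b1 := hb a A T hA hT0.le haA
  have b2 := hb b A T hA hT0.le hbA
  have b3 := hb h s 1 hs' zero_le_one hhs
  have b4 := hb v t 1 ht zero_le_one hvt
  rw [mul_comm (S * (2 * T + 2))]
  refine mul_le_mul_of_nonneg_left ?_ (by positivity)
  linarith

/-- The assumptions of the problem in the form in which they are used: growth and Lipschitz bounds
with subcritical exponents, the sign and scaling properties of `u f u`, and coercivity. -/
structure Setup (n : ℕ) (f : ℝ → ℝ) (μ : ℝ) (c : Eucl n) (C p C' q κ : ℝ) : Prop where
  lip : PolyLipschitz f C p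
  posC' : 0 < C'
  hq : 1 < q
  growth : ∀ u, |f u| ≤ C' * |u| ^ q
  subp : Subcritical n (p + 1)
  subq : Subcritical n (q + 1)
  κpos : 0 < κ
  coercive : ∀ z : HTwo n, κ * ‖z‖ ^ 2 ≤ quadForm c z
  a3 : A3 f μ
  sign : ∀ u, u * f u ≤ 0
  scale : ∀ u t, 0 < t → t < 1 → t ^ 2 * (u * f u) ≤ t * u * f (t * u) ∧
    (u * f u ≠ 0 → t ^ 2 * (u * f u) < t * u * f (t * u))
  lower : ∃ M, ∀ u ≤ 0, u * f u ≤ -u ^ 2 - M * u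
  c_ne : c ≠ 0

theorem subcritical_of_lt {n : ℕ} {p : ℝ} (hp : 1 ≤ p)
    (h : 4 < n → p < ((n : ℝ) + 4) / ((n : ℝ) - 4)) : Subcritical n (p + 1) := by
  refine ⟨by linarith, ?_⟩
  have hp0 : 0 < p + 1 := by linarith
  have hinv : 0 < 1 / (p + 1) := by positivity
  by_cases hn : 4 < n
  · have hn' : (4 : ℝ) < n := by exact_mod_cast hn
    have h1 := h hn
    rw [lt_div_iff₀ (by linarith)] at h1
    have e : (n : ℝ) * (1 / 2 - 1 / (p + 1)) = n * (p - 1) / (2 * (p + 1)) := by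
      field_simp; ring
    rw [e, div_lt_iff₀ (by positivity)]
    linarith
  · rcases Nat.eq_zero_or_pos n with rfl | hn0
    · simp
    · have hn' : (n : ℝ) ≤ 4 := by exact_mod_cast not_lt.1 hn
      have hn1 : (0 : ℝ) < n := by exact_mod_cast hn0
      nlinarith

theorem exists_setup {n : ℕ} {f : ℝ → ℝ} {μ : ℝ} {c : Eucl n} (h1 : A1 f) (h2 : A2 n f)
    (h3 : A3 f μ) (h4 : A4 f) (hc0 : 0 < ‖c‖) (hc : ‖c‖ < √2) :
    ∃ C p C' q κ, Setup n f μ c C p C' q κ := by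
  obtain ⟨C, p, q, hC, hp, hq, hlip, hgr, hcrit⟩ := h2
  obtain ⟨κ, hκ, hcoer⟩ := quadForm_coercive hc
  have h0 : f 0 = 0 := by
    have := hgr 0
    rw [abs_zero, Real.zero_rpow (by linarith), mul_zero] at this
    exact abs_eq_zero.1 (le_antisymm this (abs_nonneg _))
  have hf : PolyLipschitz f C p := ⟨hC, hp, h0, hlip⟩
  have hs := mul_nonpos_and_scale hf h4 hq hgr
  exact ⟨C, p, C, q, κ, hf, hC, hq, hgr, subcritical_of_lt hp fun h => (hcrit h).1,
    subcritical_of_lt hq.le fun h => (hcrit h).2, hκ, hcoer, h3, fun u => (hs u).1,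
    fun u => (hs u).2, exists_mul_le h1 fun u => (hs u).1, norm_pos_iff.1 hc0⟩

/-- The symmetric bilinear form belonging to the quadratic form. -/
def bilin {n : ℕ} (c : Eucl n) (z : HTwo n) : HTwo n →L[ℝ] ℝ :=
  (innerSL ℝ (laplL z)).comp laplL - (innerSL ℝ (dirL c z)).comp (dirL c)
    + (innerSL ℝ (fnL z)).comp fnL

theorem bilin_apply {n : ℕ} (c : Eucl n) (z v : HTwo n) :
    bilin c z v = inner ℝ (laplL z) (laplL v) - inner ℝ (dirL c z) (dirL c v)
      + inner ℝ (fnL z) (fnL v) := rfl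

theorem bilin_self {n : ℕ} (c : Eucl n) (z : HTwo n) : bilin c z z = quadForm c z := by
  rw [bilin_apply, quadForm_eq, real_inner_self_eq_norm_sq, real_inner_self_eq_norm_sq,
    real_inner_self_eq_norm_sq]

theorem bilin_comm {n : ℕ} (c : Eucl n) (z v : HTwo n) : bilin c z v = bilin c v z := by
  simp only [bilin_apply, real_inner_comm]

theorem bilin_smul_left {n : ℕ} (c : Eucl n) (t : ℝ) (z v : HTwo n) :
    bilin c (t • z) v = t * bilin c z v := by
  rw [bilin_comm, map_smul, smul_eq_mul, bilin_comm]

theorem quadForm_add {n : ℕ} (c : Eucl n) (z h : HTwo n) :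
    quadForm c (z + h) = quadForm c z + 2 * bilin c z h + quadForm c h := by
  rw [← bilin_self, ← bilin_self, ← bilin_self, map_add, bilin_comm c (z + h) z,
    bilin_comm c (z + h) h, map_add, map_add, bilin_comm c h z]
  ring

theorem quadForm_smul {n : ℕ} (c : Eucl n) (t : ℝ) (z : HTwo n) :
    quadForm c (t • z) = t ^ 2 * quadForm c z := by
  rw [← bilin_self, ← bilin_self, bilin_smul_left, map_smul, smul_eq_mul]; ring

theorem fnL_add_ae {n : ℕ} (z h : HTwo n) : ∀ᵐ x, fnL (z + h) x = fnL z x + fnL h x := by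
  rw [map_add]; exact Lp.coeFn_add _ _

theorem fnL_sub_ae {n : ℕ} (z h : HTwo n) : ∀ᵐ x, fnL (z - h) x = fnL z x - fnL h x := by
  rw [map_sub]; exact Lp.coeFn_sub _ _

theorem fnL_smul_ae {n : ℕ} (t : ℝ) (z : HTwo n) : ∀ᵐ x, fnL (t • z) x = t * fnL z x := by
  rw [map_smul]; exact Lp.coeFn_smul _ _

namespace Setup

variable {n : ℕ} {f : ℝ → ℝ} {μ : ℝ} {c : Eucl n} {C p C' q κ : ℝ}

theorem quadForm_nonneg (S : Setup n f μ c C p C' q κ) (z : HTwo n) : 0 ≤ quadForm c z :=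
  (mul_nonneg S.κpos.le (sq_nonneg _)).trans (S.coercive z)

theorem integrable_primitive (S : Setup n f μ c C p C' q κ) (z : HTwo n) :
    Integrable (fun x => primitive f (fnL z x)) := by
  refine ((integrable_rpow_fnL S.subp z).const_mul C).mono'
    (S.lip.continuous_primitive.comp_aestronglyMeasurable (aestronglyMeasurable_fnL z))
    (Eventually.of_forall fun x => ?_)
  have := S.lip.primitive_sub_le (fnL z x) 0
  rw [PolyLipschitz.primitive_zero, sub_zero, sub_zero, abs_zero, add_zero, mul_assoc] at this
  rw [Real.rpow_add_one' (abs_nonneg _) (by linarith [S.lip.one_le])]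
  exact this

theorem integrable_mul_self (S : Setup n f μ c C p C' q κ) (z : HTwo n) :
    Integrable (fun x => fnL z x * f (fnL z x)) := by
  refine ((integrable_rpow_fnL S.subp z).const_mul C).mono'
    ((aestronglyMeasurable_fnL z).mul
      (S.lip.continuous.comp_aestronglyMeasurable (aestronglyMeasurable_fnL z)))
    (Eventually.of_forall fun x => ?_)
  rw [Real.rpow_add_one' (abs_nonneg _) (by linarith [S.lip.one_le]), norm_mul, Real.norm_eq_abs,
    Real.norm_eq_abs, mul_comm, ← mul_assoc]
  exact mul_le_mul_of_nonneg_right (S.lip.abs_le _) (abs_nonneg _)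

theorem integrable_comp_mul (S : Setup n f μ c C p C' q κ) (z v : HTwo n) :
    Integrable (fun x => f (fnL z x) * fnL v x) := by
  obtain ⟨K, -, hK⟩ := exists_superposition_bound S.lip.one_le S.subp
  refine ((hK z 0 z v).1.const_mul C).mono'
    ((S.lip.continuous.comp_aestronglyMeasurable (aestronglyMeasurable_fnL z)).mul
      (aestronglyMeasurable_fnL v)) ?_
  have h0 : ∀ᵐ x : Eucl n, fnL (0 : HTwo n) x = 0 := by
    rw [map_zero]; exact Lp.coeFn_zero _ _ _
  filter_upwards [h0] with x hx
  have := S.lip.lip (fnL z x) 0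
  rw [S.lip.zero, sub_zero, sub_zero, abs_zero] at this
  rw [hx, abs_zero, norm_mul, Real.norm_eq_abs, Real.norm_eq_abs]
  calc _ ≤ C * (|fnL z x| + 0) ^ (p - 1) * |fnL z x| * |fnL v x| := by gcongr
    _ = _ := by ring

/-- The nonlinear part of the derivative of the action, as a continuous functional. -/
theorem exists_nonlinear_clm (S : Setup n f μ c C p C' q κ) (z : HTwo n) :
    ∃ T : HTwo n →L[ℝ] ℝ, ∀ v, T v = ∫ x, f (fnL z x) * fnL v x := by
  obtain ⟨K, hK0, hK⟩ := exists_superposition_bound S.lip.one_le S.subp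
  have hC := S.lip.pos
  let T : HTwo n →ₗ[ℝ] ℝ :=
    { toFun := fun v => ∫ x, f (fnL z x) * fnL v x
      map_add' := fun v w => by
        rw [← integral_add (S.integrable_comp_mul z v) (S.integrable_comp_mul z w)]
        refine integral_congr_ae ?_
        filter_upwards [fnL_add_ae v w] with x hx
        rw [hx, mul_add]
      map_smul' := fun t v => by
        rw [RingHom.id_apply, smul_eq_mul, ← integral_const_mul]
        refine integral_congr_ae ?_
        filter_upwards [fnL_smul_ae t v] with x hx
        rw [hx, mul_left_comm] }
  refine ⟨T.mkContinuous (C * (K * ((‖z‖ + 1) ^ (p - 1) * (‖z‖ + 1)))) fun v => ?_, fun v => rfl⟩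
  rcases eq_or_ne v 0 with rfl | hv
  · simp
  have hv' : 0 < ‖v‖ := norm_pos_iff.2 hv
  have h0 : ∀ᵐ x : Eucl n, fnL (0 : HTwo n) x = 0 := by
    rw [map_zero]; exact Lp.coeFn_zero _ _ _
  have h1 : ‖T v‖ ≤ ∫ x, C * ((|fnL z x| + |fnL (0 : HTwo n) x|) ^ (p - 1) * |fnL z x| * |fnL v x|)
      := by
    refine norm_integral_le_of_norm_le ((hK z 0 z v).1.const_mul C) ?_
    filter_upwards [h0] with x hx
    have := S.lip.lip (fnL z x) 0
    rw [S.lip.zero, sub_zero, sub_zero, abs_zero] at this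
    rw [hx, abs_zero, norm_mul, Real.norm_eq_abs, Real.norm_eq_abs]
    calc _ ≤ C * (|fnL z x| + 0) ^ (p - 1) * |fnL z x| * |fnL v x| := by gcongr
      _ = _ := by ring
  rw [integral_const_mul] at h1
  have h2 := (hK z 0 z v).2 (‖z‖ + 1) (‖z‖ + 1) ‖v‖ (by positivity) (by positivity) hv'
    (by linarith) (by rw [norm_zero]; positivity) (by linarith) le_rfl
  calc ‖T v‖ ≤ _ := h1
    _ ≤ C * (K * ((‖z‖ + 1) ^ (p - 1) * (‖z‖ + 1) * ‖v‖)) := by gcongr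
    _ = _ := by ring

theorem action_eq (z : HTwo n) :
    action f c z = 1 / 2 * quadForm c z + ∫ x, primitive f (fnL z x) := rfl

theorem nehariFun_eq (z : HTwo n) :
    nehariFun f c z = quadForm c z + ∫ x, fnL z x * f (fnL z x) := rfl

/-- Second order Taylor estimate for the action, uniform on bounded sets. -/
theorem exists_taylor_bound (S : Setup n f μ c C p C' q κ) {B : ℝ} (hB : 0 < B) :
    ∃ K, 0 ≤ K ∧ ∀ z h : HTwo n, ‖z‖ ≤ B → ‖h‖ ≤ B →
      |action f c (z + h) - action f c z - (bilin c z h + ∫ x, f (fnL z x) * fnL h x)|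
        ≤ K * ‖h‖ ^ 2 := by
  obtain ⟨K, hK0, hK⟩ := exists_superposition_bound S.lip.one_le S.subp
  have hC := S.lip.pos
  refine ⟨1 + C * 2 ^ (p - 1) * (K * B ^ (p - 1)), by positivity, fun z h hz hh => ?_⟩
  rcases eq_or_ne h 0 with rfl | hne
  · have : ∫ x, f (fnL z x) * fnL (0 : HTwo n) x = 0 := by
      obtain ⟨T, hT⟩ := S.exists_nonlinear_clm z
      rw [← hT, map_zero]
    rw [add_zero, sub_self, map_zero, this]; simp
  have hh' : 0 < ‖h‖ := norm_pos_iff.2 hne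
  have h1 : |∫ x, (primitive f (fnL (z + h) x) - primitive f (fnL z x) - f (fnL z x) * fnL h x)|
      ≤ ∫ x, C * 2 ^ (p - 1) * ((|fnL z x| + |fnL h x|) ^ (p - 1) * |fnL h x| * |fnL h x|) := by
    rw [← Real.norm_eq_abs]
    refine norm_integral_le_of_norm_le ((hK z h h h).1.const_mul _) ?_
    filter_upwards [fnL_add_ae z h] with x hx
    rw [hx]
    exact S.lip.primitive_remainder_le _ _
  rw [integral_const_mul] at h1
  have h2 := (hK z h h h).2 B ‖h‖ ‖h‖ hB hh' hh' hz hh le_rfl le_rfl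
  have e1 : ∫ x, (primitive f (fnL (z + h) x) - primitive f (fnL z x) - f (fnL z x) * fnL h x)
      = (∫ x, primitive f (fnL (z + h) x)) - (∫ x, primitive f (fnL z x))
        - ∫ x, f (fnL z x) * fnL h x := by
    rw [integral_sub, integral_sub (S.integrable_primitive _) (S.integrable_primitive _)]
    · exact (S.integrable_primitive _).sub (S.integrable_primitive _)
    · exact S.integrable_comp_mul _ _
  have e2 : action f c (z + h) - action f c z - (bilin c z h + ∫ x, f (fnL z x) * fnL h x)
      = 1 / 2 * quadForm c h
        + ∫ x, (primitive f (fnL (z + h) x) - primitive f (fnL z x) - f (fnL z x) * fnL h x) := by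
    rw [e1, action_eq, action_eq, quadForm_add]; ring
  rw [e2]
  refine (abs_add_le _ _).trans ?_
  have h3 : |1 / 2 * quadForm c h| ≤ ‖h‖ ^ 2 := by
    rw [abs_of_nonneg (mul_nonneg (by norm_num) (S.quadForm_nonneg h))]
    linarith [quadForm_le c h]
  have h4 : C * 2 ^ (p - 1) * ∫ x, (|fnL z x| + |fnL h x|) ^ (p - 1) * |fnL h x| * |fnL h x|
      ≤ C * 2 ^ (p - 1) * (K * (B ^ (p - 1) * ‖h‖ * ‖h‖)) := by gcongr
  calc _ ≤ ‖h‖ ^ 2 + C * 2 ^ (p - 1) * (K * (B ^ (p - 1) * ‖h‖ * ‖h‖)) :=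
        add_le_add h3 (h1.trans h4)
    _ = _ := by ring

theorem exists_hasFDerivAt (S : Setup n f μ c C p C' q κ) (z : HTwo n) :
    ∃ D : HTwo n →L[ℝ] ℝ, HasFDerivAt (action f c) D z ∧
      ∀ v, D v = bilin c z v + ∫ x, f (fnL z x) * fnL v x := by
  obtain ⟨T, hT⟩ := S.exists_nonlinear_clm z
  refine ⟨bilin c z + T, ?_, fun v => by rw [_root_.add_apply, hT]⟩
  obtain ⟨K, hK0, hK⟩ := S.exists_taylor_bound (B := ‖z‖ + 1) (by positivity)
  rw [hasFDerivAt_iff_isLittleO_nhds_zero]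
  have hO : (fun h => action f c (z + h) - action f c z - (bilin c z + T) h)
      =O[𝓝 0] fun h : HTwo n => ‖h‖ ^ 2 := by
    refine Asymptotics.IsBigO.of_bound K ?_
    filter_upwards [Metric.ball_mem_nhds (0 : HTwo n) one_pos] with h hh
    rw [mem_ball_zero_iff] at hh
    rw [norm_pow, norm_norm, _root_.add_apply, hT]
    exact hK z h (by linarith) (by linarith [norm_nonneg z])
  refine hO.trans_isLittleO ?_
  simp_rw [sq]
  refine Asymptotics.IsLittleO.of_bound fun ε hε => ?_
  filter_upwards [Metric.ball_mem_nhds (0 : HTwo n) hε] with h hh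
  rw [mem_ball_zero_iff] at hh
  rw [norm_mul, norm_norm]
  gcongr

theorem mem_critSet_iff (S : Setup n f μ c C p C' q κ) (z : HTwo n) :
    z ∈ critSet f c ↔ z ≠ 0 ∧ ∀ v, bilin c z v + ∫ x, f (fnL z x) * fnL v x = 0 := by
  obtain ⟨D, hD, hDv⟩ := S.exists_hasFDerivAt z
  refine and_congr_right fun _ => ⟨fun h v => ?_, fun h => ?_⟩
  · rw [← hDv, hD.unique h]; rfl
  · have : D = 0 := by ext v; rw [hDv, h]; rfl
    rwa [← this]

theorem critSet_subset_nehari (S : Setup n f μ c C p C' q κ) : critSet f c ⊆ nehari f c := by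
  intro z hz
  obtain ⟨h0, h1⟩ := (S.mem_critSet_iff z).1 hz
  refine ⟨h0, ?_⟩
  rw [nehariFun_eq, ← bilin_self, ← h1 z]
  simp only [mul_comm]

end Setup

/-! ### Geometry of the Nehari manifold -/

theorem continuous_of_lipschitz_on_balls {E : Type*} [NormedAddCommGroup E] {F : E → ℝ}
    (h : ∀ B : ℝ, 0 < B → ∃ K : ℝ, ∀ z z' : E, ‖z‖ ≤ B → ‖z'‖ ≤ B → |F z - F z'| ≤ K * ‖z - z'‖) :
    Continuous F := by
  refine continuous_iff_continuousAt.2 fun z => ?_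
  obtain ⟨K, hK⟩ := h (‖z‖ + 1) (by positivity)
  rw [ContinuousAt, tendsto_iff_norm_sub_tendsto_zero]
  refine squeeze_zero' (Eventually.of_forall fun _ => norm_nonneg _)
    (g := fun y => K * ‖y - z‖) ?_ ?_
  · filter_upwards [Metric.ball_mem_nhds z one_pos] with y hy
    rw [mem_ball_iff_norm] at hy
    refine hK y z ?_ (by linarith)
    have := norm_le_norm_add_norm_sub' y z
    linarith
  · have : Tendsto (fun y => K * ‖y - z‖) (𝓝 z) (𝓝 (K * ‖z - z‖)) := by
      refine Continuous.tendsto ?_ z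
      fun_prop
    simpa using this

theorem continuous_quadForm {n : ℕ} (c : Eucl n) : Continuous (quadForm (n := n) c) := by
  have : quadForm (n := n) c = fun z => ‖laplL z‖ ^ 2 - ‖dirL c z‖ ^ 2 + ‖fnL z‖ ^ 2 :=
    funext (quadForm_eq c)
  rw [this]
  fun_prop

theorem fnL_zero_ae {n : ℕ} : ∀ᵐ x : Eucl n, fnL (0 : HTwo n) x = 0 := by
  rw [map_zero]; exact Lp.coeFn_zero _ _ _

namespace Setup

variable {n : ℕ} {f : ℝ → ℝ} {μ : ℝ} {c : Eucl n} {C p C' q κ : ℝ}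

theorem exists_mul_self_lipschitz (S : Setup n f μ c C p C' q κ) {B : ℝ} (hB : 0 < B) :
    ∃ K, 0 ≤ K ∧ ∀ z z' : HTwo n, ‖z‖ ≤ B → ‖z'‖ ≤ B →
      |(∫ x, fnL z x * f (fnL z x)) - ∫ x, fnL z' x * f (fnL z' x)| ≤ K * ‖z - z'‖ := by
  obtain ⟨K, hK0, hK⟩ := exists_superposition_bound S.lip.one_le S.subp
  have hC := S.lip.pos
  refine ⟨2 * C * (2 * (K * (B ^ (p - 1) * B))), by positivity, fun z z' hz hz' => ?_⟩
  rcases eq_or_ne z z' with rfl | hne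
  · simp
  have hd : 0 < ‖z - z'‖ := norm_pos_iff.2 (sub_ne_zero.2 hne)
  rw [← integral_sub (S.integrable_mul_self z) (S.integrable_mul_self z'), ← Real.norm_eq_abs]
  have i1 := hK z z' z (z - z')
  have i2 := hK z z' z' (z - z')
  have hle : ‖∫ x, (fnL z x * f (fnL z x) - fnL z' x * f (fnL z' x))‖ ≤ ∫ x, 2 * C *
      ((|fnL z x| + |fnL z' x|) ^ (p - 1) * |fnL z x| * |fnL (z - z') x|
        + (|fnL z x| + |fnL z' x|) ^ (p - 1) * |fnL z' x| * |fnL (z - z') x|) := by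
    refine norm_integral_le_of_norm_le ((i1.1.add i2.1).const_mul _) ?_
    filter_upwards [fnL_sub_ae z z'] with x hx
    rw [hx]
    refine (S.lip.mul_sub_le _ _).trans (le_of_eq ?_)
    have : (|fnL z x| + |fnL z' x|) ^ p
        = (|fnL z x| + |fnL z' x|) ^ (p - 1) * (|fnL z x| + |fnL z' x|) := by
      rw [← Real.rpow_add_one' (by positivity) (by linarith [S.lip.one_le]), sub_add_cancel]
    rw [this]
    ring
  rw [integral_const_mul, integral_add i1.1 i2.1] at hle
  have b1 := i1.2 B B ‖z - z'‖ hB hB hd hz hz' hz le_rfl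
  have b2 := i2.2 B B ‖z - z'‖ hB hB hd hz hz' hz' le_rfl
  refine hle.trans ?_
  calc _ ≤ 2 * C * (K * (B ^ (p - 1) * B * ‖z - z'‖) + K * (B ^ (p - 1) * B * ‖z - z'‖)) :=
      by gcongr
    _ = _ := by ring

theorem continuous_nehariFun (S : Setup n f μ c C p C' q κ) :
    Continuous (nehariFun (n := n) f c) := by
  refine (continuous_quadForm c).add (continuous_of_lipschitz_on_balls fun B hB => ?_)
  obtain ⟨K, -, hK⟩ := S.exists_mul_self_lipschitz hB
  exact ⟨K, hK⟩

theorem continuous_comp_mul (S : Setup n f μ c C p C' q κ) (v : HTwo n) :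
    Continuous fun z : HTwo n => ∫ x, f (fnL z x) * fnL v x := by
  obtain ⟨K, hK0, hK⟩ := exists_superposition_bound S.lip.one_le S.subp
  have hC := S.lip.pos
  refine continuous_of_lipschitz_on_balls fun B hB =>
    ⟨C * (K * (B ^ (p - 1) * (‖v‖ + 1))), fun z z' hz hz' => ?_⟩
  rcases eq_or_ne z z' with rfl | hne
  · simp
  have hd : 0 < ‖z - z'‖ := norm_pos_iff.2 (sub_ne_zero.2 hne)
  rw [← integral_sub (S.integrable_comp_mul z v) (S.integrable_comp_mul z' v), ← Real.norm_eq_abs]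
  have hle : ‖∫ x, (f (fnL z x) * fnL v x - f (fnL z' x) * fnL v x)‖ ≤ ∫ x, C *
      ((|fnL z x| + |fnL z' x|) ^ (p - 1) * |fnL (z - z') x| * |fnL v x|) := by
    refine norm_integral_le_of_norm_le ((hK z z' (z - z') v).1.const_mul _) ?_
    filter_upwards [fnL_sub_ae z z'] with x hx
    rw [hx, ← sub_mul, norm_mul, Real.norm_eq_abs, Real.norm_eq_abs]
    calc _ ≤ C * (|fnL z x| + |fnL z' x|) ^ (p - 1) * |fnL z x - fnL z' x| * |fnL v x| :=
          mul_le_mul_of_nonneg_right (S.lip.lip _ _) (abs_nonneg _)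
      _ = _ := by ring
  rw [integral_const_mul] at hle
  have b1 := (hK z z' (z - z') v).2 B ‖z - z'‖ (‖v‖ + 1) hB hd (by positivity) hz hz' le_rfl
    (by linarith)
  refine hle.trans ?_
  calc _ ≤ C * (K * (B ^ (p - 1) * ‖z - z'‖ * (‖v‖ + 1))) := by gcongr
    _ = _ := by ring

theorem nehariFun_zero : nehariFun f c (0 : HTwo n) = 0 := by
  have h1 : quadForm c (0 : HTwo n) = 0 := by rw [← bilin_self, map_zero]
  have h2 : ∫ x, fnL (0 : HTwo n) x * f (fnL (0 : HTwo n) x) = 0 := by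
    refine integral_eq_zero_of_ae ?_
    filter_upwards [fnL_zero_ae] with x hx
    rw [hx, zero_mul]; rfl
  rw [nehariFun_eq, h1, h2, add_zero]

/-- The nonlinear term is of order higher than two at the origin. -/
theorem exists_neg_integral_le (S : Setup n f μ c C p C' q κ) :
    ∃ A, 0 < A ∧ (∀ z : HTwo n, ∫ x, |fnL z x| ^ (q + 1) ≤ A * ‖z‖ ^ (q + 1)) ∧
      ∀ z : HTwo n, -(∫ x, fnL z x * f (fnL z x)) ≤ C' * ∫ x, |fnL z x| ^ (q + 1) := by
  obtain ⟨A, hA, h⟩ := exists_integral_rpow_le S.subq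
  refine ⟨A + 1, by positivity, fun z => (h z).trans (by gcongr; linarith), fun z => ?_⟩
  rw [← integral_neg, ← integral_const_mul]
  refine integral_mono (S.integrable_mul_self z).neg ((integrable_rpow_fnL S.subq z).const_mul _)
      fun x => ?_
  have h1 := S.growth (fnL z x)
  have hq := S.hq
  rw [Real.rpow_add_one' (abs_nonneg _) (by linarith)]
  calc -(fnL z x * f (fnL z x)) ≤ |fnL z x * f (fnL z x)| := neg_le_abs _
    _ = |f (fnL z x)| * |fnL z x| := by rw [abs_mul, mul_comm]
    _ ≤ C' * |fnL z x| ^ q * |fnL z x| := by gcongr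
    _ = _ := by ring

/-- Near the origin the quadratic part of `P_c` dominates. -/
theorem exists_pos_of_small (S : Setup n f μ c C p C' q κ) :
    ∃ δ, 0 < δ ∧ ∀ z : HTwo n, z ≠ 0 → ‖z‖ < δ → 0 < nehariFun f c z := by
  obtain ⟨A, hA, h1, h2⟩ := S.exists_neg_integral_le
  have hq : 0 < q - 1 := by linarith [S.hq]
  have hC' := S.posC'
  have hκ := S.κpos
  have ht : Tendsto (fun δ : ℝ => C' * A * δ ^ (q - 1)) (𝓝[>] 0) (𝓝 (C' * A * 0 ^ (q - 1))) :=
    ((Real.continuousAt_rpow_const 0 _ (Or.inr hq.le)).tendsto.mono_left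
      nhdsWithin_le_nhds).const_mul _
  rw [Real.zero_rpow hq.ne', mul_zero] at ht
  obtain ⟨δ, hδ, hδ0⟩ := ((ht.eventually_lt_const hκ).and self_mem_nhdsWithin).exists
  refine ⟨δ, hδ0, fun z hz hzδ => ?_⟩
  have hz0 : 0 < ‖z‖ := norm_pos_iff.2 hz
  have e : ‖z‖ ^ (q + 1) = ‖z‖ ^ (q - 1) * ‖z‖ ^ 2 := by
    rw [← Real.rpow_natCast, ← Real.rpow_add hz0]; congr 1; push_cast; ring
  have h3 : -(∫ x, fnL z x * f (fnL z x)) ≤ C' * A * ‖z‖ ^ (q - 1) * ‖z‖ ^ 2 := by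
    refine (h2 z).trans ?_
    calc _ ≤ C' * (A * ‖z‖ ^ (q + 1)) := mul_le_mul_of_nonneg_left (h1 z) hC'.le
      _ = _ := by rw [e]; ring
  have h4 : C' * A * ‖z‖ ^ (q - 1) * ‖z‖ ^ 2 < κ * ‖z‖ ^ 2 := by
    refine mul_lt_mul_of_pos_right (lt_of_le_of_lt ?_ hδ) (by positivity)
    gcongr
  have h5 := S.coercive z
  rw [nehariFun_eq]
  linarith

/-- Every nonzero point with `P_c ≤ 0` can be scaled down to the Nehari manifold. -/
theorem exists_smul_mem_nehari (S : Setup n f μ c C p C' q κ) {z : HTwo n} (hz : z ≠ 0)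
    (hP : nehariFun f c z ≤ 0) : ∃ t : ℝ, 0 < t ∧ t ≤ 1 ∧ t • z ∈ nehari f c := by
  obtain ⟨δ, hδ, h⟩ := S.exists_pos_of_small
  have hz0 : 0 < ‖z‖ := norm_pos_iff.2 hz
  let s : ℝ := min 1 (δ / 2 / ‖z‖)
  have hs0 : 0 < s := lt_min one_pos (by positivity)
  have hs1 : s ≤ 1 := min_le_left _ _
  have hsz : ‖s • z‖ < δ := by
    rw [norm_smul, Real.norm_of_nonneg hs0.le]
    have : s * ‖z‖ ≤ δ / 2 / ‖z‖ * ‖z‖ := by gcongr; exact min_le_right _ _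
    rw [div_mul_cancel₀ _ hz0.ne'] at this
    linarith
  have hpos := h (s • z) (smul_ne_zero hs0.ne' hz) hsz
  have hcont : ContinuousOn (fun t : ℝ => nehariFun f c (t • z)) (Set.Icc s 1) :=
    (S.continuous_nehariFun.comp (by fun_prop)).continuousOn
  obtain ⟨t, ht, hte⟩ := intermediate_value_Icc' hs1 hcont
    (show (0 : ℝ) ∈ Set.Icc _ _ from ⟨by rw [one_smul]; exact hP, hpos.le⟩)
  have ht0 : 0 < t := hs0.trans_le ht.1
  exact ⟨t, ht0, ht.2, smul_ne_zero ht0.ne' hz, hte⟩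

theorem integral_smul_eq (t : ℝ) (z : HTwo n) (g : ℝ → ℝ) :
    ∫ x, g (fnL (t • z) x) = ∫ x, g (t * fnL z x) := by
  refine integral_congr_ae ?_
  filter_upwards [fnL_smul_ae t z] with x hx
  rw [hx]

theorem integrable_smul {t : ℝ} {z : HTwo n} {g : ℝ → ℝ}
    (h : Integrable fun x => g (fnL (t • z) x)) : Integrable fun x => g (t * fnL z x) := by
  refine h.congr ?_
  filter_upwards [fnL_smul_ae t z] with x hx
  rw [hx]

theorem nehariFun_smul (t : ℝ) (z : HTwo n) :
    nehariFun f c (t • z) = t ^ 2 * quadForm c z + ∫ x, t * fnL z x * f (t * fnL z x) := by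
  rw [nehariFun_eq, quadForm_smul, integral_smul_eq t z fun u => u * f u]

theorem quadForm_pos (S : Setup n f μ c C p C' q κ) {z : HTwo n} (hz : z ≠ 0) : 0 < quadForm c z :=
  (mul_pos S.κpos (pow_pos (norm_pos_iff.2 hz) 2)).trans_le (S.coercive z)

/-- On the Nehari manifold `z f(z)` does not vanish almost everywhere, so pointwise inequalities
that are strict where `u f(u) ≠ 0` give strict inequalities of integrals. -/
theorem integral_lt_of_nehari (S : Setup n f μ c C p C' q κ) {z : HTwo n} (hz : z ∈ nehari f c)
    {g h : ℝ → ℝ} (hg : Integrable fun x => g (fnL z x)) (hh : Integrable fun x => h (fnL z x))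
    (hgh : ∀ u, g u ≤ h u ∧ (u * f u ≠ 0 → g u < h u)) :
    ∫ x, g (fnL z x) < ∫ x, h (fnL z x) := by
  refine lt_of_le_of_ne (integral_mono hg hh fun x => (hgh _).1) fun heq => ?_
  have h0 : ∫ x, (h (fnL z x) - g (fnL z x)) = 0 := by rw [integral_sub hh hg, heq, sub_self]
  rw [integral_eq_zero_iff_of_nonneg (fun x => sub_nonneg.2 (hgh _).1) (hh.sub hg)] at h0
  have h1 : ∫ x, fnL z x * f (fnL z x) = 0 := by
    refine integral_eq_zero_of_ae ?_
    filter_upwards [h0] with x hx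
    by_contra hne
    have := (hgh _).2 hne
    simp only [Pi.zero_apply] at hx
    linarith
  have h2 := hz.2
  rw [nehariFun_eq, h1, add_zero] at h2
  exact (S.quadForm_pos hz.1).ne' h2

theorem nehariFun_smul_pos (S : Setup n f μ c C p C' q κ) {z : HTwo n} (hz : z ∈ nehari f c)
    {t : ℝ} (ht0 : 0 < t) (ht1 : t < 1) : 0 < nehariFun f c (t • z) := by
  have h1 := S.integral_lt_of_nehari hz (g := fun u => t ^ 2 * (u * f u))
    (h := fun u => t * u * f (t * u)) ((S.integrable_mul_self z).const_mul _)
    (integrable_smul (g := fun u => u * f u) (S.integrable_mul_self (t • z)))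
    (fun u => S.scale u t ht0 ht1)
  have h2 := hz.2
  rw [nehariFun_eq] at h2
  rw [integral_const_mul] at h1
  rw [nehariFun_smul]
  nlinarith [sq_nonneg t]

theorem nehariFun_smul_neg (S : Setup n f μ c C p C' q κ) {z : HTwo n} (hz : z ∈ nehari f c)
    {t : ℝ} (ht1 : 1 < t) : nehariFun f c (t • z) < 0 := by
  have ht0 : 0 < t := by linarith
  have hsc : ∀ u, t * u * f (t * u) ≤ t ^ 2 * (u * f u) ∧
      (u * f u ≠ 0 → t * u * f (t * u) < t ^ 2 * (u * f u)) := by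
    intro u
    have h1 := S.scale (t * u) t⁻¹ (by positivity) (inv_lt_one_of_one_lt₀ ht1)
    rw [inv_mul_cancel_left₀ ht0.ne'] at h1
    have e : t ^ 2 * (t⁻¹ ^ 2 * (t * u * f (t * u))) = t * u * f (t * u) := by field_simp
    have h2 : t * u * f (t * u) ≤ t ^ 2 * (u * f u) := by
      rw [← e]; exact mul_le_mul_of_nonneg_left h1.1 (by positivity)
    refine ⟨h2, fun hne => ?_⟩
    have h3 : u * f u < 0 := lt_of_le_of_ne (S.sign u) hne
    have h4 : t * u * f (t * u) ≠ 0 := by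
      have : t ^ 2 * (u * f u) < 0 := mul_neg_of_pos_of_neg (by positivity) h3
      linarith
    rw [← e]; exact mul_lt_mul_of_pos_left (h1.2 h4) (by positivity)
  have h1 := S.integral_lt_of_nehari hz (h := fun u => t ^ 2 * (u * f u))
    (g := fun u => t * u * f (t * u))
    (integrable_smul (g := fun u => u * f u) (S.integrable_mul_self (t • z)))
    ((S.integrable_mul_self z).const_mul _) hsc
  have h2 := hz.2
  rw [nehariFun_eq] at h2
  rw [integral_const_mul] at h1
  rw [nehariFun_smul]
  nlinarith [sq_nonneg t]

theorem hasDerivAt_action_smul (S : Setup n f μ c C p C' q κ) (z : HTwo n) (t : ℝ) :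
    ∃ d, HasDerivAt (fun s : ℝ => action f c (s • z)) d t ∧ t * d = nehariFun f c (t • z) := by
  obtain ⟨D, hD, hDv⟩ := S.exists_hasFDerivAt (t • z)
  refine ⟨D z, ?_, ?_⟩
  · have h1 : HasDerivAt (fun s : ℝ => s • z) z t := by
      simpa using (hasDerivAt_id t).smul_const z
    exact hD.comp_hasDerivAt t h1
  · have h2 : D (t • z) = t * D z := by rw [map_smul, smul_eq_mul]
    rw [← h2, hDv, nehariFun_eq, bilin_self]
    simp only [mul_comm]

/-- The action attains its maximum along a ray at the point on the Nehari manifold. -/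
theorem action_smul_le (S : Setup n f μ c C p C' q κ) {z : HTwo n} (hz : z ∈ nehari f c)
    {t : ℝ} (ht : 0 < t) : action f c (t • z) ≤ action f c z := by
  have hd : ∀ s : ℝ, DifferentiableAt ℝ (fun s : ℝ => action f c (s • z)) s := fun s =>
    let ⟨_, h, _⟩ := S.hasDerivAt_action_smul z s
    h.differentiableAt
  have hcont : Continuous (fun s : ℝ => action f c (s • z)) :=
    continuous_iff_continuousAt.2 fun s => (hd s).continuousAt
  rcases le_total t 1 with h1 | h1
  · have hm : MonotoneOn (fun s : ℝ => action f c (s • z)) (Set.Icc t 1) := by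
      refine monotoneOn_of_deriv_nonneg (convex_Icc t 1) hcont.continuousOn
        (fun s _ => (hd s).differentiableWithinAt) fun s hs => ?_
      rw [interior_Icc] at hs
      obtain ⟨d, hd1, hd2⟩ := S.hasDerivAt_action_smul z s
      have hs0 : 0 < s := ht.trans hs.1
      rw [hd1.deriv]
      have := S.nehariFun_smul_pos hz hs0 hs.2
      rw [← hd2] at this
      exact (pos_of_mul_pos_right this hs0.le).le
    simpa using hm (Set.left_mem_Icc.2 h1) (Set.right_mem_Icc.2 h1) h1
  · have hm : AntitoneOn (fun s : ℝ => action f c (s • z)) (Set.Icc 1 t) := by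
      refine antitoneOn_of_deriv_nonpos (convex_Icc 1 t) hcont.continuousOn
        (fun s _ => (hd s).differentiableWithinAt) fun s hs => ?_
      rw [interior_Icc] at hs
      obtain ⟨d, hd1, hd2⟩ := S.hasDerivAt_action_smul z s
      have hs0 : 0 < s := one_pos.trans hs.1
      rw [hd1.deriv]
      have := S.nehariFun_smul_neg hz hs.1
      rw [← hd2] at this
      by_contra! hcon
      exact absurd this (not_lt.2 (mul_nonneg hs0.le hcon.le))
    simpa using hm (Set.left_mem_Icc.2 h1) (Set.right_mem_Icc.2 h1) h1

/-- Minimizers over the Nehari manifold are critical points: otherwise, following a descent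
direction and rescaling would lower the action. -/
theorem mem_critSet_of_minimizer (S : Setup n f μ c C p C' q κ) {w : HTwo n}
    (hw : IsNehariMinimizer f c w) : w ∈ critSet f c := by
  refine (S.mem_critSet_iff w).2 ⟨hw.1.1, ?_⟩
  by_contra! hcon
  -- a direction of descent
  obtain ⟨v, hv⟩ : ∃ v, bilin c w v + ∫ x, f (fnL w x) * fnL v x < 0 := by
    obtain ⟨T, hT⟩ := S.exists_nonlinear_clm w
    obtain ⟨v, hv⟩ := hcon
    rcases lt_or_gt_of_ne hv with h | h
    · exact ⟨v, h⟩
    · refine ⟨-v, ?_⟩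
      rw [← hT] at h ⊢
      rw [map_neg, map_neg]; linarith
  set a := -(bilin c w v + ∫ x, f (fnL w x) * fnL v x) with ha
  have ha0 : 0 < a := by linarith
  have hDcont : Continuous fun t : ℝ => bilin c (t • w) v + ∫ x, f (fnL (t • w) x) * fnL v x := by
    refine Continuous.add ?_ ((S.continuous_comp_mul v).comp (by fun_prop))
    simp only [bilin_smul_left]
    fun_prop
  obtain ⟨ε, hε0, hε1, hε⟩ : ∃ ε : ℝ, 0 < ε ∧ ε < 1 ∧ ∀ t ∈ Set.Icc (1 - ε) (1 + ε),
      bilin c (t • w) v + ∫ x, f (fnL (t • w) x) * fnL v x < -(a / 2) := by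
    have h1 : ∀ᶠ t in 𝓝 (1 : ℝ), bilin c (t • w) v + ∫ x, f (fnL (t • w) x) * fnL v x < -(a / 2) :=
        by
      refine (hDcont.tendsto 1).eventually_lt_const ?_
      rw [one_smul]; linarith
    obtain ⟨ε, hε, h⟩ := Metric.eventually_nhds_iff.1 h1
    refine ⟨min (ε / 2) (1 / 2), by positivity, (min_le_right _ _).trans_lt (by norm_num),
      fun t ht => h ?_⟩
    have := min_le_left (ε / 2) (1 / 2)
    rw [Real.dist_eq, abs_lt]
    constructor <;> linarith [ht.1, ht.2]
  obtain ⟨K, hK0, hK⟩ := S.exists_taylor_bound (B := 2 * ‖w‖ + 2 * ‖v‖ + 1) (by positivity)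
  have hP : ∀ t : ℝ, Continuous fun s : ℝ => nehariFun f c (t • (w + s • v)) := fun t =>
    S.continuous_nehariFun.comp (by fun_prop)
  -- for small `s` the ray through `w + s • v` still meets the manifold at some `t` close to `1`
  have e1 : ∀ᶠ s in 𝓝[>] (0 : ℝ), 0 < nehariFun f c ((1 - ε) • (w + s • v)) := by
    refine nhdsWithin_le_nhds (((hP (1 - ε)).tendsto 0).eventually_const_lt ?_)
    rw [zero_smul, add_zero]
    exact S.nehariFun_smul_pos hw.1 (by linarith) (by linarith)
  have e2 : ∀ᶠ s in 𝓝[>] (0 : ℝ), nehariFun f c ((1 + ε) • (w + s • v)) < 0 := by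
    refine nhdsWithin_le_nhds (((hP (1 + ε)).tendsto 0).eventually_lt_const ?_)
    rw [zero_smul, add_zero]
    exact S.nehariFun_smul_neg hw.1 (by linarith)
  have e3 : ∀ᶠ s in 𝓝[>] (0 : ℝ), K * (2 * s) * ‖v‖ ^ 2 < a / 2 := by
    have : Continuous fun s : ℝ => K * (2 * s) * ‖v‖ ^ 2 := by fun_prop
    refine nhdsWithin_le_nhds ((this.tendsto 0).eventually_lt_const ?_)
    simpa using ha0
  have e4 : ∀ᶠ s in 𝓝[>] (0 : ℝ), s < 1 := nhdsWithin_le_nhds (eventually_lt_nhds one_pos)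
  obtain ⟨s, hs1, hs2, hs3, hs4, hs0⟩ :=
    (e1.and (e2.and (e3.and (e4.and self_mem_nhdsWithin)))).exists
  have hs0 : 0 < s := hs0
  obtain ⟨t, ht, hte⟩ := intermediate_value_Icc' (show 1 - ε ≤ 1 + ε by linarith)
    (show ContinuousOn (fun t : ℝ => nehariFun f c (t • (w + s • v))) _ from
      (S.continuous_nehariFun.comp (by fun_prop)).continuousOn)
    (show (0 : ℝ) ∈ Set.Icc _ _ from ⟨hs2.le, hs1.le⟩)
  have ht0 : 0 < t := by linarith [ht.1]
  have ht2 : t ≤ 2 := by linarith [ht.2]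
  have hne : w + s • v ≠ 0 := by
    intro h0
    rw [h0, smul_zero, nehariFun_zero] at hs1
    exact lt_irrefl _ hs1
  have hmin := hw.2 _ (show t • (w + s • v) ∈ nehari f c from ⟨smul_ne_zero ht0.ne' hne, hte⟩)
  have hray := S.action_smul_le hw.1 ht0
  -- from `t • w` to `t • (w + s • v)` the action decreases to first order in `s`
  have htay := hK (t • w) ((t * s) • v) (by
      rw [norm_smul, Real.norm_of_nonneg ht0.le]
      nlinarith [norm_nonneg w, norm_nonneg v]) (by
      rw [norm_smul, Real.norm_of_nonneg (by positivity)]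
      have : t * s ≤ 2 := by nlinarith
      nlinarith [norm_nonneg w, norm_nonneg v])
  have e5 : t • w + (t * s) • v = t • (w + s • v) := by rw [smul_add, smul_smul]
  obtain ⟨T, hT⟩ := S.exists_nonlinear_clm (t • w)
  have hder := hε t ht
  rw [e5, ← hT, map_smul, map_smul, smul_eq_mul, smul_eq_mul, norm_smul,
    Real.norm_of_nonneg (by positivity : 0 ≤ t * s), ← mul_add] at htay
  rw [← hT] at hder
  have h6 := (abs_le.1 htay).2
  have hts : 0 < t * s := by positivity
  have h7 : K * (t * s * ‖v‖) ^ 2 ≤ (t * s) * (K * (2 * s) * ‖v‖ ^ 2) := by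
    have : K * (t * s * ‖v‖) ^ 2 = (t * s) * (K * (t * s) * ‖v‖ ^ 2) := by ring
    rw [this]
    gcongr
  nlinarith

end Setup

/-! ### Coercivity of the action on the Nehari manifold -/

/-- The functional `I_c - P_c / μ`. It agrees with the action on the Nehari manifold, is
non-negative, and does not increase along segments towards the origin. -/
def reducedAction {n : ℕ} (f : ℝ → ℝ) (μ : ℝ) (c : Eucl n) (z : HTwo n) : ℝ :=
  (1 / 2 - 1 / μ) * quadForm c z + ∫ x, gFun f μ (fnL z x)

namespace Setup

variable {n : ℕ} {f : ℝ → ℝ} {μ : ℝ} {c : Eucl n} {C p C' q κ : ℝ}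

theorem integrable_gFun (S : Setup n f μ c C p C' q κ) (z : HTwo n) :
    Integrable (fun x => gFun f μ (fnL z x)) :=
  (S.integrable_primitive z).sub ((S.integrable_mul_self z).const_mul _)

theorem reducedAction_eq (S : Setup n f μ c C p C' q κ) (z : HTwo n) :
    reducedAction f μ c z = action f c z - 1 / μ * nehariFun f c z := by
  have : ∫ x, gFun f μ (fnL z x) = (∫ x, primitive f (fnL z x))
      - 1 / μ * ∫ x, fnL z x * f (fnL z x) := by
    rw [← integral_const_mul, ← integral_sub (S.integrable_primitive z)
      ((S.integrable_mul_self z).const_mul _)]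
    rfl
  rw [reducedAction, this, action_eq, nehariFun_eq]
  ring

theorem reducedAction_of_mem (S : Setup n f μ c C p C' q κ) {z : HTwo n} (hz : z ∈ nehari f c) :
    reducedAction f μ c z = action f c z := by
  rw [S.reducedAction_eq, hz.2, mul_zero, sub_zero]

theorem half_sub_nonneg (S : Setup n f μ c C p C' q κ) : 0 ≤ 1 / 2 - 1 / μ := by
  have := one_div_le_one_div_of_le two_pos S.a3.1
  linarith

theorem integral_gFun_nonneg (S : Setup n f μ c C p C' q κ) (z : HTwo n) :
    0 ≤ ∫ x, gFun f μ (fnL z x) := integral_nonneg fun _ => S.a3.2.1 _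

theorem reducedAction_nonneg (S : Setup n f μ c C p C' q κ) (z : HTwo n) :
    0 ≤ reducedAction f μ c z :=
  add_nonneg (mul_nonneg S.half_sub_nonneg (S.quadForm_nonneg z)) (S.integral_gFun_nonneg z)

theorem reducedAction_smul_le (S : Setup n f μ c C p C' q κ) (z : HTwo n) {t : ℝ} (ht0 : 0 ≤ t)
    (ht1 : t ≤ 1) : reducedAction f μ c (t • z) ≤ t * reducedAction f μ c z := by
  have h1 : ∫ x, gFun f μ (fnL (t • z) x) ≤ t * ∫ x, gFun f μ (fnL z x) := by
    rw [← integral_const_mul]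
    refine integral_mono_ae (S.integrable_gFun _) ((S.integrable_gFun z).const_mul _) ?_
    filter_upwards [fnL_smul_ae t z] with x hx
    rw [hx]
    exact gFun_mul_le S.a3 ht0 ht1 _
  have h2 : t ^ 2 * quadForm c z ≤ t * quadForm c z := by
    have := S.quadForm_nonneg z
    gcongr
    nlinarith
  rw [reducedAction, reducedAction, quadForm_smul]
  have := mul_le_mul_of_nonneg_left h2 S.half_sub_nonneg
  linarith

/-- On the Nehari manifold the action controls the norm. For `μ = 2` only `∫ G` is left in the
action; the part of `-∫ z f(z)` that it does not control is absorbed by the quadratic form. -/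
theorem exists_mul_norm_le (S : Setup n f μ c C p C' q κ) :
    ∃ a, 0 < a ∧ ∀ z ∈ nehari f c, a * ‖z‖ ≤ action f c z := by
  obtain ⟨δ, hδ, hpos⟩ := S.exists_pos_of_small
  have hκ := S.κpos
  have hge : ∀ z ∈ nehari f c, δ ≤ ‖z‖ := fun z hz => by
    by_contra! h
    exact (hpos z hz.1 h).ne' hz.2
  rcases S.a3.1.lt_or_eq with hμ | hμ
  · have h1 : 0 < 1 / 2 - 1 / μ := by
      have := one_div_lt_one_div_of_lt two_pos hμ
      linarith
    refine ⟨(1 / 2 - 1 / μ) * κ * δ, by positivity, fun z hz => ?_⟩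
    rw [← S.reducedAction_of_mem hz, reducedAction]
    have h2 := S.integral_gFun_nonneg z
    have h3 := S.coercive z
    have h4 : κ * δ * ‖z‖ ≤ κ * ‖z‖ ^ 2 := by
      have := hge z hz
      rw [pow_two, mul_assoc]; gcongr
    have := mul_le_mul_of_nonneg_left (h4.trans h3) h1.le
    linarith
  · subst hμ
    obtain ⟨A, hA, hA1, -⟩ := S.exists_neg_integral_le
    have hq : 0 < q - 1 := by linarith [S.hq]
    have hC' := S.posC'
    obtain ⟨s, hs0, hs⟩ : ∃ s : ℝ, 0 < s ∧ 2 * C' * A * s ^ (q - 1) ≤ κ / 2 := by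
      have ht : Tendsto (fun s : ℝ => 2 * C' * A * s ^ (q - 1)) (𝓝[>] 0)
          (𝓝 (2 * C' * A * 0 ^ (q - 1))) :=
        ((Real.continuousAt_rpow_const 0 _ (Or.inr hq.le)).tendsto.mono_left
          nhdsWithin_le_nhds).const_mul _
      rw [Real.zero_rpow hq.ne', mul_zero] at ht
      obtain ⟨s, hs, hs0⟩ :=
        ((ht.eventually_le_const (half_pos hκ)).and self_mem_nhdsWithin).exists
      exact ⟨s, hs0, hs⟩
    refine ⟨κ * min δ s / 8, by positivity, fun z hz => ?_⟩
    have hz0 : 0 < ‖z‖ := norm_pos_iff.2 hz.1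
    -- with this parameter the superquadratic term is absorbed by the quadratic form
    set k : ℝ := min 1 (s / ‖z‖) with hk
    have hk0 : 0 < k := lt_min one_pos (by positivity)
    have hk1 : k ≤ 1 := min_le_left _ _
    have hkz : k * ‖z‖ ≤ s := by
      have : k * ‖z‖ ≤ s / ‖z‖ * ‖z‖ := by gcongr; exact min_le_right _ _
      rwa [div_mul_cancel₀ _ hz0.ne'] at this
    have hkm : min δ s ≤ k * ‖z‖ := by
      rcases min_choice 1 (s / ‖z‖) with h | h
      · rw [hk, h, one_mul]; exact (min_le_left _ _).trans (hge z hz)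
      · rw [hk, h, div_mul_cancel₀ _ hz0.ne']; exact min_le_right _ _
    have h1 : -(∫ x, fnL z x * f (fnL z x))
        ≤ 2 * C' * k ^ (q - 1) * (∫ x, |fnL z x| ^ (q + 1)) + 4 / k * ∫ x, gFun f 2 (fnL z x) := by
      rw [← integral_neg, ← integral_const_mul, ← integral_const_mul,
        ← integral_add ((integrable_rpow_fnL S.subq z).const_mul _)
          ((S.integrable_gFun z).const_mul _)]
      exact integral_mono (S.integrable_mul_self z).neg
        (((integrable_rpow_fnL S.subq z).const_mul _).add ((S.integrable_gFun z).const_mul _))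
        fun x => neg_mul_le S.lip S.posC' S.hq S.growth S.a3 _ hk0 hk1
    have h2 : 2 * C' * k ^ (q - 1) * (∫ x, |fnL z x| ^ (q + 1)) ≤ κ / 2 * ‖z‖ ^ 2 := by
      have e : ‖z‖ ^ (q + 1) = ‖z‖ ^ (q - 1) * ‖z‖ ^ 2 := by
        rw [← Real.rpow_natCast, ← Real.rpow_add hz0]; congr 1; push_cast; ring
      calc _ ≤ 2 * C' * k ^ (q - 1) * (A * ‖z‖ ^ (q + 1)) := by gcongr; exact hA1 z
        _ = 2 * C' * A * (k * ‖z‖) ^ (q - 1) * ‖z‖ ^ 2 := by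
          rw [e, Real.mul_rpow hk0.le hz0.le]; ring
        _ ≤ 2 * C' * A * s ^ (q - 1) * ‖z‖ ^ 2 := by gcongr
        _ ≤ _ := by gcongr
    have h3 := S.coercive z
    have h4 := hz.2
    rw [nehariFun_eq] at h4
    rw [← S.reducedAction_of_mem hz, reducedAction]
    have h5 : κ / 2 * ‖z‖ ^ 2 ≤ 4 / k * ∫ x, gFun f 2 (fnL z x) := by linarith
    have h6 : k * (κ / 2 * ‖z‖ ^ 2) ≤ 4 * ∫ x, gFun f 2 (fnL z x) := by
      refine (mul_le_mul_of_nonneg_left h5 hk0.le).trans (le_of_eq ?_)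
      field_simp
    have h7 : min δ s * (κ * ‖z‖) ≤ k * ‖z‖ * (κ * ‖z‖) := by gcongr
    have h8 : ((1 : ℝ) / 2 - 1 / 2) * quadForm c z = 0 := by norm_num
    rw [h8]
    linarith

/-- The action is bounded below by a positive constant on the Nehari manifold. -/
theorem exists_le_action (S : Setup n f μ c C p C' q κ) :
    ∃ a, 0 < a ∧ ∀ z ∈ nehari f c, a ≤ action f c z := by
  obtain ⟨δ, hδ, hpos⟩ := S.exists_pos_of_small
  obtain ⟨a, ha, h⟩ := S.exists_mul_norm_le
  refine ⟨a * δ, by positivity, fun z hz => le_trans ?_ (h z hz)⟩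
  gcongr
  by_contra! hlt
  exact (hpos z hz.1 hlt).ne' hz.2

end Setup

/-! ### Test functions as elements of the Sobolev space -/

/-- The derivative of `φ` in the direction `v`, as a function. -/
def pd {E : Type*} [NormedAddCommGroup E] [NormedSpace ℝ E] (v : E) (φ : E → ℝ) (x : E) : ℝ :=
  fderiv ℝ φ x v

/-- Smooth functions with compact support. -/
structure IsTest {E : Type*} [NormedAddCommGroup E] [NormedSpace ℝ E] (φ : E → ℝ) : Prop where
  smooth : ContDiff ℝ ∞ φ
  supp : HasCompactSupport φ

namespace IsTest

theorem pd {E : Type*} [NormedAddCommGroup E] [NormedSpace ℝ E] {φ : E → ℝ} (h : IsTest φ)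
    (v : E) : IsTest (pd v φ) :=
  ⟨(h.smooth.fderiv_right (m := ∞) (by simp)).clm_apply contDiff_const,
    h.supp.fderiv_apply ℝ v⟩

variable {n : ℕ} {φ : Eucl n → ℝ}

theorem memLp (h : IsTest φ) : MemLp φ 2 :=
  h.smooth.continuous.memLp_of_hasCompactSupport h.supp

/-- A test function as an `L²` function. -/
def toLp (h : IsTest φ) : LTwo n := h.memLp.toLp φ

theorem coeFn_toLp (h : IsTest φ) : h.toLp =ᵐ[volume] φ := h.memLp.coeFn_toLp

theorem integrable_mul (h : IsTest φ) {ψ : Eucl n → ℝ} (hψ : Continuous ψ) :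
    Integrable fun x => φ x * ψ x :=
  (h.smooth.continuous.mul hψ).integrable_of_hasCompactSupport h.supp.mul_right

theorem isWeakPartial (h : IsTest φ) (i : Fin n) :
    IsWeakPartial i h.toLp (h.pd (EuclideanSpace.single i 1)).toLp := by
  intro ψ hψ hs
  have e1 : ∫ x, h.toLp x * fderiv ℝ ψ x (EuclideanSpace.single i 1)
      = ∫ x, φ x * fderiv ℝ ψ x (EuclideanSpace.single i 1) := by
    refine integral_congr_ae ?_
    filter_upwards [h.coeFn_toLp] with x hx
    rw [hx]
  have e2 : ∫ x, (h.pd (EuclideanSpace.single i 1)).toLp x * ψ x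
      = ∫ x, fderiv ℝ φ x (EuclideanSpace.single i 1) * ψ x := by
    refine integral_congr_ae ?_
    filter_upwards [(h.pd (EuclideanSpace.single i 1)).coeFn_toLp] with x hx
    rw [hx]; rfl
  rw [e1, e2]
  exact integral_mul_fderiv_eq_neg_fderiv_mul_of_integrable
    ((h.pd (EuclideanSpace.single i 1)).integrable_mul hψ.continuous)
    (h.integrable_mul (continuous_test_partial hψ _)) (h.integrable_mul hψ.continuous)
    (fun x _ => h.smooth.differentiable (by simp) x) (fun x _ => hψ.differentiable (by simp) x)

/-- A test function as an element of `H²`. -/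
def toHTwo (h : IsTest φ) : HTwo n :=
  ⟨WithLp.toLp 2 fun
    | Sum.inl _ => h.toLp
    | Sum.inr (Sum.inl i) => (h.pd (EuclideanSpace.single i 1)).toLp
    | Sum.inr (Sum.inr (i, j)) =>
      ((h.pd (EuclideanSpace.single i 1)).pd (EuclideanSpace.single j 1)).toLp,
    fun i => h.isWeakPartial i, fun _ j => (h.pd _).isWeakPartial j⟩

theorem fnL_toHTwo (h : IsTest φ) : fnL h.toHTwo = h.toLp := rfl

end IsTest

theorem pd_eq_sum {n : ℕ} (c : Eucl n) (φ : Eucl n → ℝ) (x : Eucl n) :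
    pd c φ x = ∑ i, c i * pd (EuclideanSpace.single i 1) φ x := by
  have hc : c = ∑ i, c i • (EuclideanSpace.single i (1 : ℝ) : Eucl n) := by
    ext j; simp [Finset.sum_apply, Pi.single_apply]
  unfold pd
  conv_lhs => rw [hc]
  rw [map_sum]
  simp

theorem coeFn_dirL_toHTwo {n : ℕ} {φ : Eucl n → ℝ} (h : IsTest φ) (c : Eucl n) :
    dirL c h.toHTwo =ᵐ[volume] pd c φ := by
  have h1 : ∀ᵐ x, ∀ i, d1L i h.toHTwo x = pd (EuclideanSpace.single i 1) φ x :=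
    ae_all_iff.2 fun i => (h.pd (EuclideanSpace.single i 1)).coeFn_toLp
  filter_upwards [coeFn_dirL c h.toHTwo, h1] with x hx h1
  rw [hx, pd_eq_sum]
  exact Finset.sum_congr rfl fun i _ => by rw [← h1 i]; rfl

theorem coeFn_laplL_toHTwo {n : ℕ} {φ : Eucl n → ℝ} (h : IsTest φ) :
    laplL h.toHTwo =ᵐ[volume] fun x =>
      ∑ i, pd (EuclideanSpace.single i 1) (pd (EuclideanSpace.single i 1) φ) x := by
  have h1 : ∀ᵐ x, ∀ i, d2L i i h.toHTwo x
      = pd (EuclideanSpace.single i 1) (pd (EuclideanSpace.single i 1) φ) x :=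
    ae_all_iff.2 fun i =>
      ((h.pd (EuclideanSpace.single i 1)).pd (EuclideanSpace.single i 1)).coeFn_toLp
  filter_upwards [coeFn_laplL h.toHTwo, h1] with x hx h1
  rw [hx]
  exact Finset.sum_congr rfl fun i _ => by rw [← h1 i]; rfl

theorem laplacian_eq_sum_pd {n : ℕ} {φ : Eucl n → ℝ} (h : ContDiff ℝ ∞ φ) (x : Eucl n) :
    Laplacian.laplacian φ x
      = ∑ i, pd (EuclideanSpace.single i 1) (pd (EuclideanSpace.single i 1) φ) x := by
  rw [InnerProductSpace.laplacian_eq_iteratedFDeriv_orthonormalBasis φ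
    (EuclideanSpace.basisFun (Fin n) ℝ)]
  refine Finset.sum_congr rfl fun i _ => ?_
  rw [iteratedFDeriv_two_apply]
  have hd : DifferentiableAt ℝ (fderiv ℝ φ) x :=
    ((h.fderiv_right (m := ∞) (by simp)).differentiable (by simp)) x
  simp only [EuclideanSpace.basisFun_apply, Matrix.cons_val_zero, Matrix.cons_val_one]
  have := fderiv_clm_apply hd
    (differentiableAt_const (c := (EuclideanSpace.single i (1:ℝ) : Eucl n)))
  change _ = fderiv ℝ (fun y => fderiv ℝ φ y (EuclideanSpace.single i 1)) x _
  rw [this]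
  simp

theorem IsTest.inner_eq {n : ℕ} {g g' : LTwo n} {φ : Eucl n → ℝ} (h : g' =ᵐ[volume] φ) :
    inner ℝ g g' = ∫ x, g x * φ x := by
  rw [L2.inner_def]
  refine integral_congr_ae ?_
  filter_upwards [h] with x hx
  rw [hx]
  simp [mul_comm]

theorem inner_d1L {n : ℕ} {φ : Eucl n → ℝ} (h : IsTest φ) (w : HTwo n) (i : Fin n) :
    inner ℝ (d1L i w) h.toLp = -inner ℝ (fnL w) (h.pd (EuclideanSpace.single i 1)).toLp := by
  rw [IsTest.inner_eq h.coeFn_toLp, IsTest.inner_eq (h.pd _).coeFn_toLp,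
    eq_neg_iff_add_eq_zero, add_comm, ← eq_neg_iff_add_eq_zero]
  exact w.2.1 i φ h.smooth h.supp

theorem inner_d2L {n : ℕ} {φ : Eucl n → ℝ} (h : IsTest φ) (w : HTwo n) (i j : Fin n) :
    inner ℝ (d2L i j w) h.toLp = inner ℝ (fnL w)
      ((h.pd (EuclideanSpace.single j 1)).pd (EuclideanSpace.single i 1)).toLp := by
  have h1 : inner ℝ (d2L i j w) h.toLp
      = -inner ℝ (d1L i w) (h.pd (EuclideanSpace.single j 1)).toLp := by
    rw [IsTest.inner_eq h.coeFn_toLp, IsTest.inner_eq (h.pd _).coeFn_toLp,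
      eq_neg_iff_add_eq_zero, add_comm, ← eq_neg_iff_add_eq_zero]
    exact w.2.2 i j φ h.smooth h.supp
  rw [h1, inner_d1L, neg_neg]

theorem IsTest.sum {E ι : Type*} [NormedAddCommGroup E] [NormedSpace ℝ E] [Fintype ι]
    {g : ι → E → ℝ} (h : ∀ i, IsTest (g i)) :
    IsTest fun x => ∑ i, g i x := by
  refine ⟨ContDiff.sum fun i _ => (h i).smooth, ?_⟩
  have : (fun x => ∑ i, g i x) = ∑ i, g i := by ext; simp
  rw [this]
  exact Finset.sum_induction g HasCompactSupport (fun _ _ => HasCompactSupport.add)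
    HasCompactSupport.zero fun i _ => (h i).supp

theorem IsTest.laplacian {n : ℕ} {φ : Eucl n → ℝ} (h : IsTest φ) :
    IsTest (Laplacian.laplacian φ) := by
  rw [show Laplacian.laplacian φ = _ from funext (laplacian_eq_sum_pd h.smooth)]
  exact IsTest.sum fun i => (h.pd _).pd _

/-- For a test function in the second slot all derivatives can be moved to that slot. -/
theorem bilin_toHTwo {n : ℕ} {φ : Eucl n → ℝ} (h : IsTest φ) (c : Eucl n) (w : HTwo n) :
    bilin c w h.toHTwo = ∫ x, fnL w x *
      (Laplacian.laplacian (Laplacian.laplacian φ) x + pd c (pd c φ) x + φ x) := by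
  have h1 : inner ℝ (laplL w) (laplL h.toHTwo)
      = ∫ x, fnL w x * Laplacian.laplacian (Laplacian.laplacian φ) x := by
    have e1 : laplL h.toHTwo = h.laplacian.toLp := by
      refine Lp.ext ((coeFn_laplL_toHTwo h).trans ?_)
      filter_upwards [h.laplacian.coeFn_toLp] with x hx
      rw [hx, laplacian_eq_sum_pd h.smooth]
    have e2 : laplL w = ∑ i, d2L i i w := by simp [laplL]
    rw [e1, e2, sum_inner]
    simp only [inner_d2L]
    rw [← inner_sum, IsTest.inner_eq]
    have h2 : ∀ᵐ x, ∀ i, ((h.laplacian.pd (EuclideanSpace.single i 1)).pd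
        (EuclideanSpace.single i 1)).toLp x = pd (EuclideanSpace.single i 1)
          (pd (EuclideanSpace.single i 1) (Laplacian.laplacian φ)) x :=
      ae_all_iff.2 fun i => ((h.laplacian.pd _).pd _).coeFn_toLp
    filter_upwards [coeFn_finset_sum Finset.univ fun i => ((h.laplacian.pd
      (EuclideanSpace.single i 1)).pd (EuclideanSpace.single i 1)).toLp, h2] with x hx h2
    rw [hx, laplacian_eq_sum_pd h.laplacian.smooth]
    exact Finset.sum_congr rfl fun i _ => h2 i
  have h2 : inner ℝ (dirL c w) (dirL c h.toHTwo) = -∫ x, fnL w x * pd c (pd c φ) x := by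
    have e1 : dirL c h.toHTwo = (h.pd c).toLp :=
      Lp.ext ((coeFn_dirL_toHTwo h c).trans (h.pd c).coeFn_toLp.symm)
    have e2 : dirL c w = ∑ i, c i • d1L i w := by simp [dirL]
    rw [e1, e2, sum_inner]
    simp only [inner_smul_left, inner_d1L]
    rw [← integral_neg]
    have h3 : ∀ x, -(fnL w x * pd c (pd c φ) x)
        = ∑ i, -(c i * (fnL w x * pd (EuclideanSpace.single i 1) (pd c φ) x)) := fun x => by
      rw [pd_eq_sum c (pd c φ), Finset.mul_sum, ← Finset.sum_neg_distrib]
      exact Finset.sum_congr rfl fun i _ => by ring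
    simp only [h3]
    have hi : ∀ i, Integrable fun x =>
        -(c i * (fnL w x * pd (EuclideanSpace.single i 1) (pd c φ) x)) := fun i =>
      ((integrable_mul_test (fnL w) ((h.pd c).pd (EuclideanSpace.single i 1)).smooth.continuous
        ((h.pd c).pd _).supp).const_mul _).neg
    rw [integral_finsetSum _ fun i _ => hi i]
    refine Finset.sum_congr rfl fun i _ => ?_
    rw [IsTest.inner_eq ((h.pd c).pd _).coeFn_toLp, integral_neg, integral_const_mul]
    simp
  have i1 := integrable_mul_test (fnL w) h.laplacian.laplacian.smooth.continuous
    h.laplacian.laplacian.supp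
  have i2 := integrable_mul_test (fnL w) ((h.pd c).pd c).smooth.continuous ((h.pd c).pd c).supp
  have i3 := integrable_mul_test (fnL w) h.smooth.continuous h.supp
  have i12 : Integrable fun x => fnL w x * Laplacian.laplacian (Laplacian.laplacian φ) x
      + fnL w x * pd c (pd c φ) x := i1.add i2
  simp only [mul_add]
  rw [bilin_apply, h1, h2, h.fnL_toHTwo, IsTest.inner_eq h.coeFn_toLp, integral_add i12 i3,
    integral_add i1 i2, sub_neg_eq_add]

/-! ### The Nehari manifold is not empty -/

theorem pd_comp_smul {n : ℕ} {φ : Eucl n → ℝ} (h : IsTest φ) (v : Eucl n) (a : ℝ) (x : Eucl n) :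
    pd v (fun y => φ (a • y)) x = a * pd v φ (a • x) := by
  have h1 : HasFDerivAt (fun y : Eucl n => a • y) (a • ContinuousLinearMap.id ℝ (Eucl n)) x :=
    (hasFDerivAt_id x).const_smul a
  have h3 : fderiv ℝ (fun y => φ (a • y)) x = _ :=
    ((h.smooth.differentiable (by simp) (a • x)).hasFDerivAt.comp x h1).fderiv
  unfold pd
  rw [h3]
  simp

theorem IsTest.comp_smul {n : ℕ} {φ : Eucl n → ℝ} (h : IsTest φ) {a : ℝ} (ha : a ≠ 0) :
    IsTest fun x => φ (a • x) :=
  ⟨h.smooth.comp (contDiff_const_smul a), h.supp.comp_smul ha⟩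

theorem pd_pd_comp_smul {n : ℕ} {φ : Eucl n → ℝ} (h : IsTest φ) (v : Eucl n) {a : ℝ}
    (x : Eucl n) : pd v (pd v fun y => φ (a • y)) x = a ^ 2 * pd v (pd v φ) (a • x) := by
  have h1 : pd v (fun y => φ (a • y)) = fun x => a • pd v φ (a • x) :=
    funext fun x => pd_comp_smul h v a x
  rw [h1]
  have h2 := pd_comp_smul (h.pd v) v a x
  unfold pd at h2 ⊢
  rw [fderiv_fun_const_smul, _root_.smul_apply, h2, smul_eq_mul]
  · ring
  · exact (((h.pd v).smooth.comp (contDiff_const_smul a)).differentiable (by simp)) x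

/-- A test function is not constant along a line. -/
theorem integral_sq_pd_pos {n : ℕ} {φ : Eucl n → ℝ} (h : IsTest φ) {c : Eucl n} (hc : c ≠ 0)
    (h0 : φ 0 ≠ 0) : 0 < ∫ x, pd c φ x ^ 2 := by
  obtain ⟨x, hx⟩ : ∃ x, pd c φ x ≠ 0 := by
    by_contra! hcon
    have hd : ∀ s : ℝ, HasDerivAt (fun s : ℝ => φ (s • c)) 0 s := fun s => by
      have h1 : HasDerivAt (fun s : ℝ => s • c) c s := by
        simpa using (hasDerivAt_id s).smul_const c
      have h2 := (h.smooth.differentiable (by simp) (s • c)).hasFDerivAt.comp_hasDerivAt s h1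
      have h3 : fderiv ℝ φ (s • c) c = 0 := hcon _
      rwa [h3] at h2
    have hconst : ∀ s : ℝ, φ (s • c) = φ 0 := fun s => by
      have := is_const_of_deriv_eq_zero (fun s => (hd s).differentiableAt)
        (fun s => (hd s).deriv) s 0
      simpa using this
    obtain ⟨R, hR⟩ := h.supp.isBounded.exists_norm_le
    have hc' : 0 < ‖c‖ := norm_pos_iff.2 hc
    have := hR (((|R| + 1) / ‖c‖) • c) (subset_tsupport φ (by
      rw [Function.mem_support, hconst]; exact h0))
    rw [norm_smul, Real.norm_of_nonneg (by positivity), div_mul_cancel₀ _ hc'.ne'] at this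
    linarith [le_abs_self R]
  have ht := h.pd c
  refine Continuous.integral_pos_of_hasCompactSupport_nonneg_nonzero (x := x)
    (ht.smooth.continuous.pow 2) ?_ (fun _ => sq_nonneg _) (pow_ne_zero 2 hx)
  exact ht.supp.comp_left (g := fun y : ℝ => y ^ 2) (by simp)

theorem sq_norm_eq_of_ae {n : ℕ} {g : LTwo n} {φ : Eucl n → ℝ} (h : g =ᵐ[volume] φ) :
    ‖g‖ ^ 2 = ∫ x, φ x ^ 2 := by
  rw [sq_norm_eq_integral]
  refine integral_congr_ae ?_
  filter_upwards [h] with x hx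
  rw [hx, Real.norm_eq_abs, sq_abs]

/-- Slowly varying test functions: the second derivatives are dominated by the first ones. -/
theorem exists_test_lapl_lt_dir {n : ℕ} {c : Eucl n} (hc : c ≠ 0) :
    ∃ (φ : Eucl n → ℝ) (h : IsTest φ), (∀ x, 0 ≤ φ x)
        ∧ ‖laplL h.toHTwo‖ ^ 2 < ‖dirL c h.toHTwo‖ ^ 2 := by
  let χ : ContDiffBump (0 : Eucl n) := ⟨1, 2, one_pos, one_lt_two⟩
  have hχ : IsTest (χ : Eucl n → ℝ) := ⟨χ.contDiff, χ.hasCompactSupport⟩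
  have hχ0 : (χ : Eucl n → ℝ) 0 ≠ 0 := by
    rw [χ.one_of_mem_closedBall (by simp [χ])]; exact one_ne_zero
  set Y := ∫ x, pd c χ x ^ 2 with hY
  have hY0 : 0 < Y := integral_sq_pd_pos hχ hc hχ0
  set X := ∫ x, (∑ i, pd (EuclideanSpace.single i 1) (pd (EuclideanSpace.single i 1) χ) x) ^ 2
    with hX
  -- stretching by `1 / a` gains a factor `a ^ 2` for second over first derivatives
  obtain ⟨a, haX, ha0⟩ : ∃ a : ℝ, a ^ 2 * X < Y ∧ 0 < a := by
    have : Tendsto (fun a : ℝ => a ^ 2 * X) (𝓝[>] 0) (𝓝 (0 ^ 2 * X)) :=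
      ((by fun_prop : Continuous fun a : ℝ => a ^ 2 * X).tendsto 0).mono_left nhdsWithin_le_nhds
    exact ((this.eventually_lt_const (by simpa using hY0)).and self_mem_nhdsWithin).exists
  refine ⟨_, hχ.comp_smul ha0.ne', fun x => χ.nonneg, ?_⟩
  rw [sq_norm_eq_of_ae (coeFn_laplL_toHTwo _), sq_norm_eq_of_ae (coeFn_dirL_toHTwo _ c)]
  simp only [pd_pd_comp_smul hχ, pd_comp_smul hχ, ← Finset.mul_sum, mul_pow]
  rw [integral_const_mul, integral_const_mul, Measure.integral_comp_smul volume (fun x =>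
    (∑ i, pd (EuclideanSpace.single i 1) (pd (EuclideanSpace.single i 1) χ) x) ^ 2),
    Measure.integral_comp_smul volume (fun x => pd c χ x ^ 2), ← hX, ← hY, smul_eq_mul,
    smul_eq_mul]
  have h1 : 0 < |(a ^ Module.finrank ℝ (Eucl n))⁻¹| := abs_pos.2 (by positivity)
  have h2 : (0:ℝ) < a ^ 2 * |(a ^ Module.finrank ℝ (Eucl n))⁻¹| := by positivity
  calc _ = (a ^ 2 * |(a ^ Module.finrank ℝ (Eucl n))⁻¹|) * (a ^ 2 * X) := by ring
    _ < (a ^ 2 * |(a ^ Module.finrank ℝ (Eucl n))⁻¹|) * Y := mul_lt_mul_of_pos_left haX h2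
    _ = _ := by ring

namespace Setup

variable {n : ℕ} {f : ℝ → ℝ} {μ : ℝ} {c : Eucl n} {C p C' q κ : ℝ}

/-- Large negative multiples of a slowly varying bump have `P_c < 0`, since `-u f(u)` grows at
least like `u ^ 2` at `-∞`. -/
theorem nehari_nonempty (S : Setup n f μ c C p C' q κ) : (nehari f c).Nonempty := by
  obtain ⟨φ, h, hφ0, hlt⟩ := exists_test_lapl_lt_dir S.c_ne
  obtain ⟨M, hM⟩ := S.lower
  set D := ‖dirL c h.toHTwo‖ ^ 2 - ‖laplL h.toHTwo‖ ^ 2 with hD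
  have hD0 : 0 < D := by linarith
  set t := (|M * ∫ x, φ x| + 1) / D with ht
  have ht0 : 0 < t := by positivity
  have hφi : Integrable φ := h.smooth.continuous.integrable_of_hasCompactSupport h.supp
  have hφ2 : Integrable fun x => φ x ^ 2 := by
    simpa [pow_two] using h.integrable_mul h.smooth.continuous
  have h1 : ∫ x, fnL ((-t) • h.toHTwo) x * f (fnL ((-t) • h.toHTwo) x)
      ≤ ∫ x, (-(t ^ 2 * φ x ^ 2) + t * (M * φ x)) := by
    refine integral_mono_ae (S.integrable_mul_self _)
      ((hφ2.const_mul _).neg.add ((hφi.const_mul _).const_mul _)) ?_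
    filter_upwards [fnL_smul_ae (-t) h.toHTwo, h.coeFn_toLp] with x hx hx'
    rw [hx, h.fnL_toHTwo, hx']
    refine (hM _ ?_).trans (le_of_eq (by ring))
    nlinarith [hφ0 x]
  have hi : Integrable fun x => -(t ^ 2 * φ x ^ 2) := (hφ2.const_mul _).neg
  rw [integral_add hi ((hφi.const_mul _).const_mul _), integral_neg,
    integral_const_mul, integral_const_mul, integral_const_mul] at h1
  have h2 : quadForm c h.toHTwo = -D + ∫ x, φ x ^ 2 := by
    rw [quadForm_eq, h.fnL_toHTwo, sq_norm_eq_of_ae h.coeFn_toLp, hD]; ring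
  have h3 : nehariFun f c ((-t) • h.toHTwo) < 0 := by
    rw [nehariFun_eq, quadForm_smul, h2]
    have h4 : t * D = |M * ∫ x, φ x| + 1 := div_mul_cancel₀ _ hD0.ne'
    have h5 := le_abs_self (M * ∫ x, φ x)
    have h6 : t * (-(t * D) + M * ∫ x, φ x) < 0 := mul_neg_of_pos_of_neg ht0 (by linarith)
    nlinarith
  have h7 : (-t) • h.toHTwo ≠ 0 := fun h0 => by
    rw [h0, nehariFun_zero] at h3; exact lt_irrefl _ h3
  obtain ⟨s, -, -, hs⟩ := S.exists_smul_mem_nehari h7 h3.le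
  exact ⟨_, hs⟩

end Setup

/-! ### Translations -/

/-- The translate `x ↦ g (x + y)` of an `L²` function. -/
def shiftLp {n : ℕ} (y : Eucl n) (g : LTwo n) : LTwo n :=
  Lp.compMeasurePreserving (· + y) (measurePreserving_add_right volume y) g

theorem coeFn_shiftLp {n : ℕ} (y : Eucl n) (g : LTwo n) :
    ∀ᵐ x, shiftLp y g x = g (x + y) :=
  Lp.coeFn_compMeasurePreserving g (measurePreserving_add_right volume y)

theorem norm_shiftLp {n : ℕ} (y : Eucl n) (g : LTwo n) : ‖shiftLp y g‖ = ‖g‖ :=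
  Lp.norm_compMeasurePreserving g (measurePreserving_add_right volume y)

theorem IsWeakPartial.shift {n : ℕ} {i : Fin n} {g h : LTwo n} (H : IsWeakPartial i g h)
    (y : Eucl n) : IsWeakPartial i (shiftLp y g) (shiftLp y h) := by
  intro φ hφ hs
  have hφ' : ContDiff ℝ ∞ fun x => φ (x - y) := hφ.comp (contDiff_id.sub contDiff_const)
  have hs' : HasCompactSupport fun x => φ (x - y) := by
    simpa [sub_eq_add_neg, Function.comp_def] using hs.comp_homeomorph (Homeomorph.addRight (-y))
  have key := H _ hφ' hs'
  have e : ∀ (g : LTwo n) (ψ : Eucl n → ℝ), ∫ x, shiftLp y g x * ψ x = ∫ x, g x * ψ (x - y) := by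
    intro g ψ
    rw [← integral_add_right_eq_self (fun x => g x * ψ (x - y)) y]
    refine integral_congr_ae ?_
    filter_upwards [coeFn_shiftLp y g] with x hx
    rw [hx, add_sub_cancel_right]
  rw [e g fun x => fderiv ℝ φ x (EuclideanSpace.single i 1), e h φ, ← key]
  refine integral_congr_ae (Eventually.of_forall fun x => ?_)
  simp only [fderiv_comp_sub]

/-- The translate `x ↦ z (x + y)` of an element of `H²`. -/
def shift {n : ℕ} (y : Eucl n) (z : HTwo n) : HTwo n :=
  ⟨WithLp.toLp 2 fun k => shiftLp y (z.1 k),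
    fun i => (z.2.1 i).shift y, fun i j => (z.2.2 i j).shift y⟩

theorem norm_shift {n : ℕ} (y : Eucl n) (z : HTwo n) : ‖shift y z‖ = ‖z‖ := by
  change ‖(shift y z).1‖ = ‖z.1‖
  rw [PiLp.norm_eq_of_L2, PiLp.norm_eq_of_L2]
  congr 1
  exact Finset.sum_congr rfl fun k _ => congrArg (· ^ 2) (norm_shiftLp y (z.1 k))

theorem fnL_shift {n : ℕ} (y : Eucl n) (z : HTwo n) : fnL (shift y z) = shiftLp y (fnL z) := rfl

theorem integral_comp_shift {n : ℕ} (y : Eucl n) (z : HTwo n) (g : ℝ → ℝ) :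
    ∫ x, g (fnL (shift y z) x) = ∫ x, g (fnL z x) := by
  rw [← integral_add_right_eq_self (fun x => g (fnL z x)) y]
  refine integral_congr_ae ?_
  filter_upwards [coeFn_shiftLp y (fnL z)] with x hx
  rw [fnL_shift, hx]

theorem quadForm_shift {n : ℕ} (c y : Eucl n) (z : HTwo n) :
    quadForm c (shift y z) = quadForm c z := by
  unfold quadForm
  rw [← integral_add_right_eq_self (fun x => lapl z x ^ 2 - dirDeriv c z x ^ 2 + z.1.fn x ^ 2) y]
  have h : ∀ᵐ x, ∀ k, shiftLp y (z.1 k) x = z.1 k (x + y) :=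
    ae_all_iff.2 fun k => coeFn_shiftLp y (z.1 k)
  refine integral_congr_ae ?_
  filter_upwards [h] with x hx
  have h1 : lapl (shift y z) x = lapl z (x + y) := Finset.sum_congr rfl fun i _ => hx _
  have h2 : dirDeriv c (shift y z) x = dirDeriv c z (x + y) :=
    Finset.sum_congr rfl fun i _ => congrArg (c i * ·) (hx _)
  have h3 : (shift y z).1.fn x = z.1.fn (x + y) := hx _
  rw [h1, h2, h3]

theorem nehariFun_shift {n : ℕ} (f : ℝ → ℝ) (c y : Eucl n) (z : HTwo n) :
    nehariFun f c (shift y z) = nehariFun f c z := by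
  rw [Setup.nehariFun_eq, Setup.nehariFun_eq, quadForm_shift,
    integral_comp_shift y z fun u => u * f u]

theorem action_shift {n : ℕ} (f : ℝ → ℝ) (c y : Eucl n) (z : HTwo n) :
    action f c (shift y z) = action f c z := by
  rw [Setup.action_eq, Setup.action_eq, quadForm_shift, integral_comp_shift y z]

theorem shift_mem_nehari {n : ℕ} {f : ℝ → ℝ} {c : Eucl n} {z : HTwo n} (hz : z ∈ nehari f c)
    (y : Eucl n) : shift y z ∈ nehari f c := by
  refine ⟨fun h => hz.1 (norm_eq_zero.1 ?_), by rw [nehariFun_shift]; exact hz.2⟩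
  rw [← norm_shift y, h, norm_zero]

theorem lowPass_shift {n : ℕ} (R : ℝ) (y : Eucl n) (z : HTwo n) :
    lowPass R (fnL (shift y z)) 0 = lowPass R (fnL z) y := by
  rw [lowPass_eq_integral, lowPass_eq_integral, ← integral_add_right_eq_self
    (fun x => (fnL z x : ℂ) * (starRingEnd ℂ) (lowKernel n R (x - y))) y]
  refine integral_congr_ae ?_
  filter_upwards [coeFn_shiftLp y (fnL z)] with x hx
  rw [fnL_shift, hx, sub_zero, add_sub_cancel_right]

/-! ### Splitting of the nonlinear functionals along weakly convergent sequences -/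

theorem exists_two_mul_add_rpow_mul_le {p ε : ℝ} (hp : 0 ≤ p) (hε : 0 < ε) :
    ∃ K, 0 ≤ K ∧ ∀ a b : ℝ, 0 ≤ a → 0 ≤ b →
      (2 * a + b) ^ p * b ≤ ε * a ^ (p + 1) + K * b ^ (p + 1) := by
  set s : ℝ := min 1 (ε / 3 ^ p) with hs
  have hs0 : 0 < s := lt_min one_pos (by positivity)
  refine ⟨(2 / s + 1) ^ p, by positivity, fun a b ha hb => ?_⟩
  have hap : a ^ (p + 1) = a ^ p * a := Real.rpow_add_one' ha (by linarith)
  have hbp : b ^ (p + 1) = b ^ p * b := Real.rpow_add_one' hb (by linarith)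
  rcases le_total b (s * a) with h | h
  · have h1 : b ≤ a := h.trans (mul_le_of_le_one_left ha (min_le_left _ _))
    have h2 : 3 ^ p * s ≤ ε := by
      have : 3 ^ p * s ≤ 3 ^ p * (ε / 3 ^ p) := by gcongr; exact min_le_right _ _
      rwa [mul_div_cancel₀ _ (by positivity)] at this
    have h3 : (2 * a + b) ^ p * b ≤ ε * a ^ (p + 1) := by
      calc (2 * a + b) ^ p * b ≤ (3 * a) ^ p * (s * a) := by gcongr; linarith
        _ = (3 ^ p * s) * a ^ (p + 1) := by rw [Real.mul_rpow (by norm_num) ha, hap]; ring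
        _ ≤ _ := by gcongr
    have : 0 ≤ (2 / s + 1) ^ p * b ^ (p + 1) := by positivity
    linarith
  · have h1 : a ≤ b / s := by rwa [le_div_iff₀ hs0, mul_comm]
    have h3 : (2 * a + b) ^ p * b ≤ (2 / s + 1) ^ p * b ^ (p + 1) := by
      calc (2 * a + b) ^ p * b ≤ ((2 / s + 1) * b) ^ p * b := by
            gcongr
            calc 2 * a + b ≤ 2 * (b / s) + b := by gcongr
              _ = _ := by ring
        _ = _ := by rw [Real.mul_rpow (by positivity) hb, hbp]; ring
    have : 0 ≤ ε * a ^ (p + 1) := by positivity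
    linarith

/-- Brezis–Lieb splitting for superposition operators of polynomial growth. -/
theorem tendsto_integral_sub {n : ℕ} {H : ℝ → ℝ} {A p B : ℝ} (hp : 0 ≤ p)
    (hsub : Subcritical n (p + 1)) (hA : 0 ≤ A) (hc : Continuous H) (h0 : H 0 = 0)
    (hH : ∀ u v, |H u - H v| ≤ A * (|u| + |v|) ^ p * |u - v|) {z : ℕ → HTwo n} {w : HTwo n}
    (hB : ∀ k, ‖z k‖ ≤ B) (hw : ∀ᵐ x, Tendsto (fun k => fnL (z k) x) atTop (𝓝 (fnL w x))) :
    Tendsto (fun k => (∫ x, H (fnL (z k) x)) - ∫ x, H (fnL (z k - w) x)) atTop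
      (𝓝 (∫ x, H (fnL w x))) := by
  have habs : ∀ u, |H u| ≤ A * |u| ^ (p + 1) := fun u => by
    have := hH u 0
    rwa [h0, sub_zero, sub_zero, abs_zero, add_zero, mul_assoc,
      ← Real.rpow_add_one' (abs_nonneg _) (by linarith)] at this
  have hint : ∀ z : HTwo n, Integrable fun x => H (fnL z x) := fun z =>
    ((integrable_rpow_fnL hsub z).const_mul A).mono'
      (hc.comp_aestronglyMeasurable (aestronglyMeasurable_fnL z))
      (Eventually.of_forall fun x => habs _)
  have hri := fun z : HTwo n => integrable_rpow_fnL hsub z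
  let D : ℕ → Eucl n → ℝ := fun k x => H (fnL (z k) x) - H (fnL (z k - w) x) - H (fnL w x)
  have hDi : ∀ k, Integrable (D k) := fun k => ((hint _).sub (hint _)).sub (hint _)
  have hsubae : ∀ᵐ x, ∀ k, fnL (z k - w) x = fnL (z k) x - fnL w x :=
    ae_all_iff.2 fun k => fnL_sub_ae (z k) w
  have hD0 : ∀ᵐ x, Tendsto (fun k => D k x) atTop (𝓝 0) := by
    filter_upwards [hw, hsubae] with x hx hs
    have h1 : Tendsto (fun k => fnL (z k - w) x) atTop (𝓝 0) := by
      simp only [hs]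
      simpa using hx.sub_const (fnL w x)
    have h2 := (((hc.tendsto _).comp hx).sub ((hc.tendsto _).comp h1)).sub_const (H (fnL w x))
    simpa [h0, D, Function.comp_def] using h2
  obtain ⟨E, hE0, hE⟩ := exists_integral_rpow_le hsub
  set M := E * (B + ‖w‖) ^ (p + 1) + 1 with hM
  have hB0 : 0 ≤ B := (norm_nonneg _).trans (hB 0)
  have hM0 : 0 < M := by positivity
  have hvM : ∀ k, ∫ x, |fnL (z k - w) x| ^ (p + 1) ≤ M := fun k => by
    refine (hE _).trans ?_
    have : ‖z k - w‖ ≤ B + ‖w‖ := (norm_sub_le _ _).trans (by linarith [hB k])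
    have : E * ‖z k - w‖ ^ (p + 1) ≤ E * (B + ‖w‖) ^ (p + 1) := by gcongr
    linarith
  -- up to a small multiple of `|z k - w| ^ (p + 1)` the defect is dominated by `|w| ^ (p + 1)`
  have hlim : Tendsto (fun k => ∫ x, |D k x|) atTop (𝓝 0) := by
    rw [Metric.tendsto_atTop]
    intro ε hε
    obtain ⟨K, hK0, hK⟩ := exists_two_mul_add_rpow_mul_le hp
      (show 0 < ε / (2 * M * (A + 1)) by positivity)
    let ε' := A * (ε / (2 * M * (A + 1)))
    have hε' : ε' * M ≤ ε / 2 := by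
      have : ε' * M = ε / 2 * (A / (A + 1)) := by simp only [ε']; field_simp
      rw [this]
      exact mul_le_of_le_one_right (by positivity) ((div_le_one (by positivity)).2 (by linarith))
    have hε'0 : 0 ≤ ε' := by positivity
    let W : ℕ → Eucl n → ℝ := fun k x => max 0 (|D k x| - ε' * |fnL (z k - w) x| ^ (p + 1))
    have hbd : ∀ k, ∀ᵐ x, ‖W k x‖ ≤ (A * K + A) * |fnL w x| ^ (p + 1) := fun k => by
      filter_upwards [fnL_sub_ae (z k) w] with x hx
      rw [Real.norm_of_nonneg (le_max_left _ _)]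
      refine max_le (by positivity) ?_
      have h1 := hH (fnL (z k) x) (fnL (z k - w) x)
      have h2 := hK |fnL (z k - w) x| |fnL w x| (abs_nonneg _) (abs_nonneg _)
      have h3 : |fnL (z k) x| ≤ |fnL (z k - w) x| + |fnL w x| := by
        have : fnL (z k) x = fnL (z k - w) x + fnL w x := by rw [hx]; ring
        rw [this]; exact abs_add_le _ _
      have h4 : fnL (z k) x - fnL (z k - w) x = fnL w x := by rw [hx]; ring
      rw [h4] at h1
      have h5 : |D k x| ≤ |H (fnL (z k) x) - H (fnL (z k - w) x)| + |H (fnL w x)| := abs_sub _ _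
      have h6 : A * (|fnL (z k) x| + |fnL (z k - w) x|) ^ p * |fnL w x|
          ≤ A * ((2 * |fnL (z k - w) x| + |fnL w x|) ^ p * |fnL w x|) := by
        rw [mul_assoc]
        exact mul_le_mul_of_nonneg_left (mul_le_mul_of_nonneg_right
          (Real.rpow_le_rpow (by positivity) (by linarith) hp) (abs_nonneg _)) hA
      have h7 := mul_le_mul_of_nonneg_left h2 hA
      have h8 := habs (fnL w x)
      simp only [ε']
      linarith
    have hWi : Tendsto (fun k => ∫ x, W k x) atTop (𝓝 (∫ _ : Eucl n, (0:ℝ))) := by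
      refine tendsto_integral_of_dominated_convergence _ (fun k => ?_)
        ((hri w).const_mul (A * K + A)) hbd ?_
      · exact (aestronglyMeasurable_const.sup
          ((hDi k).abs.sub ((hri (z k - w)).const_mul ε')).aestronglyMeasurable)
      · filter_upwards [hD0] with x hx
        refine squeeze_zero (fun _ => le_max_left _ _) (fun k => ?_) (by simpa using hx.abs)
        refine max_le (abs_nonneg _) ?_
        have : 0 ≤ ε' * |fnL (z k - w) x| ^ (p + 1) := by positivity
        linarith
    rw [integral_zero] at hWi
    obtain ⟨N, hN⟩ := eventually_atTop.1 (hWi.eventually_lt_const (half_pos hε))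
    refine ⟨N, fun k hk => ?_⟩
    rw [Real.dist_eq, sub_zero, abs_of_nonneg (integral_nonneg fun _ => abs_nonneg _)]
    have hWint : Integrable (W k) :=
      (integrable_zero (Eucl n) ℝ volume).sup ((hDi k).abs.sub ((hri (z k - w)).const_mul ε'))
    have h1 : ∫ x, |D k x| ≤ ∫ x, (W k x + ε' * |fnL (z k - w) x| ^ (p + 1)) := by
      refine integral_mono (hDi k).abs (hWint.add ((hri (z k - w)).const_mul ε')) fun x => ?_
      have : |D k x| - ε' * |fnL (z k - w) x| ^ (p + 1) ≤ W k x := le_max_right _ _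
      linarith
    rw [integral_add hWint ((hri (z k - w)).const_mul ε'), integral_const_mul] at h1
    have h2 : ε' * ∫ x, |fnL (z k - w) x| ^ (p + 1) ≤ ε' * M := by gcongr; exact hvM k
    linarith [hN k hk]
  have hDint : Tendsto (fun k => ∫ x, D k x) atTop (𝓝 0) :=
    squeeze_zero_norm (fun k => norm_integral_le_integral_norm _) hlim
  have := hDint.add_const (∫ x, H (fnL w x))
  rw [zero_add] at this
  refine this.congr fun k => ?_
  have h12 : Integrable fun x => H (fnL (z k) x) - H (fnL (z k - w) x) := (hint _).sub (hint _)
  simp only [D]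
  rw [integral_sub h12 (hint w), integral_sub (hint _) (hint _)]
  ring

theorem tendsto_quadForm_sub {n : ℕ} (c : Eucl n) {z : ℕ → HTwo n} {w : HTwo n}
    (hw : ∀ L : HTwo n →L[ℝ] ℝ, Tendsto (fun k => L (z k)) atTop (𝓝 (L w))) :
    Tendsto (fun k => quadForm c (z k) - quadForm c (z k - w)) atTop (𝓝 (quadForm c w)) := by
  have h1 := ((hw (bilin c w)).const_mul 2).sub_const (quadForm c w)
  have e : 2 * bilin c w w - quadForm c w = quadForm c w := by rw [bilin_self]; ring
  rw [e] at h1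
  refine h1.congr fun k => ?_
  have h2 := quadForm_add c w (z k - w)
  rw [add_sub_cancel, map_sub, bilin_self] at h2
  linarith

namespace Setup

variable {n : ℕ} {f : ℝ → ℝ} {μ : ℝ} {c : Eucl n} {C p C' q κ : ℝ}

theorem tendsto_action_sub (S : Setup n f μ c C p C' q κ) {B : ℝ} {z : ℕ → HTwo n} {w : HTwo n}
    (hB : ∀ k, ‖z k‖ ≤ B)
    (hw : ∀ L : HTwo n →L[ℝ] ℝ, Tendsto (fun k => L (z k)) atTop (𝓝 (L w)))
    (hae : ∀ᵐ x, Tendsto (fun k => fnL (z k) x) atTop (𝓝 (fnL w x))) :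
    Tendsto (fun k => action f c (z k) - action f c (z k - w)) atTop (𝓝 (action f c w)) := by
  have hp := S.lip.one_le
  have h1 := tendsto_integral_sub (by linarith) S.subp S.lip.pos.le S.lip.continuous_primitive
    PolyLipschitz.primitive_zero S.lip.primitive_sub_le hB hae
  refine (((tendsto_quadForm_sub c hw).const_mul (1 / 2)).add h1).congr fun k => ?_
  rw [action_eq, action_eq]; ring

theorem tendsto_nehariFun_sub (S : Setup n f μ c C p C' q κ) {B : ℝ} {z : ℕ → HTwo n}
    {w : HTwo n} (hB : ∀ k, ‖z k‖ ≤ B)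
    (hw : ∀ L : HTwo n →L[ℝ] ℝ, Tendsto (fun k => L (z k)) atTop (𝓝 (L w)))
    (hae : ∀ᵐ x, Tendsto (fun k => fnL (z k) x) atTop (𝓝 (fnL w x))) :
    Tendsto (fun k => nehariFun f c (z k) - nehariFun f c (z k - w)) atTop
      (𝓝 (nehariFun f c w)) := by
  have hp := S.lip.one_le
  have h1 := tendsto_integral_sub (H := fun u => u * f u) (by linarith) S.subp
    (mul_nonneg two_pos.le S.lip.pos.le) (continuous_id.mul S.lip.continuous)
    (by simp) S.lip.mul_sub_le hB hae
  refine ((tendsto_quadForm_sub c hw).add h1).congr fun k => ?_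
  rw [nehariFun_eq, nehariFun_eq]; ring

/-! ### Existence of minimizers over the Nehari manifold -/

/-- The minimal action on the Nehari manifold. -/
def minAction {n : ℕ} (f : ℝ → ℝ) (c : Eucl n) : ℝ := sInf (action f c '' nehari f c)

theorem minAction_le (S : Setup n f μ c C p C' q κ) {z : HTwo n} (hz : z ∈ nehari f c) :
    minAction f c ≤ action f c z := by
  obtain ⟨a, -, h⟩ := S.exists_le_action
  exact csInf_le ⟨a, Set.forall_mem_image.2 h⟩ (Set.mem_image_of_mem _ hz)

theorem minAction_pos (S : Setup n f μ c C p C' q κ) : 0 < minAction f c := by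
  obtain ⟨a, ha, h⟩ := S.exists_le_action
  exact ha.trans_le (le_csInf (S.nehari_nonempty.image _) (Set.forall_mem_image.2 h))

/-- After suitable translations a minimizing sequence has a nonzero weak limit. -/
theorem exists_minimizing_seq (S : Setup n f μ c C p C' q κ) :
    ∃ (z : ℕ → HTwo n) (w : HTwo n) (B : ℝ), 0 < B ∧ (∀ k, z k ∈ nehari f c) ∧ (∀ k, ‖z k‖ ≤ B) ∧
      Tendsto (fun k => action f c (z k)) atTop (𝓝 (minAction f c)) ∧ w ≠ 0 ∧
      (∀ L : HTwo n →L[ℝ] ℝ, Tendsto (fun k => L (z k)) atTop (𝓝 (L w))) ∧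
      ∀ᵐ x, Tendsto (fun k => fnL (z k) x) atTop (𝓝 (fnL w x)) := by
  obtain ⟨a, ha, hbd⟩ := S.exists_mul_norm_le
  obtain ⟨b, -, hb⟩ := S.exists_le_action
  obtain ⟨u, hu, hut, hun⟩ := exists_seq_tendsto_sInf (S.nehari_nonempty.image (action f c))
    ⟨b, Set.forall_mem_image.2 hb⟩
  choose z hz hzu using hun
  set B := u 0 / a + 1 with hBdef
  have hu0 : 0 ≤ u 0 := by
    rw [← hzu]; exact (mul_nonneg ha.le (norm_nonneg _)).trans (hbd _ (hz 0))
  have hB0 : 0 < B := by positivity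
  have hB : ∀ k, ‖z k‖ ≤ B := fun k => by
    have h1 : ‖z k‖ * a ≤ u 0 := by
      rw [mul_comm]; exact ((hbd _ (hz k)).trans (hzu k).le).trans (hu (Nat.zero_le k))
    have := (le_div_iff₀ ha).2 h1
    linarith
  obtain ⟨δ, hδ, hpos⟩ := S.exists_pos_of_small
  obtain ⟨A, -, -, hneg⟩ := S.exists_neg_integral_le
  have hκ := S.κpos
  have hC' := S.posC'
  have hlow : ∀ k, κ * δ ^ 2 / C' ≤ ∫ x, |fnL (z k) x| ^ (q + 1) := fun k => by
    rw [div_le_iff₀' hC']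
    refine le_trans ?_ (hneg (z k))
    have h1 := (hz k).2
    rw [nehariFun_eq] at h1
    have h2 : δ ≤ ‖z k‖ := by
      by_contra! hlt
      exact (hpos _ (hz k).1 hlt).ne' (hz k).2
    have h3 : κ * δ ^ 2 ≤ κ * ‖z k‖ ^ 2 := by gcongr
    linarith [S.coercive (z k)]
  obtain ⟨R, η, hη, hR⟩ := exists_lowPass_ge S.subq (by linarith [S.hq]) hB0
    (show 0 < κ * δ ^ 2 / C' by positivity)
  choose y hy using fun k => hR (z k) (hB k) (hlow k)
  obtain ⟨w, φ, hφ, hw⟩ := exists_weak_subseq (z := fun k => shift (y k) (z k)) (B := B)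
    fun k => by rw [norm_shift]; exact hB k
  obtain ⟨ψ, hψ, hae⟩ := exists_ae_subseq (z := fun k => shift (y (φ k)) (z (φ k))) (B := B)
    (fun k => by rw [norm_shift]; exact hB _) hw
  refine ⟨fun k => shift (y (φ (ψ k))) (z (φ (ψ k))), w, B, hB0,
    fun k => shift_mem_nehari (hz _) _, fun k => by rw [norm_shift]; exact hB _, ?_, ?_,
    fun L => (hw L).comp hψ.tendsto_atTop, hae⟩
  · simp only [action_shift, hzu]
    exact hut.comp (hφ.comp hψ).tendsto_atTop
  · rintro rfl
    have h1 := (tendsto_lowPass hw R 0).norm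
    have h2 : lowPass R (fnL (0 : HTwo n)) 0 = 0 := by
      rw [lowPass_eq_integral]
      refine integral_eq_zero_of_ae ?_
      filter_upwards [fnL_zero_ae] with x hx
      rw [hx]; simp
    rw [h2, norm_zero] at h1
    refine absurd (ge_of_tendsto' h1 fun k => ?_) (not_le.2 hη)
    rw [lowPass_shift]
    exact hy _

/-- If the weak limit had `P_c > 0`, the remainder would carry the constraint with strictly less
action; so the weak limit has `P_c ≤ 0`, and rescaling it gives a minimizer. -/
theorem exists_minimizer (S : Setup n f μ c C p C' q κ) :
    ∃ w : HTwo n, IsNehariMinimizer f c w := by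
  obtain ⟨z, w, B, hB0, hz, hB, hm, hw0, hw, hae⟩ := S.exists_minimizing_seq
  have hmpos := S.minAction_pos
  have hP := S.tendsto_nehariFun_sub hB hw hae
  have hJ : Tendsto (fun k => reducedAction f μ c (z k - w)) atTop
      (𝓝 (minAction f c - reducedAction f μ c w)) := by
    have h1 := (hm.sub (S.tendsto_action_sub hB hw hae)).add (hP.const_mul (1 / μ))
    have e : minAction f c - action f c w + 1 / μ * nehariFun f c w
        = minAction f c - reducedAction f μ c w := by rw [S.reducedAction_eq]; ring
    rw [e] at h1
    refine h1.congr fun k => ?_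
    rw [S.reducedAction_eq, (hz k).2]; ring
  have hJw : reducedAction f μ c w ≤ minAction f c := by
    have := ge_of_tendsto' hJ fun k => S.reducedAction_nonneg (z k - w)
    linarith
  rcases le_or_gt (nehariFun f c w) 0 with hPw | hPw
  · obtain ⟨t, ht0, ht1, ht⟩ := S.exists_smul_mem_nehari hw0 hPw
    refine ⟨t • w, ht, fun v hv => le_trans ?_ (S.minAction_le hv)⟩
    rw [← S.reducedAction_of_mem ht]
    refine (S.reducedAction_smul_le w ht0.le ht1).trans (le_trans ?_ hJw)
    exact mul_le_of_le_one_left (S.reducedAction_nonneg w) ht1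
  · exfalso
    have hPv : Tendsto (fun k => nehariFun f c (z k - w)) atTop (𝓝 (-nehariFun f c w)) := by
      refine hP.neg.congr fun k => ?_
      rw [(hz k).2]; ring
    set B' := B + ‖w‖ with hB'
    have hB'0 : 0 < B' := by positivity
    have hv : ∀ k, ‖z k - w‖ ≤ B' := fun k => (norm_sub_le _ _).trans (by linarith [hB k])
    obtain ⟨K, hK0, hK⟩ := S.exists_mul_self_lipschitz hB'0
    set s := min (1 / 2) (nehariFun f c w / (2 * (K * B' + 1))) with hs
    have hs0 : 0 < s := lt_min (by norm_num) (by positivity)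
    have hs1 : s ≤ 1 / 2 := min_le_left _ _
    have hs2 : K * (s * B') ≤ nehariFun f c w / 2 := by
      have h1 : s * (2 * (K * B' + 1)) ≤ nehariFun f c w :=
        (le_div_iff₀ (by positivity)).1 (min_le_right _ _)
      nlinarith
    -- the remainders can be shrunk by the fixed factor `1 - s` before they meet the manifold
    have hev : ∀ᶠ k in atTop, minAction f c ≤ (1 - s) * reducedAction f μ c (z k - w) := by
      filter_upwards [hPv.eventually_lt_const
        (show -nehariFun f c w < -(nehariFun f c w / 2) by linarith)] with k hk
      have hvne : z k - w ≠ 0 := fun h0 => by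
        rw [h0, nehariFun_zero] at hk; linarith
      have hle : nehariFun f c ((1 - s) • (z k - w)) ≤ 0 := by
        have hn : ‖(1 - s) • (z k - w)‖ ≤ B' := by
          rw [norm_smul, Real.norm_of_nonneg (by linarith)]
          exact (mul_le_of_le_one_left (norm_nonneg _) (by linarith)).trans (hv k)
        have h1 := (abs_le.1 (hK _ _ hn (hv k))).2
        have h2 : ‖(1 - s) • (z k - w) - (z k - w)‖ = s * ‖z k - w‖ := by
          have : (1 - s) • (z k - w) - (z k - w) = -(s • (z k - w)) := by
            rw [sub_smul, one_smul]; abel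
          rw [this, norm_neg, norm_smul, Real.norm_of_nonneg hs0.le]
        rw [h2] at h1
        have h3 : K * (s * ‖z k - w‖) ≤ K * (s * B') := by gcongr; exact hv k
        have h4 : (1 - s) ^ 2 * quadForm c (z k - w) ≤ quadForm c (z k - w) :=
          mul_le_of_le_one_left (S.quadForm_nonneg _) (by nlinarith)
        rw [nehariFun_eq] at hk ⊢
        rw [quadForm_smul]
        linarith
      obtain ⟨t, ht0, ht1, ht⟩ := S.exists_smul_mem_nehari
        (smul_ne_zero (by linarith) hvne) hle
      refine (S.minAction_le ht).trans ?_
      rw [← S.reducedAction_of_mem ht]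
      refine (S.reducedAction_smul_le _ ht0.le ht1).trans ?_
      refine (mul_le_of_le_one_left (S.reducedAction_nonneg _) ht1).trans ?_
      exact S.reducedAction_smul_le _ (by linarith) (by linarith)
    have hfin := ge_of_tendsto (hJ.const_mul (1 - s)) hev
    have h0 := S.reducedAction_nonneg w
    nlinarith

theorem isGroundState_iff (S : Setup n f μ c C p C' q κ) (w : HTwo n) :
    IsGroundState f c w ↔ IsNehariMinimizer f c w := by
  constructor
  · rintro ⟨hw, hmin⟩
    obtain ⟨v, hv⟩ := S.exists_minimizer
    exact ⟨S.critSet_subset_nehari hw, fun z hz =>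
      (hmin v (S.mem_critSet_of_minimizer hv)).trans (hv.2 z hz)⟩
  · intro hw
    exact ⟨S.mem_critSet_of_minimizer hw, fun u hu => hw.2 u (S.critSet_subset_nehari hu)⟩

end Setup

/-! ### Travelling waves -/

theorem pd_pd_comm {E : Type*} [NormedAddCommGroup E] [NormedSpace ℝ E] {φ : E → ℝ}
    (h : IsTest φ) (u v : E) : pd u (pd v φ) = pd v (pd u φ) := by
  have key : ∀ a b x, pd a (pd b φ) x = fderiv ℝ (fderiv ℝ φ) x a b := fun a b x => by
    have hd : DifferentiableAt ℝ (fderiv ℝ φ) x :=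
      ((h.smooth.fderiv_right (m := ∞) (by simp)).differentiable (by simp)) x
    have := fderiv_clm_apply hd (differentiableAt_const (c := b))
    change fderiv ℝ (fun y => fderiv ℝ φ y b) x a = _
    rw [this]
    simp
  funext x
  rw [key, key]
  exact (h.smooth.contDiffAt.isSymmSndFDerivAt (by simp; exact WithTop.coe_le_coe.2 le_top)).eq u v

theorem pd_add_left {E : Type*} [NormedAddCommGroup E] [NormedSpace ℝ E] (u v : E) (φ : E → ℝ) :
    pd (u + v) φ = fun x => pd u φ x + pd v φ x := by
  funext x; simp [pd]

theorem pd_sub_left {E : Type*} [NormedAddCommGroup E] [NormedSpace ℝ E] (u v : E) (φ : E → ℝ) :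
    pd (u - v) φ = fun x => pd u φ x - pd v φ x := by
  funext x; simp [pd]

theorem pd_add {E : Type*} [NormedAddCommGroup E] [NormedSpace ℝ E] {φ ψ : E → ℝ} (h : IsTest φ)
    (h' : IsTest ψ) (v : E) : pd v (fun x => φ x + ψ x) = fun x => pd v φ x + pd v ψ x := by
  funext x
  unfold pd
  rw [fderiv_fun_add (h.smooth.differentiable (by simp) x) (h'.smooth.differentiable (by simp) x)]
  rfl

/-- The wave operator along `v` factors as `∂ₑ² - ∂ᵥ² = (∂ₑ - ∂ᵥ) (∂ₑ + ∂ᵥ)`. -/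
theorem pd_sub_pd_add {E : Type*} [NormedAddCommGroup E] [NormedSpace ℝ E] {φ : E → ℝ}
    (h : IsTest φ) (e v : E) (x : E) :
    pd (e - v) (pd (e + v) φ) x = pd e (pd e φ) x - pd v (pd v φ) x := by
  rw [pd_add_left, pd_add (h.pd e) (h.pd v), pd_sub_left, pd_sub_left, pd_pd_comm h v e]
  ring

theorem IsTest.hasDerivAt_line {E : Type*} [NormedAddCommGroup E] [NormedSpace ℝ E] {φ : E → ℝ}
    (h : IsTest φ) (x v : E) (s : ℝ) :
    HasDerivAt (fun s : ℝ => φ (x + s • v)) (BeamWave.pd v φ (x + s • v)) s := by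
  have h1 : HasDerivAt (fun s : ℝ => x + s • v) v s := by
    simpa using ((hasDerivAt_id s).smul_const v).const_add x
  exact (h.smooth.differentiable (by simp) _).hasFDerivAt.comp_hasDerivAt s h1

/-- The restriction of a function on space-time to the copy of space through `y`. -/
def slice {n : ℕ} (y : ℝ × Eucl n) (φ : ℝ × Eucl n → ℝ) (x : Eucl n) : ℝ := φ (y + (0, x))

/-- The spatial Laplacian of a function on space-time. -/
def spaceLapl {n : ℕ} (φ : ℝ × Eucl n → ℝ) (y : ℝ × Eucl n) : ℝ :=
  ∑ i, pd (0, EuclideanSpace.single i 1) (pd (0, EuclideanSpace.single i 1) φ) y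

section

variable {n : ℕ} {φ : ℝ × Eucl n → ℝ}

theorem IsTest.slice (h : IsTest φ) (y : ℝ × Eucl n) : IsTest (slice y φ) := by
  have hcont : Continuous fun x : Eucl n => y + ((0 : ℝ), x) := by fun_prop
  have hemb : IsClosedEmbedding fun x : Eucl n => y + ((0 : ℝ), x) :=
    Function.LeftInverse.isClosedEmbedding (f := fun q : ℝ × Eucl n => q.2 - y.2)
      (fun x => by simp) (by fun_prop) hcont
  exact ⟨h.smooth.comp (contDiff_const.add (contDiff_const.prodMk contDiff_id)),
    h.supp.comp_isClosedEmbedding hemb⟩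

theorem pd_slice (h : IsTest φ) (y : ℝ × Eucl n) (v : Eucl n) :
    pd v (slice y φ) = slice y (pd (0, v) φ) := by
  funext x
  have h1 : HasFDerivAt (fun x : Eucl n => y + ((0 : ℝ), x))
      (ContinuousLinearMap.inr ℝ ℝ (Eucl n)) x :=
    (ContinuousLinearMap.inr ℝ ℝ (Eucl n)).hasFDerivAt.const_add y
  have h3 : fderiv ℝ (slice y φ) x = _ :=
    ((h.smooth.differentiable (by simp) _).hasFDerivAt.comp x h1).fderiv
  unfold pd
  rw [h3]
  rfl

theorem IsTest.spaceLapl (h : IsTest φ) : IsTest (spaceLapl φ) :=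
  IsTest.sum fun _ => (h.pd _).pd _

theorem laplacian_slice (h : IsTest φ) (y : ℝ × Eucl n) :
    Laplacian.laplacian (slice y φ) = slice y (spaceLapl φ) := by
  funext x
  rw [laplacian_eq_sum_pd (h.slice y).smooth]
  refine Finset.sum_congr rfl fun i _ => ?_
  rw [pd_slice h, pd_slice (h.pd _)]
  rfl

theorem iteratedDeriv_two_time (h : IsTest φ) (t : ℝ) (x : Eucl n) :
    iteratedDeriv 2 (fun s => φ (s, x)) t = pd (1, 0) (pd (1, 0) φ) (t, x) := by
  have e : ∀ (χ : ℝ × Eucl n → ℝ), IsTest χ →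
      deriv (fun s : ℝ => χ (s, x)) = fun s => pd (1, 0) χ (s, x) := fun χ hχ => by
    funext s
    simpa using (hχ.hasDerivAt_line ((0 : ℝ), x) (1, 0) s).deriv
  rw [iteratedDeriv_succ', iteratedDeriv_one, e φ h, e _ (h.pd _)]

end

/-- The shear `(t, x) ↦ (t, x + t c)` of space-time. -/
def shear {n : ℕ} (c : Eucl n) : ℝ × Eucl n ≃ₜ ℝ × Eucl n where
  toFun y := (y.1, y.2 + y.1 • c)
  invFun y := (y.1, y.2 - y.1 • c)
  left_inv y := by simp
  right_inv y := by simp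
  continuous_toFun := by fun_prop
  continuous_invFun := by fun_prop

theorem measurePreserving_shear {n : ℕ} (c : Eucl n) :
    MeasurePreserving (shear c) (volume : Measure (ℝ × Eucl n)) volume := by
  rw [Measure.volume_eq_prod]
  exact (MeasurePreserving.id volume).skew_product (g := fun t x => x + t • c)
    (by fun_prop : Continuous fun y : ℝ × Eucl n => y.2 + y.1 • c).measurable
    (Eventually.of_forall fun t => (measurePreserving_add_right volume (t • c)).map_eq)

theorem locallyIntegrable_comp_shear {n : ℕ} (c : Eucl n) {g : Eucl n → ℝ}
    (hg : LocallyIntegrable g) :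
    LocallyIntegrable fun y : ℝ × Eucl n => g (y.2 + y.1 • c) := by
  rw [locallyIntegrable_iff]
  intro k hk
  have h1 : k = shear c ⁻¹' (shear c '' k) := ((shear c).injective.preimage_image k).symm
  rw [h1]
  refine ((measurePreserving_shear c).integrableOn_comp_preimage (shear c).measurableEmbedding
    (f := fun y => g y.2)).2 ?_
  have hk' : IsCompact (shear c '' k) := hk.image (shear c).continuous
  have h2 : IntegrableOn (fun y : ℝ × Eucl n => g y.2)
      ((Prod.fst '' (shear c '' k)) ×ˢ (Prod.snd '' (shear c '' k))) := by
    rw [IntegrableOn, Measure.volume_eq_prod, ← Measure.prod_restrict]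
    have : IsFiniteMeasure ((volume : Measure ℝ).restrict (Prod.fst '' (shear c '' k))) :=
      isFiniteMeasure_restrict.2 (hk'.image continuous_fst).measure_lt_top.ne
    exact (hg.integrableOn_isCompact (hk'.image continuous_snd)).comp_snd _
  exact h2.mono_set fun y hy => ⟨Set.mem_image_of_mem _ hy, Set.mem_image_of_mem _ hy⟩

theorem integrable_mul_shear {n : ℕ} (c : Eucl n) {g : Eucl n → ℝ} (hg : LocallyIntegrable g)
    {χ : ℝ × Eucl n → ℝ} (h : IsTest χ) :
    Integrable fun y : ℝ × Eucl n => g y.2 * χ (shear c y) := by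
  have h1 := locallyIntegrable_comp_shear 0 hg
  simp only [smul_zero, add_zero] at h1
  exact h1.integrable_smul_right_of_hasCompactSupport (h.smooth.continuous.comp (shear
      c).continuous)
    (h.supp.comp_homeomorph (shear c))

/-- A profile that does not depend on time is orthogonal to derivatives along the shear. -/
theorem integral_mul_pd_shear {n : ℕ} (c : Eucl n) {g : Eucl n → ℝ} (hg : LocallyIntegrable g)
    {χ : ℝ × Eucl n → ℝ} (h : IsTest χ) :
    ∫ y : ℝ × Eucl n, g y.2 * pd (1, c) χ (shear c y) = 0 := by
  have hi := integrable_mul_shear c hg (h.pd (1, c))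
  rw [Measure.volume_eq_prod] at hi ⊢
  rw [integral_prod_symm _ hi]
  refine integral_eq_zero_of_ae (Eventually.of_forall fun x => ?_)
  simp only [Pi.zero_apply]
  rw [integral_const_mul]
  have hcont : Continuous fun s : ℝ => shear c (s, x) := by fun_prop
  have hemb : IsClosedEmbedding fun s : ℝ => shear c (s, x) :=
    Function.LeftInverse.isClosedEmbedding (f := Prod.fst) (fun s => rfl) continuous_fst hcont
  have hint : ∀ θ : ℝ × Eucl n → ℝ, IsTest θ → Integrable fun s : ℝ => θ (shear c (s, x)) :=
    fun θ hθ => (hθ.smooth.continuous.comp hcont).integrable_of_hasCompactSupport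
      (hθ.supp.comp_isClosedEmbedding hemb)
  have hd : ∀ s : ℝ, HasDerivAt (fun s : ℝ => χ (shear c (s, x))) (pd (1, c) χ (shear c (s, x)))
      s := by
    intro s
    have := h.hasDerivAt_line ((0 : ℝ), x) (1, c) s
    simpa [shear] using this
  rw [integral_eq_zero_of_hasDerivAt_of_integrable hd (hint _ (h.pd _)) (hint _ h), mul_zero]

namespace Setup

variable {n : ℕ} {f : ℝ → ℝ} {μ : ℝ} {c : Eucl n} {C p C' q κ : ℝ}

theorem locallyIntegrable_comp (S : Setup n f μ c C p C' q κ) (w : HTwo n) :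
    LocallyIntegrable fun x => f (fnL w x) := by
  have h1 : LocallyIntegrable fun x : Eucl n => C * (1 + |fnL w x| ^ (p + 1)) :=
    ((locallyIntegrable_const (1 : ℝ)).add (integrable_rpow_fnL S.subp w).locallyIntegrable).smul C
  have hp := S.lip.one_le
  have hC := S.lip.pos
  refine h1.mono (S.lip.continuous.comp_aestronglyMeasurable (aestronglyMeasurable_fnL w))
    (Eventually.of_forall fun x => ?_)
  rw [Real.norm_eq_abs, Real.norm_of_nonneg (by positivity)]
  refine (S.lip.abs_le _).trans ?_
  gcongr
  rcases le_total |fnL w x| 1 with h | h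
  · have := Real.rpow_le_one (abs_nonneg (fnL w x)) h (by linarith : 0 ≤ p)
    have : 0 ≤ |fnL w x| ^ (p + 1) := by positivity
    linarith
  · have := Real.rpow_le_rpow_of_exponent_le h (by linarith : p ≤ p + 1)
    linarith

/-- Critical points of the action are profiles of travelling waves. In the moving frame the time
derivatives of a test function differ from `(c · ∇)²` by a derivative in time, against which a
stationary profile integrates to zero; what remains is the critical point equation at each time. -/
theorem isWeakSolution (S : Setup n f μ c C p C' q κ) {w : HTwo n} (hw : w ∈ critSet f c) :
    IsWeakSolution f (travellingWave c w) := by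
  have hg : LocallyIntegrable (fnL w : Eucl n → ℝ) :=
      (Lp.memLp (fnL w)).locallyIntegrable (by norm_num)
  have hfg := S.locallyIntegrable_comp w
  refine ⟨locallyIntegrable_comp_shear c hg, locallyIntegrable_comp_shear c hfg, fun ψ hψ hs => ?_⟩
  have h : IsTest ψ := ⟨hψ, hs⟩
  set e0 : ℝ × Eucl n := (1, 0) with he0
  set ec : ℝ × Eucl n := (0, c) with hec
  -- the test function in the moving frame, apart from the time derivatives
  let θ : ℝ × Eucl n → ℝ := fun y => spaceLapl (spaceLapl ψ) y + pd ec (pd ec ψ) y + ψ y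
  have hθ : IsTest θ := by
    refine ⟨(h.spaceLapl.spaceLapl.smooth.add ((h.pd _).pd _).smooth).add h.smooth, ?_⟩
    exact (h.spaceLapl.spaceLapl.supp.add ((h.pd _).pd _).supp).add h.supp
  have hχ : IsTest (pd (e0 + ec) ψ) := h.pd _
  have hev : e0 - ec = (1, -c) := by simp [he0, hec]
  have hpt : ∀ y : ℝ × Eucl n,
      iteratedDeriv 2 (fun s => ψ (s, y.2)) y.1
        + Laplacian.laplacian (Laplacian.laplacian fun x => ψ (y.1, x)) y.2 + ψ y
      = pd (1, -c) (pd (e0 + ec) ψ) y + θ y := by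
    rintro ⟨t, x⟩
    have e1 : (fun x => ψ (t, x)) = slice (t, 0) ψ := by funext x; simp [slice]
    rw [iteratedDeriv_two_time h, e1, laplacian_slice h, laplacian_slice h.spaceLapl, ← hev,
      pd_sub_pd_add h]
    simp only [slice, θ, Prod.mk_add_mk, add_zero, zero_add, he0]
    ring
  have hmp := measurePreserving_shear (-c)
  rw [← hmp.integral_comp (shear (-c)).measurableEmbedding]
  have hw1 : ∀ y : ℝ × Eucl n, travellingWave c w (shear (-c) y) = fnL w y.2 := by
    intro y; simp [travellingWave, shear, fnL_apply]
  have i1 := integrable_mul_shear (-c) hg (hχ.pd (1, -c))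
  have i2 := integrable_mul_shear (-c) hg hθ
  have i3 := integrable_mul_shear (-c) hfg h
  have i23 : Integrable fun y : ℝ × Eucl n =>
      fnL w y.2 * θ (shear (-c) y) + f (fnL w y.2) * ψ (shear (-c) y) := i2.add i3
  simp only [hpt, hw1]
  have e2 : ∀ y : ℝ × Eucl n,
      fnL w y.2 * (pd (1, -c) (pd (e0 + ec) ψ) (shear (-c) y) + θ (shear (-c) y))
        + f (fnL w y.2) * ψ (shear (-c) y)
      = fnL w y.2 * pd (1, -c) (pd (e0 + ec) ψ) (shear (-c) y)
        + (fnL w y.2 * θ (shear (-c) y) + f (fnL w y.2) * ψ (shear (-c) y)) := fun y => by ring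
  simp only [e2]
  rw [integral_add i1 i23, integral_mul_pd_shear (-c) hg hχ, zero_add]
  rw [Measure.volume_eq_prod] at i23 ⊢
  rw [integral_prod _ i23]
  refine integral_eq_zero_of_ae (Eventually.of_forall fun t => ?_)
  simp only [Pi.zero_apply]
  -- at fixed time this is the critical point equation
  let y : ℝ × Eucl n := (t, t • (-c))
  have hy : ∀ x, shear (-c) (t, x) = y + (0, x) := fun x => by simp [shear, y, add_comm]
  have hcrit := ((S.mem_critSet_iff w).1 hw).2 (h.slice y).toHTwo
  rw [bilin_toHTwo, laplacian_slice h, laplacian_slice h.spaceLapl, pd_slice h,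
    pd_slice (h.pd _)] at hcrit
  have e3 : ∫ x, f (fnL w x) * fnL (h.slice y).toHTwo x = ∫ x, f (fnL w x) * ψ (shear (-c) (t, x))
      := by
    refine integral_congr_ae ?_
    filter_upwards [(h.slice y).coeFn_toLp] with x hx
    rw [IsTest.fnL_toHTwo, hx, hy]; rfl
  have j2 : Integrable fun x => fnL w x * θ (shear (-c) (t, x)) := by
    simp only [hy]
    exact integrable_mul_test (fnL w) (hθ.slice y).smooth.continuous (hθ.slice y).supp
  have j3 : Integrable fun x => f (fnL w x) * ψ (shear (-c) (t, x)) := by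
    simp only [hy]
    exact hfg.integrable_smul_right_of_hasCompactSupport (h.slice y).smooth.continuous
      (h.slice y).supp
  rw [integral_add j2 j3, ← e3, ← hcrit]
  simp only [hy]
  rfl

end Setup

end BeamWave

end

theorem theorem3p1 (n : ℕ) (hn : 1 ≤ n) (f : ℝ → ℝ) (μ : ℝ) (c : BeamWave.Eucl n)
    (h1 : BeamWave.A1 f) (h2 : BeamWave.A2 n f) (h3 : BeamWave.A3 f μ) (h4 : BeamWave.A4 f)
    (hc0 : 0 < ‖c‖) (hc : ‖c‖ < √2) :
    (2 < μ → ∃ w : BeamWave.HTwo n, BeamWave.IsGroundState f c w ∧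
        BeamWave.IsWeakSolution f (BeamWave.travellingWave c w)) ∧
      (μ = 2 → n ≤ 3 → ∃ w : BeamWave.HTwo n, BeamWave.IsGroundState f c w ∧
        BeamWave.IsWeakSolution f (BeamWave.travellingWave c w)) ∧
      ∀ w : BeamWave.HTwo n,
        BeamWave.IsGroundState f c w ↔ BeamWave.IsNehariMinimizer f c w := by
  obtain ⟨C, p, C', q, κ, S⟩ := BeamWave.exists_setup h1 h2 h3 h4 hc0 hc
  have hex : ∃ w : BeamWave.HTwo n, BeamWave.IsGroundState f c w ∧
      BeamWave.IsWeakSolution f (BeamWave.travellingWave c w) := by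
    obtain ⟨w, hw⟩ := S.exists_minimizer
    exact ⟨w, (S.isGroundState_iff w).2 hw, S.isWeakSolution (S.mem_critSet_of_minimizer hw)⟩
  exact ⟨fun _ => hex, fun _ _ => hex, S.isGroundState_iff⟩
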